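/- Let $d\ge 3$, let $W\subset\mathbb R^d$ be convex with $\mathrm{vol}_d(W)=1$, let $L\subset\mathbb R^d$ be a fixed two-dimensional linear subspace, and write $x|_L$ for the orthogonal projection of $x$ onto $L$. For $t>0$ let $V=\{v_1,\dots,v_n\}$ be a Poisson point process of intensity $t$ in $W$: $n$ is Poisson distributed with parameter $t$ and, independently of $n$, the points $v_1,v_2,\dots$ are independent and uniformly distributed in $W$. Let $\delta_t>0$ with $\delta_t\to 0$ as $t\to\infty$, and assume that the limit $\ell=\lim_{t\to\infty}\frac1{t\delta_t^d}\in[0,\infty)$ exists. Put $[u,v]$ for the segment between $u$ and $v$ if $\|u-v\|\le\delta_t$ and $[u,v]=\emptyset$ otherwise, and write $V^k_{\ne}$ for the set of ordered $k$-tuples of pairwise distinct points of $V$. Let $G$ be the random geometric graph with vertex set $V$, two distinct points being adjacent iff their distance is at most $\delta_t$, and let $G_L$ be its projection onto $L$. Its rectilinear crossing number is $$\overline{\mathrm{cr}}(G_L)=\frac18\sum_{(v_1,v_2,v_3,v_4)\in V^4_{\ne}}\mathbf 1\bigl([v_1,v_2]|_L\cap[v_3,v_4]|_L\ne\emptyset\bigr).$$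 Let $d_0(x,y)=\|x-y\|$ and $d_L(x,y)=\|x|_L-y|_L\|$, let $w$ be a measurable weight function that on $W$ is symmetric, $w(x,y)=w(y,x)$, and positive, $w(x,y)>0$ for $x\neq y$, put $q(x,y)=w(x,y)\,(d_0(x,y)-d_L(x,y))^2$, assume $\int_{W^2}q(x,y)^2\,dx\,dy<\infty$, and let $$\mathrm{stress}(G,G_L)=\frac12\sum_{(v_1,v_2)\in V^2_{\ne}}q(v_1,v_2).$$ Let $\kappa_d$ be the volume of the unit ball $B_d$ of $\mathbb R^d$, let $2B_2$ be the disc of radius $2$ about $0$ in $L$, and let $$c_d=\int_{B_d}\int_{2B_2}\int_{B_d}\mathbf 1\bigl(\{s\,x|_L:0\le s\le1\}\cap\{y+s\,z|_L:0\le s\le1\}\ne\emptyset\bigr)\,dz\,dy\,dx,$$ a constant that depends only on $d$ and not on $L$. For $v\in\mathbb R^d$ let $\sigma(v)=\mathrm{vol}_{d-2}\bigl((v+L^\perp)\cap W\bigr)$, and let $$I^{(3)}(W,L)=\int_{W|_L}\sigma(v)^3\,dv,\qquad S^{(2)}(W,L)=\int_{W^3}q(v,v_1)\,q(v,v_2)\,dv_1\,dv_2\,dv.$$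 Then the correlation coefficient of $\overline{\mathrm{cr}}(G_L)$ and $\mathrm{stress}(G,G_L)$ with respect to $V$ converges as $t\to\infty$, and $$\lim_{t\to\infty}\mathrm{Corr}_V\bigl(\overline{\mathrm{cr}}(G_L),\mathrm{stress}(G,G_L)\bigr)\;\ge\;\frac{\displaystyle\int_{W}\int_W\sigma(v)\,q(v,v_1)\,dv_1\,dv}{\Bigl(1+\frac{2\pi\kappa_d}{c_d}\,\ell\Bigr)^{1/2}\,I^{(3)}(W,L)^{1/2}\,S^{(2)}(W,L)^{1/2}}\;>\;0 .$$ -/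

import Mathlib

open MeasureTheory ProbabilityTheory Filter Topology Set
open scoped NNReal ENNReal

noncomputable section

/-- Euclidean space `ℝ^d`. -/
abbrev Euc (d : ℕ) : Type := EuclideanSpace ℝ (Fin d)

namespace RGG

variable {d : ℕ}

/-! ### The point process -/

/-- The random variables that generate a Poisson point process of intensity `t` in a set `W` of
volume one: a Poisson distributed number `N` with parameter `t`, and, independently of it, a
sequence of independent points `X 0, X 1, …` that are uniformly distributed in `W`. The point
process is `{X 0, …, X (N - 1)}`, see `pointSet`. -/
structure IsPoissonSample {Ω : Type*} [MeasurableSpace Ω] (P : Measure Ω) (t : ℝ)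
    (W : Set (Euc d)) (N : Ω → ℕ) (X : ℕ → Ω → Euc d) : Prop where
  measurable_count : Measurable N
  measurable_point : ∀ i, Measurable (X i)
  law_count : P.map N = poissonMeasure t.toNNReal
  law_point : ∀ i, pdf.IsUniform (X i) W P volume
  indep_points : iIndepFun X P
  indep_count : IndepFun N (fun ω i => X i ω) P

open Classical in
/-- The vertex set `V = {X 0, …, X (N - 1)}`. -/
def pointSet {Ω : Type*} (N : Ω → ℕ) (X : ℕ → Ω → Euc d) (ω : Ω) : Finset (Euc d) :=
  (Finset.range (N ω)).image (fun i => X i ω)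

open Classical in
/-- `V^k_≠`: the ordered `k`-tuples of pairwise distinct elements of `V`. -/
def distinctTuples (k : ℕ) (V : Finset (Euc d)) : Finset (Fin k → Euc d) :=
  (Fintype.piFinset (fun _ : Fin k => V)).filter Function.Injective

/-- The U-statistic `∑_{v ∈ V^k_≠} f(v)`. -/
def uStat (k : ℕ) (f : (Fin k → Euc d) → ℝ) (V : Finset (Euc d)) : ℝ :=
  ∑ v ∈ distinctTuples k V, f v

/-! ### Crossing number and stress of the projected random geometric graph -/

/-- The orthogonal projection `x ↦ x|_L` onto the linear subspace `L`. -/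
def proj (L : Submodule ℝ (Euc d)) (x : Euc d) : L := L.orthogonalProjectionOnto x

open Classical in
/-- The straight-line edge between `u` and `v` in the geometric graph with distance parameter `δ`:
the segment `[u, v]` if the distance of the points is at most `δ`, and the empty set otherwise. -/
def edgeSegment (δ : ℝ) (u v : Euc d) : Set (Euc d) :=
  if dist u v ≤ δ then segment ℝ u v else ∅

open Classical in
/-- The rectilinear crossing number of the projection onto `L` of the geometric graph
with vertex set `V` and distance parameter `δ`. -/
def crossingNumber (δ : ℝ) (L : Submodule ℝ (Euc d)) (V : Finset (Euc d)) : ℝ :=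
  (1 / 8) * uStat 4 (fun v =>
    if ((proj L '' edgeSegment δ (v 0) (v 1)) ∩ (proj L '' edgeSegment δ (v 2) (v 3))).Nonempty
    then 1 else 0) V

/-- The weighted squared distortion `w(x, y) (d₀(x, y) - d_L(x, y))²`, where `d₀` is the distance
of `x` and `y`, and `d_L` the distance of their projections onto `L`. -/
def distortion (w : Euc d → Euc d → ℝ) (L : Submodule ℝ (Euc d)) (x y : Euc d) : ℝ :=
  w x y * (dist x y - dist (proj L x) (proj L y)) ^ 2

/-- The stress of the projection onto `L`. -/
def stress (w : Euc d → Euc d → ℝ) (L : Submodule ℝ (Euc d)) (V : Finset (Euc d)) : ℝ :=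
  (1 / 2) * uStat 2 (fun v => distortion w L (v 0) (v 1)) V

/-- The correlation coefficient of two real random variables. -/
def corr {Ω : Type*} [MeasurableSpace Ω] (P : Measure Ω) (Y Z : Ω → ℝ) : ℝ :=
  covariance Y Z P / (√(variance Y P) * √(variance Z P))

/-! ### The constants in the bound -/

/-- `κ_d`, the volume of the unit ball in `ℝ^d`. -/
def kappa (d : ℕ) : ℝ := (volume (Metric.closedBall (0 : Euc d) 1)).toReal

open Classical in
/-- The constant
`∫_{B_d × 2B_2 × B_d} 1([0, x|_L] ∩ (y + [0, z|_L]) ≠ ∅) dz dy dx`, where `2B_2` is the disc of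
radius two in the plane `L`. It is the same for all planes, see `crossConst_eq`. -/
def crossConst (L : Submodule ℝ (Euc d)) : ℝ :=
  ∫ x in Metric.closedBall (0 : Euc d) 1, ∫ y in Metric.closedBall (0 : L) 2,
    ∫ z in Metric.closedBall (0 : Euc d) 1,
      if (segment ℝ 0 (proj L x) ∩ ((fun p => y + p) '' segment ℝ 0 (proj L z))).Nonempty
      then 1 else 0

/-- `vol_{d-2}((v + L^⊥) ∩ W)` for a plane `L`: the Lebesgue measure, in the Euclidean
space `L^⊥`, of the section translated by `-v`. -/
def sectionVol (W : Set (Euc d)) (L : Submodule ℝ (Euc d)) (v : Euc d) : ℝ :=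
  (volume {u : Lᗮ | v + (u : Euc d) ∈ W}).toReal

/-- `I^{(3)}(W, L) = ∫_{W|_L} vol_{d-2}((v + L^⊥) ∩ W)³ dv`. -/
def sectionIntegral (W : Set (Euc d)) (L : Submodule ℝ (Euc d)) : ℝ :=
  ∫ v in proj L '' W, sectionVol W L (v : Euc d) ^ 3

/-- `S^{(2)}(W, L) = ∫_{W³} ∏_{i = 1, 2} w(v, v_i) (d₀(v, v_i) - d_L(v, v_i))² dv_1 dv_2 dv`. -/
def stressIntegral (W : Set (Euc d)) (L : Submodule ℝ (Euc d)) (w : Euc d → Euc d → ℝ) : ℝ :=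
  ∫ v in W, ∫ v₁ in W, ∫ v₂ in W, distortion w L v v₁ * distortion w L v v₂

/-- The lower bound for the limiting correlation coefficient, with `ℓ = lim 1 / (t δ_t^d)`. -/
def corrBound (W : Set (Euc d)) (L : Submodule ℝ (Euc d)) (w : Euc d → Euc d → ℝ) (ℓ : ℝ) : ℝ :=
  (∫ v in W, ∫ v₁ in W, sectionVol W L v * distortion w L v v₁) /
    (√(1 + 2 * Real.pi * kappa d / crossConst L * ℓ) *
      √(sectionIntegral W L) * √(stressIntegral W L w))

/-- `crossConst` depends only on the dimensions, not on the choice of the subspace. -/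
theorem crossConst_eq (L M : Submodule ℝ (Euc d))
    (h : Module.finrank ℝ L = Module.finrank ℝ M) : crossConst L = crossConst M := by
  classical
  let e : L ≃ₗᵢ[ℝ] M := (stdOrthonormalBasis ℝ L).equiv (stdOrthonormalBasis ℝ M) (finCongr h)
  let T0 : Euc d →ₗᵢ[ℝ] Euc d := LinearIsometry.extend (M.subtypeₗᵢ.comp e.toLinearIsometry)
  have hT0 : ∀ x : L, T0 x = (e x : Euc d) := fun x =>
    LinearIsometry.extend_apply (M.subtypeₗᵢ.comp e.toLinearIsometry) x
  let T : Euc d ≃ₗᵢ[ℝ] Euc d := T0.toLinearIsometryEquiv rfl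
  have hT : ∀ x : L, T x = (e x : Euc d) := hT0
  have hproj : ∀ x, proj M (T x) = e (proj L x) := by
    intro x
    refine Subtype.ext ?_
    refine Submodule.eq_starProjection_of_mem_of_inner_eq_zero (K := M) (Subtype.mem _) ?_
    intro m hm
    have hm' : m = T (e.symm ⟨m, hm⟩ : L) := by rw [hT]; simp
    rw [hm', ← hT, ← map_sub, LinearIsometryEquiv.inner_map_map]
    exact Submodule.starProjection_inner_eq_zero x _ (Subtype.mem _)
  have hT_ball : ∀ f : Euc d → ℝ, ∫ x in Metric.closedBall (0 : Euc d) 1, f x =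
      ∫ x in Metric.closedBall (0 : Euc d) 1, f (T x) := by
    intro f
    have := T.measurePreserving.setIntegral_preimage_emb
      T.toHomeomorph.measurableEmbedding f (Metric.closedBall 0 1)
    rw [← this, T.preimage_closedBall]; simp
  have he_ball : ∀ f : M → ℝ, ∫ x in Metric.closedBall (0 : M) 2, f x =
      ∫ x in Metric.closedBall (0 : L) 2, f (e x) := by
    intro f
    have := e.measurePreserving.setIntegral_preimage_emb
      e.toHomeomorph.measurableEmbedding f (Metric.closedBall 0 2)
    rw [← this, e.preimage_closedBall]; simp
  have hseg : ∀ p : L, segment ℝ 0 (e p) = e '' segment ℝ 0 p := by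
    intro p
    have := image_segment ℝ (e : L →ₗ[ℝ] M).toAffineMap 0 p
    simpa using this.symm
  symm
  unfold crossConst
  rw [hT_ball]
  refine integral_congr_ae (Eventually.of_forall fun x => ?_)
  simp only
  rw [he_ball]
  refine integral_congr_ae (Eventually.of_forall fun y => ?_)
  simp only
  rw [hT_ball]
  refine integral_congr_ae (Eventually.of_forall fun z => ?_)
  simp only [hproj, hseg]
  have : (fun p : M => e y + p) '' (e '' segment ℝ 0 (proj L z)) =
      e '' ((fun p : L => y + p) '' segment ℝ 0 (proj L z)) := by
    simp only [Set.image_image, map_add]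
  rw [this, ← Set.image_inter e.injective, Set.image_nonempty]

end RGG

end

/-! Up to the factors 1/8 and 1/2, both statistics are sums of a nonnegative kernel over tuples of
distinct Poisson points. A product of two such sums splits according to which points the two tuples
share (`tupleSum_mul_tupleSum`). By the Mecke formula (`IsPoissonSample.lintegral_tupleSum`) each
sharing pattern φ contributes a power of t times the integral `pairTerm`. The empty pattern is the
product of the expectations, so the covariance is the sum over the nonempty patterns
(`IsPoissonSample.covariance_tupleSum`).

It remains to find the size of each pattern as δ → 0. A second edge meets a given edge only if its
starting point has projection within 2δ, which costs δ² in the plane and leaves the coordinate in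
`Lᗮ` free; the two edge vectors cost δ^d each. Write c for `crossConst L`, σ for the section volume,
H for the integral of the squared area `edgeInt`, I for ∫ σ² over the interior of W (equal to I⁽³⁾
by Fubini), S for S⁽²⁾ and A for ∫∫ σ q.

For two crossings, each of the 16 patterns with one common vertex gives t⁷δ^(4d+4) c² I. Each of the
8 patterns with a common edge gives t⁶δ^(3d+4) H I, smaller by 1/(tδ^d) → ℓ. All other patterns lose
a further δ^(d-2), which vanishes since d ≥ 3. For a crossing and a stress pair, 8 patterns give
t⁵δ^(2d+2) c A; for two stress pairs, 4 patterns give t³ S. The powers of t and δ cancel in the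
correlation, whose limit is A / (√(1 + H ℓ / (2c²)) √I √S). The bound follows from H ≤ 4πκ_d c
(`toReal_edgeIntPow_two_le`).

Throughout, W is replaced by its interior O: the frontier of a convex set is null, and openness
supplies measurability, positive sections and local constancy of the indicator. -/

namespace RGG

/-! ### Sums over tuples of distinct points, and their products -/

section TupleSum

variable {ι κ E : Type*}

open Classical in
/-- The sum of `F` over the tuples of pairwise distinct elements of `V`. -/
noncomputable def tupleSum [Fintype ι] (F : (ι → E) → ℝ≥0∞) (V : Finset E) : ℝ≥0∞ :=
  ∑ v ∈ (Fintype.piFinset fun _ : ι => V).filter Function.Injective, F v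

/-- The partial injections from `κ` to `ι`. -/
def matchings (ι κ : Type*) [Fintype ι] [Fintype κ] [DecidableEq ι] [DecidableEq κ] :
    Finset (κ → Option ι) :=
  Finset.univ.filter fun φ => ∀ j j', φ j ≠ none → φ j = φ j' → j = j'

/-- The indices that are left out by a partial injection. -/
def freeIdx [Fintype κ] (φ : κ → Option ι) : Finset κ :=
  Finset.univ.filter fun j => φ j = none

theorem mem_freeIdx [Fintype κ] {φ : κ → Option ι} {j : κ} : j ∈ freeIdx φ ↔ φ j = none := by
  simp [freeIdx]

/-- The tuple indexed by `κ` that is obtained from a tuple indexed by `ι` by means of a partial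
injection. -/
def pullIdx [Zero E] (φ : κ → Option ι) (x : ι → E) : κ → E :=
  fun j => (φ j).elim 0 x

/-- The tuple indexed by `κ` that extends `pullIdx` by prescribed values at the free indices. -/
def glue [Fintype κ] [Zero E] [DecidableEq κ] (φ : κ → Option ι) (x : ι → E)
    (z : freeIdx φ → E) : κ → E :=
  Function.updateFinset (pullIdx φ x) (freeIdx φ) z

theorem glue_of_none [Fintype κ] [Zero E] [DecidableEq κ] {φ : κ → Option ι} {x : ι → E}
    {z : freeIdx φ → E}
    {j : κ} (h : φ j = none) : glue φ x z j = z ⟨j, mem_freeIdx.2 h⟩ := by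
  simp [glue, Function.updateFinset, mem_freeIdx, h]

theorem glue_of_some [Fintype κ] [Zero E] [DecidableEq κ] {φ : κ → Option ι} {x : ι → E}
    {z : freeIdx φ → E}
    {j : κ} {i : ι} (h : φ j = some i) : glue φ x z j = x i := by
  simp [glue, Function.updateFinset, mem_freeIdx, h, pullIdx]

/-- The product of `F` and `G`, where the arguments of `G` are identified with arguments of `F` by
a partial injection. -/
noncomputable def mergeFun [Fintype κ] [Zero E] [DecidableEq κ] (φ : κ → Option ι)
    (F : (ι → E) → ℝ≥0∞)
    (G : (κ → E) → ℝ≥0∞) (x : ι ⊕ freeIdx φ → E) : ℝ≥0∞ :=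
  F (x ∘ Sum.inl) * G (glue φ (x ∘ Sum.inl) (x ∘ Sum.inr))

open Classical in
/-- The partial injection that records the common entries of two tuples. -/
noncomputable def pattern (v : ι → E) (u : κ → E) (j : κ) : Option ι :=
  if h : ∃ i, v i = u j then some h.choose else none

theorem pattern_eq_some {v : ι → E} (hv : Function.Injective v) {u : κ → E} {i : ι} {j : κ} :
    pattern v u j = some i ↔ v i = u j := by
  unfold pattern
  split_ifs with h
  · rw [Option.some_inj]
    exact ⟨fun e => e ▸ h.choose_spec, fun e => hv (h.choose_spec.trans e.symm)⟩
  · simp only [false_iff]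
    exact fun e => h ⟨i, e⟩

theorem pattern_eq_none {v : ι → E} {u : κ → E} {j : κ} :
    pattern v u j = none ↔ ∀ i, v i ≠ u j := by
  unfold pattern
  split_ifs with h
  · simpa using h
  · simpa using h

/-- Pairs of tuples are grouped by their `pattern`, which is a partial injection because both tuples
are injective. Within one group, keeping the first tuple and the unmatched entries of the second
loses nothing and yields exactly the injective tuples on `ι ⊕ freeIdx φ`. -/
theorem tupleSum_mul_tupleSum [Fintype ι] [Fintype κ] [Zero E] [DecidableEq ι] [DecidableEq κ]
    (F : (ι → E) → ℝ≥0∞)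
    (G : (κ → E) → ℝ≥0∞) (V : Finset E) :
    tupleSum F V * tupleSum G V = ∑ φ ∈ matchings ι κ, tupleSum (mergeFun φ F G) V := by
  classical
  unfold tupleSum
  rw [Finset.sum_mul_sum, ← Finset.sum_product',
    ← Finset.sum_fiberwise_of_maps_to (g := fun p : (ι → E) × (κ → E) => pattern p.1 p.2)
      (t := matchings ι κ)]
  · refine Finset.sum_congr rfl fun φ hφ => ?_
    have hφ' : ∀ j j', φ j ≠ none → φ j = φ j' → j = j' := by simpa [matchings] using hφ
    refine Finset.sum_bij' (fun p _ => Sum.elim p.1 fun j => p.2 j)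
      (fun x _ => (x ∘ Sum.inl, glue φ (x ∘ Sum.inl) (x ∘ Sum.inr))) ?_ ?_ ?_ ?_ ?_
    · rintro ⟨v, u⟩ h
      simp only [Finset.mem_filter, Finset.mem_product, Fintype.mem_piFinset] at h ⊢
      obtain ⟨⟨⟨hvV, hv⟩, huV, hu⟩, rfl⟩ := h
      refine ⟨?_, hv.sumElim (hu.comp Subtype.val_injective) ?_⟩
      · rintro (i | j)
        · exact hvV i
        · exact huV j
      · rintro i ⟨j, hj⟩
        exact pattern_eq_none.1 (mem_freeIdx.1 hj) i
    · intro x h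
      simp only [Finset.mem_filter, Finset.mem_product, Fintype.mem_piFinset] at h ⊢
      obtain ⟨hxV, hx⟩ := h
      have hinl : Function.Injective (x ∘ Sum.inl) := hx.comp Sum.inl_injective
      have hcases : ∀ j, (∃ h : φ j = none, glue φ (x ∘ Sum.inl) (x ∘ Sum.inr) j =
          x (Sum.inr ⟨j, mem_freeIdx.2 h⟩)) ∨ ∃ i, φ j = some i ∧
          glue φ (x ∘ Sum.inl) (x ∘ Sum.inr) j = x (Sum.inl i) := by
        intro j
        by_cases hj : φ j = none
        · exact Or.inl ⟨hj, glue_of_none hj⟩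
        · obtain ⟨i, hi⟩ := Option.ne_none_iff_exists'.1 hj
          exact Or.inr ⟨i, hi, glue_of_some hi⟩
      refine ⟨⟨⟨fun i => hxV _, hinl⟩, fun j => ?_, fun j j' e => ?_⟩, funext fun j => ?_⟩
      · rcases hcases j with ⟨h, e⟩ | ⟨i, h, e⟩ <;> rw [e] <;> exact hxV _
      · rcases hcases j with ⟨h, e1⟩ | ⟨i, h, e1⟩ <;> rcases hcases j' with ⟨h', e2⟩ | ⟨i', h', e2⟩
        · rw [e1, e2] at e
          simpa using hx e
        · rw [e1, e2] at e
          simpa using hx e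
        · rw [e1, e2] at e
          simpa using hx e
        · rw [e1, e2] at e
          have : i = i' := by simpa using hx e
          exact hφ' j j' (by simp [h]) (by rw [h, h', this])
      · rcases hcases j with ⟨h, e1⟩ | ⟨i, h, e1⟩
        · rw [h, pattern_eq_none]
          intro i e
          rw [e1] at e
          simpa using hx e
        · rw [h, pattern_eq_some hinl, e1]
          rfl
    · rintro ⟨v, u⟩ h
      simp only [Finset.mem_filter, Finset.mem_product, Fintype.mem_piFinset] at h
      obtain ⟨⟨⟨hvV, hv⟩, huV, hu⟩, rfl⟩ := h
      refine Prod.ext rfl (funext fun j => ?_)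
      rcases hj : pattern v u j with _ | i
      · exact glue_of_none hj
      · exact (glue_of_some hj).trans ((pattern_eq_some hv).1 hj)
    · intro x h
      funext s
      rcases s with i | ⟨j, hj⟩
      · rfl
      · exact glue_of_none (mem_freeIdx.1 hj)
    · rintro ⟨v, u⟩ h
      simp only [Finset.mem_filter, Finset.mem_product, Fintype.mem_piFinset] at h
      obtain ⟨⟨⟨hvV, hv⟩, huV, hu⟩, rfl⟩ := h
      have : glue (pattern v u) v (fun j : freeIdx (pattern v u) => u j) = u := by
        funext j
        rcases hj : pattern v u j with _ | i
        · exact glue_of_none hj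
        · exact (glue_of_some hj).trans ((pattern_eq_some hv).1 hj)
      change F v * G u = F v * G (glue (pattern v u) v fun j : freeIdx (pattern v u) => u j)
      rw [this]
  · rintro ⟨v, u⟩ h
    simp only [Finset.mem_filter, Finset.mem_product, Fintype.mem_piFinset] at h
    obtain ⟨⟨hvV, hv⟩, huV, hu⟩ := h
    simp only [matchings, Finset.mem_filter, Finset.mem_univ, true_and]
    intro j j' hj e
    obtain ⟨i, hi⟩ := Option.ne_none_iff_exists'.1 hj
    exact hu (((pattern_eq_some hv).1 hi).symm.trans ((pattern_eq_some hv).1 (e ▸ hi)))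

end TupleSum

end RGG

namespace RGG

/-! ### Moments of sums over tuples of points of a Poisson process -/

/-- Factorial moments of the Poisson law. The first k terms of the series vanish, and shifting the
index by k leaves r^k times the total mass. -/
theorem lintegral_descFactorial_poissonMeasure (r : ℝ≥0) (k : ℕ) :
    ∫⁻ n, (n.descFactorial k : ℝ≥0∞) ∂poissonMeasure r = (r : ℝ≥0∞) ^ k := by
  have hterm : ∀ n : ℕ, ENNReal.ofReal (Real.exp (-r) * r ^ n / n.factorial) *
      (n.descFactorial k : ℝ≥0∞) =
      ENNReal.ofReal (Real.exp (-r) * r ^ n / n.factorial * n.descFactorial k) := by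
    intro n
    rw [ENNReal.ofReal_mul (by positivity), ENNReal.ofReal_natCast]
  have hsum : HasSum (fun n : ℕ => Real.exp (-r) * r ^ n / n.factorial * n.descFactorial k)
      ((r : ℝ) ^ k) := by
    rw [← hasSum_nat_add_iff' k]
    have h0 : ∑ i ∈ Finset.range k,
        Real.exp (-r) * (r : ℝ) ^ i / i.factorial * i.descFactorial k = 0 := by
      refine Finset.sum_eq_zero fun i hi => ?_
      rw [Nat.descFactorial_eq_zero_iff_lt.2 (Finset.mem_range.1 hi)]
      simp
    rw [h0, sub_zero]
    have := (hasSum_one_poissonMeasure r).mul_left ((r : ℝ) ^ k)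
    rw [mul_one] at this
    convert! this using 2 with n
    have e := Nat.factorial_mul_descFactorial (Nat.le_add_left k n)
    rw [Nat.add_sub_cancel] at e
    rw [← e]
    have h1 : (n.factorial : ℝ) ≠ 0 := by positivity
    have h2 : ((n + k).descFactorial k : ℝ) ≠ 0 := by
      have := Nat.descFactorial_pos.2 (Nat.le_add_left k n)
      positivity
    push_cast
    field_simp
    ring
  unfold poissonMeasure
  rw [lintegral_sum_measure]
  simp only [lintegral_smul_measure, lintegral_dirac, smul_eq_mul, hterm]
  rw [← ENNReal.ofReal_tsum_of_nonneg (fun n => by positivity) hsum.summable, hsum.tsum_eq,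
    ENNReal.ofReal_pow r.coe_nonneg, ENNReal.ofReal_coe_nnreal]

section Poisson

variable {d : ℕ} {Ω : Type*} [MeasurableSpace Ω] {P : Measure Ω} {t : ℝ} {W : Set (Euc d)}
  {N : Ω → ℕ} {X : ℕ → Ω → Euc d}

theorem IsPoissonSample.isProbabilityMeasure (h : IsPoissonSample P t W N X) :
    IsProbabilityMeasure P := by
  have := Measure.map_apply (μ := P) h.measurable_count MeasurableSet.univ
  rw [h.law_count, measure_univ, preimage_univ] at this
  exact ⟨this.symm⟩

theorem IsPoissonSample.map_point (h : IsPoissonSample P t W N X) (hW : volume W = 1) (i : ℕ) :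
    P.map (X i) = volume.restrict W := by
  have := h.law_point i
  rwa [pdf.IsUniform, ProbabilityTheory.cond, hW, inv_one, one_smul] at this

theorem IsPoissonSample.map_points (h : IsPoissonSample P t W N X) (hW : volume W = 1)
    {ι : Type*} [Fintype ι] {i : ι → ℕ} (hi : Function.Injective i) :
    P.map (fun ω j => X (i j) ω) = Measure.pi fun _ => volume.restrict W := by
  have := h.isProbabilityMeasure
  rw [(iIndepFun_iff_map_fun_eq_pi_map fun j => (h.measurable_point (i j)).aemeasurable).1
    (h.indep_points.precomp hi)]
  simp only [h.map_point hW]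

/-- Since `pointSet` is a set, repeated sample points would be merged. Lebesgue measure has no
atoms, so almost surely sums over the set can be written as sums over indices. -/
theorem IsPoissonSample.ae_injective [NullSingletonClass (volume : Measure (Euc d))]
    (h : IsPoissonSample P t W N X) (hW : volume W = 1) :
    ∀ᵐ ω ∂P, Function.Injective fun i => X i ω := by
  have := h.isProbabilityMeasure
  have key : ∀ i j, i ≠ j → ∀ᵐ ω ∂P, X i ω ≠ X j ω := by
    intro i j hij
    have hm : MeasurableSet (diagonal (Euc d)) := measurableSet_diagonal
    have hmap := (indepFun_iff_map_prod_eq_prod_map_map (h.measurable_point i).aemeasurable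
      (h.measurable_point j).aemeasurable).1 (h.indep_points.indepFun hij)
    have h0 : P.map (fun ω => (X i ω, X j ω)) (diagonal (Euc d)) = 0 := by
      rw [hmap, h.map_point hW, h.map_point hW,
        @Measure.measure_prod_null _ _ _ _ _ _ _ _ hm]
      refine Eventually.of_forall fun x => ?_
      have : Prod.mk x ⁻¹' diagonal (Euc d) = {x} := by
        ext y
        simp [eq_comm]
      change (volume.restrict W) (Prod.mk x ⁻¹' diagonal (Euc d)) = 0
      rw [this]
      exact le_antisymm ((Measure.restrict_apply_le _ _).trans (measure_singleton x).le) bot_le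
    rw [Measure.map_apply ((h.measurable_point i).prodMk (h.measurable_point j)) hm] at h0
    exact measure_eq_zero_iff_ae_notMem.1 h0
  have h2 : ∀ᵐ ω ∂P, ∀ i j, i ≠ j → X i ω ≠ X j ω :=
    ae_all_iff.2 fun i => ae_all_iff.2 fun j => by
      by_cases hij : i = j
      · exact Eventually.of_forall fun _ h => absurd hij h
      · exact (key i j hij).mono fun _ h _ => h
  filter_upwards [h2] with ω hω i j hij
  by_contra hne
  exact hω i j hne hij

theorem IsPoissonSample.ae_mem (h : IsPoissonSample P t W N X) (hW : volume W = 1)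
    (hWm : NullMeasurableSet W) : ∀ᵐ ω ∂P, ∀ v ∈ pointSet N X ω, v ∈ W := by
  have h1 : ∀ᵐ ω ∂P, ∀ i, X i ω ∈ W := by
    refine ae_all_iff.2 fun i => ?_
    have : ∀ᵐ x ∂(P.map (X i)), x ∈ W := by
      rw [h.map_point hW]
      exact ae_restrict_mem₀ hWm
    exact ae_of_ae_map (h.measurable_point i).aemeasurable this
  filter_upwards [h1] with ω hω v hv
  simp only [pointSet, Finset.mem_image] at hv
  obtain ⟨i, -, rfl⟩ := hv
  exact hω i

variable {ι : Type*} [Fintype ι]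

/-- The indicator function of the set of all injective tuples with entries below `n`. -/
noncomputable def belowIndicator (i : ι → ℕ) (n : ℕ) : ℝ≥0∞ :=
  open Classical in if Function.Injective i ∧ ∀ j, i j < n then 1 else 0

/-- Summing over all index tuples with an indicator separates the dependence on the number of points
from the dependence on their positions, so that independence can be applied term by term. -/
theorem tupleSum_pointSet {Ω : Type*} {N : Ω → ℕ} {X : ℕ → Ω → Euc d}
    (F : (ι → Euc d) → ℝ≥0∞) {ω : Ω}
    (hω : Function.Injective fun i => X i ω) :
    tupleSum F (pointSet N X ω) =
      ∑' i : ι → ℕ, belowIndicator i (N ω) * F fun j => X (i j) ω := by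
  classical
  rw [tsum_eq_sum (s := (Fintype.piFinset fun _ : ι => Finset.range (N ω)).filter
    Function.Injective)]
  · symm
    refine Finset.sum_bij (fun i _ j => X (i j) ω) ?_ ?_ ?_ ?_
    · intro i hi
      simp only [Finset.mem_filter, Fintype.mem_piFinset, Finset.mem_range] at hi ⊢
      exact ⟨fun j => Finset.mem_image.2 ⟨i j, Finset.mem_range.2 (hi.1 j), rfl⟩, hω.comp hi.2⟩
    · intro i _ i' _ e
      funext j
      exact hω (congrFun e j)
    · intro v hv
      simp only [Finset.mem_filter, Fintype.mem_piFinset] at hv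
      have : ∀ j, ∃ n, n < N ω ∧ X n ω = v j := fun j => by
        simpa [pointSet] using hv.1 j
      choose i hi hiv using this
      refine ⟨i, ?_, funext hiv⟩
      simp only [Finset.mem_filter, Fintype.mem_piFinset, Finset.mem_range]
      refine ⟨hi, fun a b hab => hv.2 ?_⟩
      rw [← hiv a, ← hiv b, hab]
    · intro i hi
      simp only [Finset.mem_filter, Fintype.mem_piFinset, Finset.mem_range] at hi
      rw [belowIndicator, if_pos ⟨hi.2, hi.1⟩, one_mul]
  · intro i hi
    simp only [Finset.mem_filter, Fintype.mem_piFinset, Finset.mem_range] at hi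
    rw [belowIndicator, if_neg (fun h => hi ⟨h.2, h.1⟩), zero_mul]

theorem tsum_belowIndicator (n : ℕ) :
    ∑' i : ι → ℕ, belowIndicator i n = (n.descFactorial (Fintype.card ι) : ℝ≥0∞) := by
  classical
  rw [tsum_eq_sum (s := (Fintype.piFinset fun _ : ι => Finset.range n).filter
    Function.Injective)]
  · have h1 : ∀ i ∈ (Fintype.piFinset fun _ : ι => Finset.range n).filter Function.Injective,
        belowIndicator i n = 1 := by
      intro i hi
      simp only [Finset.mem_filter, Fintype.mem_piFinset, Finset.mem_range] at hi
      rw [belowIndicator, if_pos ⟨hi.2, hi.1⟩]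
    rw [Finset.sum_congr rfl h1, Finset.sum_const, nsmul_one]
    have h2 := Fintype.card_embedding_eq (α := ι) (β := Fin n)
    rw [Fintype.card_fin] at h2
    rw [← h2, ← Finset.card_univ, Nat.cast_inj]
    symm
    refine Finset.card_bij (fun e _ j => (e j : ℕ)) ?_ ?_ ?_
    · intro e _
      simp only [Finset.mem_filter, Fintype.mem_piFinset, Finset.mem_range]
      exact ⟨fun j => (e j).2, Fin.val_injective.comp e.injective⟩
    · intro e _ e' _ h
      ext j
      exact congrFun h j
    · intro i hi
      simp only [Finset.mem_filter, Fintype.mem_piFinset, Finset.mem_range] at hi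
      exact ⟨⟨fun j => ⟨i j, hi.1 j⟩, fun a b hab => hi.2 (by simpa using hab)⟩,
        Finset.mem_univ _, rfl⟩
  · intro i hi
    simp only [Finset.mem_filter, Fintype.mem_piFinset, Finset.mem_range] at hi
    rw [belowIndicator, if_neg (fun h => hi ⟨h.2, h.1⟩)]

theorem IsPoissonSample.aemeasurable_tupleSum [NullSingletonClass (volume : Measure (Euc d))]
    (h : IsPoissonSample P t W N X) (hW : volume W = 1) {F : (ι → Euc d) → ℝ≥0∞}
    (hF : Measurable F) : AEMeasurable (fun ω => tupleSum F (pointSet N X ω)) P := by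
  refine ⟨fun ω => ∑' i : ι → ℕ, belowIndicator i (N ω) * F fun j => X (i j) ω, ?_, ?_⟩
  · refine Measurable.tsum fun i => ?_
    exact ((measurable_of_countable (belowIndicator i)).comp h.measurable_count).mul
      (hF.comp (measurable_pi_lambda _ fun j => h.measurable_point (i j)))
  · filter_upwards [h.ae_injective hW] with ω hω
    exact tupleSum_pointSet F hω

/-- The multivariate Mecke formula. Every injective index tuple contributes the same integral of F,
and the number of injective tuples below N is a falling factorial, whose mean is a power of t. -/
theorem IsPoissonSample.lintegral_tupleSum [NullSingletonClass (volume : Measure (Euc d))]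
    (h : IsPoissonSample P t W N X) (hW : volume W = 1) {F : (ι → Euc d) → ℝ≥0∞}
    (hF : Measurable F) :
    ∫⁻ ω, tupleSum F (pointSet N X ω) ∂P =
      ENNReal.ofReal t ^ Fintype.card ι * ∫⁻ x, F x ∂Measure.pi fun _ => volume.restrict W := by
  have hXm : ∀ i : ι → ℕ, Measurable fun ω j => X (i j) ω := fun i =>
    measurable_pi_lambda _ fun j => h.measurable_point (i j)
  have hNm : ∀ i : ι → ℕ, Measurable fun ω => belowIndicator i (N ω) := fun i =>
    (measurable_of_countable (belowIndicator i)).comp h.measurable_count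
  have hprod : ∀ i : ι → ℕ, Measurable fun ω => belowIndicator i (N ω) * F fun j => X (i j) ω :=
    fun i => (hNm i).mul (hF.comp (hXm i))
  have hterm : ∀ i : ι → ℕ, ∫⁻ ω, belowIndicator i (N ω) * F (fun j => X (i j) ω) ∂P =
      (∫⁻ ω, belowIndicator i (N ω) ∂P) * ∫⁻ x, F x ∂Measure.pi fun _ => volume.restrict W := by
    intro i
    by_cases hi : Function.Injective i
    · have hind : IndepFun (fun ω => belowIndicator i (N ω))
          (fun ω => F fun j => X (i j) ω) P :=
        h.indep_count.comp (φ := belowIndicator i) (ψ := fun x : ℕ → Euc d => F fun j => x (i j))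
          (measurable_of_countable _)
          (hF.comp (measurable_pi_lambda _ fun j => measurable_pi_apply _))
      have := lintegral_mul_eq_lintegral_mul_lintegral_of_indepFun (hNm i) (hF.comp (hXm i)) hind
      simp only [Pi.mul_apply, Function.comp_def] at this
      rw [this, ← h.map_points hW hi, lintegral_map hF (hXm i)]
    · have : ∀ n, belowIndicator i n = 0 := fun n => if_neg fun h => hi h.1
      simp [this]
  rw [lintegral_congr_ae (g := fun ω => ∑' i : ι → ℕ, belowIndicator i (N ω) *
      F fun j => X (i j) ω) ((h.ae_injective hW).mono fun ω hω => tupleSum_pointSet F hω),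
    lintegral_tsum fun i => (hprod i).aemeasurable]
  simp_rw [hterm]
  rw [ENNReal.tsum_mul_right, ← lintegral_tsum fun i => (hNm i).aemeasurable]
  simp_rw [tsum_belowIndicator]
  rw [← lintegral_map (f := fun n : ℕ => (n.descFactorial (Fintype.card ι) : ℝ≥0∞))
    (measurable_of_countable _) h.measurable_count, h.law_count,
    lintegral_descFactorial_poissonMeasure]
  rfl

end Poisson

end RGG

namespace RGG

set_option linter.unusedSectionVars false

/-! ### Second moments and marginals -/

section Marginals

variable {ι κ E : Type*} [Fintype ι] [Fintype κ] [DecidableEq ι] [DecidableEq κ]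
  [MeasurableSpace E]

variable (μ : Measure E) [SigmaFinite μ]

/-- The marginal of `F` in the coordinate `i`. -/
noncomputable def marg₁ (F : (ι → E) → ℝ≥0∞) (i : ι) (a : E) : ℝ≥0∞ :=
  lmarginal (fun _ => μ) (Finset.univ.erase i) F fun _ => a

/-- The marginal of `F` in the coordinates `i` and `j`. -/
noncomputable def marg₂ (F : (ι → E) → ℝ≥0∞) (i j : ι) (a b : E) : ℝ≥0∞ :=
  lmarginal (fun _ => μ) ((Finset.univ.erase i).erase j) F fun k => if k = i then a else b

/-- After all other coordinates are integrated out only `x i` matters, so the constant base point in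
`marg₁` is immaterial. -/
theorem lmarginal_eq_marg₁ (F : (ι → E) → ℝ≥0∞) (i : ι) (x : ι → E) :
    lmarginal (fun _ => μ) (Finset.univ.erase i) F x = marg₁ μ F i (x i) := by
  refine lmarginal_congr (fun _ => μ) F fun k hk => ?_
  have : k = i := by simpa using hk
  rw [this]

theorem lmarginal_eq_marg₂ (F : (ι → E) → ℝ≥0∞) {i j : ι} (hij : i ≠ j) (x : ι → E) :
    lmarginal (fun _ => μ) ((Finset.univ.erase i).erase j) F x = marg₂ μ F i j (x i) (x j) := by
  refine lmarginal_congr (fun _ => μ) F fun k hk => ?_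
  have : k = j ∨ k = i := by
    by_contra! h
    exact hk (by simp [h.1, h.2])
  rcases this with rfl | rfl
  · rw [if_neg hij.symm]
  · rw [if_pos rfl]

variable {μ}

theorem measurable_marg₁ {F : (ι → E) → ℝ≥0∞} (hF : Measurable F) (i : ι) :
    Measurable (marg₁ μ F i) :=
  (hF.lmarginal fun _ => μ).comp (measurable_pi_lambda _ fun _ => measurable_id)

theorem measurable_marg₂ {F : (ι → E) → ℝ≥0∞} (hF : Measurable F) (i j : ι) :
    Measurable fun p : E × E => marg₂ μ F i j p.1 p.2 := by
  refine (hF.lmarginal fun _ => μ).comp (measurable_pi_lambda _ fun k => ?_)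
  by_cases h : k = i
  · simp only [h, if_true]
    exact measurable_fst
  · simp only [h, if_false]
    exact measurable_snd

theorem lmarginal_mul_of_eq {F G : (ι → E) → ℝ≥0∞} (hF : Measurable F) (s : Finset ι) (x : ι → E)
    (c : ℝ≥0∞) (hG : ∀ z, G (Function.updateFinset x s z) = c) :
    lmarginal (fun _ => μ) s (fun y => F y * G y) x = lmarginal (fun _ => μ) s F x * c := by
  unfold lmarginal
  simp only [hG]
  exact lintegral_mul_const _ (hF.comp measurable_updateFinset)

theorem lintegral_mul_comp_eval [Nonempty E] {F : (ι → E) → ℝ≥0∞} (hF : Measurable F) {g : E → ℝ≥0∞}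
    (hg : Measurable g) (i : ι) :
    ∫⁻ x, F x * g (x i) ∂Measure.pi (fun _ => μ) = ∫⁻ a, marg₁ μ F i a * g a ∂μ := by
  have hm : Measurable fun x : ι → E => F x * g (x i) :=
    hF.mul (hg.comp (measurable_pi_apply i))
  rw [lintegral_eq_lmarginal_univ (Classical.arbitrary (ι → E)),
    lmarginal_erase _ hm (Finset.mem_univ i)]
  refine lintegral_congr fun a => ?_
  rw [lmarginal_mul_of_eq hF _ _ (g a), lmarginal_eq_marg₁]
  · simp
  · intro z
    simp [Function.updateFinset]

theorem lintegral_mul_comp_eval₂ [Nonempty E] {F : (ι → E) → ℝ≥0∞} (hF : Measurable F)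
    {g : E → E → ℝ≥0∞}
    (hg : Measurable fun p : E × E => g p.1 p.2) {i j : ι} (hij : i ≠ j) :
    ∫⁻ x, F x * g (x i) (x j) ∂Measure.pi (fun _ => μ) =
      ∫⁻ a, ∫⁻ b, marg₂ μ F i j a b * g a b ∂μ ∂μ := by
  have hm : Measurable fun x : ι → E => F x * g (x i) (x j) :=
    hF.mul (hg.comp (f := fun x : ι → E => (x i, x j))
      ((measurable_pi_apply i).prodMk (measurable_pi_apply j)))
  rw [lintegral_eq_lmarginal_univ (Classical.arbitrary (ι → E)),
    lmarginal_erase _ hm (Finset.mem_univ i)]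
  refine lintegral_congr fun a => ?_
  rw [lmarginal_erase _ hm (by simpa using hij.symm)]
  refine lintegral_congr fun b => ?_
  rw [lmarginal_mul_of_eq hF _ _ (g a b), lmarginal_eq_marg₂ _ _ hij]
  · simp [Function.update_of_ne hij]
  · intro z
    simp [Function.updateFinset, Function.update_of_ne hij]

theorem lintegral_marg₂ [Nonempty E] {F : (ι → E) → ℝ≥0∞} (hF : Measurable F) {i j : ι}
    (hij : i ≠ j) :
    ∫⁻ a, ∫⁻ b, marg₂ μ F i j a b ∂μ ∂μ = ∫⁻ x, F x ∂Measure.pi fun _ => μ := by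
  have := lintegral_mul_comp_eval₂ (μ := μ) hF (g := fun _ _ => 1) measurable_const hij
  simpa using this.symm

variable [Zero E]

theorem measurable_glue (φ : κ → Option ι) :
    Measurable fun p : (ι → E) × (freeIdx φ → E) => glue φ p.1 p.2 := by
  refine measurable_pi_lambda _ fun j => ?_
  rcases h : φ j with _ | i
  · simp only [glue_of_none h]
    exact (measurable_pi_apply _).comp measurable_snd
  · simp only [glue_of_some h]
    exact (measurable_pi_apply _).comp measurable_fst

theorem measurable_mergeFun (φ : κ → Option ι) {F : (ι → E) → ℝ≥0∞} {G : (κ → E) → ℝ≥0∞}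
    (hF : Measurable F) (hG : Measurable G) : Measurable (mergeFun φ F G) := by
  have h1 : Measurable fun x : ι ⊕ freeIdx φ → E => x ∘ Sum.inl :=
    measurable_pi_lambda _ fun i => measurable_pi_apply _
  have h2 : Measurable fun x : ι ⊕ freeIdx φ → E => x ∘ Sum.inr :=
    measurable_pi_lambda _ fun i => measurable_pi_apply _
  exact (hF.comp h1).mul (hG.comp ((measurable_glue φ).comp (h1.prodMk h2)))

variable (μ) in
/-- The contribution of a partial injection to the second moment of two tuple sums. -/
noncomputable def pairTerm (φ : κ → Option ι) (F : (ι → E) → ℝ≥0∞) (G : (κ → E) → ℝ≥0∞) : ℝ≥0∞ :=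
  ∫⁻ x, F x * lmarginal (fun _ => μ) (freeIdx φ) G (pullIdx φ x) ∂Measure.pi fun _ => μ

-- Fubini on `ι ⊕ freeIdx φ`: for a fixed first tuple, integrating the new points turns G into its
-- marginal over the free indices.
variable (μ) in
theorem lintegral_mergeFun (φ : κ → Option ι) {F : (ι → E) → ℝ≥0∞} {G : (κ → E) → ℝ≥0∞}
    (hF : Measurable F) (hG : Measurable G) :
    ∫⁻ x, mergeFun φ F G x ∂Measure.pi (fun _ => μ) = pairTerm μ φ F G := by
  have hm := measurable_mergeFun φ hF hG
  have hmp := measurePreserving_sumPiEquivProdPi_symm (fun _ : ι ⊕ freeIdx φ => μ)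
  rw [← hmp.lintegral_comp hm, lintegral_prod]
  · refine lintegral_congr fun x => ?_
    have : ∀ z : freeIdx φ → E, mergeFun φ F G
        ((MeasurableEquiv.sumPiEquivProdPi fun _ : ι ⊕ freeIdx φ => E).symm (x, z)) =
        F x * G (glue φ x z) := fun z => rfl
    simp_rw [this]
    rw [lintegral_const_mul]
    · rfl
    · exact hG.comp ((measurable_glue φ).comp measurable_prodMk_left)
  · exact (hm.comp (MeasurableEquiv.measurable _)).aemeasurable

-- Tuples without common points behave as if independent; this is the term that the product of
-- expectations cancels in the covariance.
variable (μ) in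
theorem pairTerm_none (F : (ι → E) → ℝ≥0∞) (hF : Measurable F) (G : (κ → E) → ℝ≥0∞) :
    pairTerm μ (fun _ => none) F G =
      (∫⁻ x, F x ∂Measure.pi fun _ => μ) * ∫⁻ x, G x ∂Measure.pi fun _ => μ := by
  have h : freeIdx (fun _ : κ => (none : Option ι)) = Finset.univ := by ext; simp [mem_freeIdx]
  simp only [pairTerm, h, lmarginal_univ]
  exact lintegral_mul_const _ hF

/-- With a single shared point, everything else in either tuple integrates separately, which leaves
one-point marginals. The leading terms are of this kind. -/
theorem pairTerm_of_one {F : (ι → E) → ℝ≥0∞} (hF : Measurable F) {G : (κ → E) → ℝ≥0∞}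
    (hG : Measurable G) {φ : κ → Option ι} {i : ι} {j : κ} (hj : φ j = some i)
    (hn : ∀ k, k ≠ j → φ k = none) :
    pairTerm μ φ F G = ∫⁻ a, marg₁ μ F i a * marg₁ μ G j a ∂μ := by
  have h : freeIdx φ = Finset.univ.erase j := by
    ext k
    rw [mem_freeIdx, Finset.mem_erase]
    constructor
    · rintro h
      refine ⟨?_, Finset.mem_univ _⟩
      rintro rfl
      simp [h] at hj
    · exact fun h => hn k h.1
  rw [← lintegral_mul_comp_eval hF (measurable_marg₁ hG j), pairTerm, h]
  simp only [lmarginal_eq_marg₁, pullIdx, hj, Option.elim_some]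

theorem pairTerm_of_two {F : (ι → E) → ℝ≥0∞} (hF : Measurable F) {G : (κ → E) → ℝ≥0∞}
    (hG : Measurable G) {φ : κ → Option ι} {i i' : ι} {j j' : κ} (hi : i ≠ i') (hjj : j ≠ j')
    (hj : φ j = some i) (hj' : φ j' = some i') (hn : ∀ k, k ≠ j → k ≠ j' → φ k = none) :
    pairTerm μ φ F G = ∫⁻ a, ∫⁻ b, marg₂ μ F i i' a b * marg₂ μ G j j' a b ∂μ ∂μ := by
  have h : freeIdx φ = (Finset.univ.erase j).erase j' := by
    ext k
    rw [mem_freeIdx, Finset.mem_erase, Finset.mem_erase]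
    constructor
    · rintro h
      refine ⟨?_, ?_, Finset.mem_univ _⟩
      · rintro rfl
        simp [h] at hj'
      · rintro rfl
        simp [h] at hj
    · exact fun h => hn k h.2.1 h.1
  rw [← lintegral_mul_comp_eval₂ hF (measurable_marg₂ hG j j') hi, pairTerm, h]
  simp only [lmarginal_eq_marg₂ μ G hjj, pullIdx, hj, hj', Option.elim_some]

end Marginals

/-- The merged tuple for φ has as many points as F has arguments plus the free indices of G; this
gives the power of t. -/
theorem IsPoissonSample.lintegral_tupleSum_mul {d : ℕ} {Ω : Type*} [MeasurableSpace Ω]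
    {P : Measure Ω} {t : ℝ} {W : Set (Euc d)} {N : Ω → ℕ} {X : ℕ → Ω → Euc d}
    {ι κ : Type*} [Fintype ι] [Fintype κ] [DecidableEq ι] [DecidableEq κ]
    [NullSingletonClass (volume : Measure (Euc d))]
    (h : IsPoissonSample P t W N X) (hW : volume W = 1) {F : (ι → Euc d) → ℝ≥0∞}
    {G : (κ → Euc d) → ℝ≥0∞} (hF : Measurable F) (hG : Measurable G) :
    ∫⁻ ω, tupleSum F (pointSet N X ω) * tupleSum G (pointSet N X ω) ∂P =
      ∑ φ ∈ matchings ι κ, ENNReal.ofReal t ^ (Fintype.card ι + (freeIdx φ).card) *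
        pairTerm (volume.restrict W) φ F G := by
  simp_rw [tupleSum_mul_tupleSum]
  rw [lintegral_finsetSum' _ fun φ _ => h.aemeasurable_tupleSum hW (measurable_mergeFun φ hF hG)]
  refine Finset.sum_congr rfl fun φ _ => ?_
  rw [h.lintegral_tupleSum hW (measurable_mergeFun φ hF hG), Fintype.card_sum,
    Fintype.card_coe, lintegral_mergeFun _ φ hF hG]

end RGG

namespace RGG

/-! ### The crossing indicator -/

/-- The set is the projection of a closed condition along the compact square of the two segment
parameters. Measurability of the crossing indicator rests on this. -/
theorem isClosed_segment_inter_segment (F : Type*) [NormedAddCommGroup F] [NormedSpace ℝ F] :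
    IsClosed {v : F × F × F × F | (segment ℝ v.1 v.2.1 ∩ segment ℝ v.2.2.1 v.2.2.2).Nonempty} := by
  have : {v : F × F × F × F | (segment ℝ v.1 v.2.1 ∩ segment ℝ v.2.2.1 v.2.2.2).Nonempty} =
      Prod.snd '' {p : (Icc (0 : ℝ) 1 × Icc (0 : ℝ) 1) × (F × F × F × F) |
        p.2.1 + (p.1.1 : ℝ) • (p.2.2.1 - p.2.1) =
          p.2.2.2.1 + (p.1.2 : ℝ) • (p.2.2.2.2 - p.2.2.2.1)} := by
    ext ⟨a, b, c, e⟩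
    simp only [mem_ofPred_eq, segment_eq_image', mem_image, Prod.exists, Subtype.exists]
    constructor
    · rintro ⟨_, ⟨s, hs, rfl⟩, r, hr, h⟩
      exact ⟨s, hs, r, hr, a, b, c, e, h.symm, rfl⟩
    · rintro ⟨s, hs, r, hr, a', b', c', e', h, heq⟩
      obtain ⟨rfl, rfl, rfl, rfl⟩ : a' = a ∧ b' = b ∧ c' = c ∧ e' = e := by simpa using heq
      exact ⟨_, ⟨s, hs, rfl⟩, r, hr, h.symm⟩
  rw [this]
  refine isClosedMap_snd_of_compactSpace _ (isClosed_eq ?_ ?_) <;> fun_prop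

variable {d : ℕ}

theorem continuous_proj (L : Submodule ℝ (Euc d)) : Continuous (proj L) :=
  L.orthogonalProjectionOnto.continuous

theorem proj_add (L : Submodule ℝ (Euc d)) (x y : Euc d) : proj L (x + y) = proj L x + proj L y :=
  map_add _ _ _

theorem proj_smul (L : Submodule ℝ (Euc d)) (r : ℝ) (x : Euc d) : proj L (r • x) = r • proj L x :=
  map_smul _ _ _

theorem dist_proj_le (L : Submodule ℝ (Euc d)) (x y : Euc d) :
    dist (proj L x) (proj L y) ≤ dist x y := by
  have : proj L x - proj L y = L.orthogonalProjectionOnto (x - y) := (map_sub _ _ _).symm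
  rw [dist_eq_norm, dist_eq_norm, this]
  exact L.norm_orthogonalProjectionOnto_apply_le _

theorem image_proj_segment (L : Submodule ℝ (Euc d)) (a b : Euc d) :
    proj L '' segment ℝ a b = segment ℝ (proj L a) (proj L b) :=
  image_segment ℝ L.orthogonalProjectionOnto.toLinearMap.toAffineMap a b

/-- The event that the projections of the edges `[a, b]` and `[c, e]` are present and meet. -/
def Crosses (δ : ℝ) (L : Submodule ℝ (Euc d)) (a b c e : Euc d) : Prop :=
  dist a b ≤ δ ∧ dist c e ≤ δ ∧
    (segment ℝ (proj L a) (proj L b) ∩ segment ℝ (proj L c) (proj L e)).Nonempty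

theorem crosses_iff (δ : ℝ) (L : Submodule ℝ (Euc d)) (a b c e : Euc d) :
    Crosses δ L a b c e ↔
      ((proj L '' edgeSegment δ a b) ∩ (proj L '' edgeSegment δ c e)).Nonempty := by
  unfold Crosses edgeSegment
  split_ifs with h1 h2 h2
  · simp [h1, h2, image_proj_segment]
  · simp [h2]
  · simp [h1]
  · simp [h1]

theorem Crosses.swap_left {δ : ℝ} {L : Submodule ℝ (Euc d)} {a b c e : Euc d}
    (h : Crosses δ L a b c e) : Crosses δ L b a c e :=
  ⟨dist_comm a b ▸ h.1, h.2.1, by rw [segment_symm]; exact h.2.2⟩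

theorem Crosses.symm {δ : ℝ} {L : Submodule ℝ (Euc d)} {a b c e : Euc d}
    (h : Crosses δ L a b c e) : Crosses δ L c e a b :=
  ⟨h.2.1, h.1, by rw [inter_comm]; exact h.2.2⟩

/-- Both starting points project to within δ of the common point, as the projection does not
increase distances. This planar constraint produces the factor δ². -/
theorem Crosses.dist_proj {δ : ℝ} {L : Submodule ℝ (Euc d)} {a b c e : Euc d}
    (h : Crosses δ L a b c e) : dist (proj L a) (proj L c) ≤ 2 * δ := by
  obtain ⟨h1, h2, p, hp1, hp2⟩ := h
  have e1 : dist (proj L a) p ≤ δ := by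
    have := (segment_subset_closedBall_left (proj L a) (proj L b)) hp1
    rw [Metric.mem_closedBall, dist_comm] at this
    linarith [dist_proj_le L a b]
  have e2 : dist p (proj L c) ≤ δ := by
    have := (segment_subset_closedBall_left (proj L c) (proj L e)) hp2
    rw [Metric.mem_closedBall] at this
    linarith [dist_proj_le L c e]
  linarith [dist_triangle (proj L a) p (proj L c)]

theorem isClosed_crosses (δ : ℝ) (L : Submodule ℝ (Euc d)) :
    IsClosed {v : Euc d × Euc d × Euc d × Euc d | Crosses δ L v.1 v.2.1 v.2.2.1 v.2.2.2} := by
  have hp := continuous_proj L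
  refine (isClosed_le (f := fun v : Euc d × Euc d × Euc d × Euc d => dist v.1 v.2.1)
    (by fun_prop) continuous_const).inter ((isClosed_le
    (f := fun v : Euc d × Euc d × Euc d × Euc d => dist v.2.2.1 v.2.2.2)
    (by fun_prop) continuous_const).inter ?_)
  exact (isClosed_segment_inter_segment L).preimage
    (f := fun v : Euc d × Euc d × Euc d × Euc d =>
      (proj L v.1, proj L v.2.1, proj L v.2.2.1, proj L v.2.2.2)) (by fun_prop)

open Classical in
/-- The indicator function of `Crosses`. -/
noncomputable def crossInd (δ : ℝ) (L : Submodule ℝ (Euc d)) (a b c e : Euc d) : ℝ≥0∞ :=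
  if Crosses δ L a b c e then 1 else 0

theorem measurable_crossInd (δ : ℝ) (L : Submodule ℝ (Euc d)) :
    Measurable fun v : Euc d × Euc d × Euc d × Euc d =>
      crossInd δ L v.1 v.2.1 v.2.2.1 v.2.2.2 :=
  Measurable.ite (isClosed_crosses δ L).measurableSet measurable_const measurable_const

theorem crossInd_swap_left (δ : ℝ) (L : Submodule ℝ (Euc d)) (a b c e : Euc d) :
    crossInd δ L b a c e = crossInd δ L a b c e := by
  have : Crosses δ L b a c e ↔ Crosses δ L a b c e := ⟨Crosses.swap_left, Crosses.swap_left⟩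
  unfold crossInd
  rw [this]

theorem crossInd_symm (δ : ℝ) (L : Submodule ℝ (Euc d)) (a b c e : Euc d) :
    crossInd δ L c e a b = crossInd δ L a b c e := by
  have : Crosses δ L c e a b ↔ Crosses δ L a b c e := ⟨Crosses.symm, Crosses.symm⟩
  unfold crossInd
  rw [this]

/-- The crossing indicator as a function of four-tuples. -/
noncomputable def crossFun (δ : ℝ) (L : Submodule ℝ (Euc d)) (v : Fin 4 → Euc d) : ℝ≥0∞ :=
  crossInd δ L (v 0) (v 1) (v 2) (v 3)

theorem measurable_crossFun (δ : ℝ) (L : Submodule ℝ (Euc d)) : Measurable (crossFun δ L) :=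
  (measurable_crossInd δ L).comp (f := fun v : Fin 4 → Euc d => (v 0, v 1, v 2, v 3))
    (by fun_prop)

open Classical in
/-- The indicator function of the event that the distance of two points is at most `δ`. -/
noncomputable def nearInd (δ : ℝ) (a b : Euc d) : ℝ≥0∞ := if dist a b ≤ δ then 1 else 0

open Classical in
/-- The indicator function of the event that the distance of the projections of two points is at
most `2 * δ`. -/
noncomputable def nearProjInd (δ : ℝ) (L : Submodule ℝ (Euc d)) (a b : Euc d) : ℝ≥0∞ :=
  if dist (proj L a) (proj L b) ≤ 2 * δ then 1 else 0

theorem measurable_nearInd_right (δ : ℝ) (a : Euc d) : Measurable (nearInd δ a) :=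
  Measurable.ite (measurableSet_le (by fun_prop) measurable_const)
    measurable_const measurable_const

theorem measurable_nearProjInd_right (δ : ℝ) (L : Submodule ℝ (Euc d)) (a : Euc d) :
    Measurable (nearProjInd δ L a) := by
  have hp := (continuous_proj L).measurable
  exact Measurable.ite (measurableSet_le (by fun_prop) measurable_const)
    measurable_const measurable_const

/-- The other end point of an edge. -/
def partner : Fin 4 → Fin 4 := ![1, 0, 3, 2]

theorem crossFun_le_one (δ : ℝ) (L : Submodule ℝ (Euc d)) (v : Fin 4 → Euc d) :
    crossFun δ L v ≤ 1 := by
  unfold crossFun crossInd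
  split_ifs <;> simp

/-- Reversing an edge and exchanging the two edges together move any two vertices from different
edges to the starting positions. -/
theorem crossFun_eq_partner (δ : ℝ) (L : Submodule ℝ (Euc d)) (v : Fin 4 → Euc d) (i j : Fin 4)
    (h1 : j ≠ i) (h2 : j ≠ partner i) :
    crossFun δ L v = crossInd δ L (v i) (v (partner i)) (v j) (v (partner j)) := by
  have e1 := crossInd_swap_left δ L
  have e2 := crossInd_symm δ L
  have e3 : ∀ a b c e, crossInd δ L a b e c = crossInd δ L a b c e := fun a b c e => by
    rw [← e2, e1, e2]
  fin_cases i <;> fin_cases j <;>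
    first
    | exact absurd rfl h1
    | exact absurd rfl h2
    | (simp only [crossFun, partner, Fin.isValue, Fin.zero_eta, Fin.mk_one, Fin.reduceFinMk,
        Matrix.cons_val]
       first
       | done
       | exact (e1 _ _ _ _).symm
       | exact (e3 _ _ _ _).symm
       | exact (e2 _ _ _ _).symm
       | exact ((e1 _ _ _ _).trans (e3 _ _ _ _)).symm
       | exact ((e1 _ _ _ _).trans (e2 _ _ _ _)).symm
       | exact ((e3 _ _ _ _).trans (e2 _ _ _ _)).symm
       | exact ((e1 _ _ _ _).trans ((e3 _ _ _ _).trans (e2 _ _ _ _))).symm)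

/-- The two ways to dominate a crossing: by the lengths of both edges, or by the closeness of the
projections of two vertices from different edges together with the length of one edge. -/
theorem crossFun_le (δ : ℝ) (L : Submodule ℝ (Euc d)) (v : Fin 4 → Euc d) (i j : Fin 4)
    (h1 : j ≠ i) (h2 : j ≠ partner i) :
    crossFun δ L v ≤ nearInd δ (v i) (v (partner i)) * nearInd δ (v j) (v (partner j)) ∧
      crossFun δ L v ≤ nearProjInd δ L (v i) (v j) * nearInd δ (v j) (v (partner j)) := by
  rw [crossFun_eq_partner δ L v i j h1 h2]
  unfold crossInd
  split_ifs with h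
  · have h0 := h.dist_proj
    simp [nearInd, nearProjInd, h.1, h.2.1, h0]
  · exact ⟨bot_le, bot_le⟩

theorem crossFun_le_nearInd (δ : ℝ) (L : Submodule ℝ (Euc d)) (v : Fin 4 → Euc d) (i : Fin 4) :
    crossFun δ L v ≤ nearInd δ (v (partner i)) (v i) := by
  have : ∃ j, j ≠ partner i ∧ j ≠ partner (partner i) ∧ partner (partner i) = i := by
    revert i; decide
  obtain ⟨j, h1, h2, h3⟩ := this
  refine (crossFun_le δ L v _ j h1 h2).1.trans ?_
  rw [h3]
  refine mul_le_of_le_one_right' ?_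
  unfold nearInd
  split_ifs <;> simp

theorem erase_erase_of_ne_partner : ∀ i j : Fin 4, j ≠ i → j ≠ partner i →
    (Finset.univ.erase i).erase j = {partner i, partner j} ∧ partner i ≠ partner j ∧
      i ≠ partner i ∧ i ≠ partner j ∧ j ≠ partner j := by
  decide

theorem exists_erase_erase_partner : ∀ i : Fin 4, ∃ j, j ≠ i ∧ j ≠ partner i ∧ partner j ≠ j ∧
    i ≠ partner j ∧ i ≠ partner i ∧ partner i ≠ partner j ∧
      (Finset.univ.erase i).erase (partner i) = {j, partner j} := by
  decide

/-! ### Bounds for the marginals and the integral of the crossing indicator -/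

section Bounds

variable {δ : ℝ} {L : Submodule ℝ (Euc d)} {μ : Measure (Euc d)} [IsProbabilityMeasure μ]

theorem lmarginal_pair {ι E : Type*} [Fintype ι] [DecidableEq ι] [MeasurableSpace E]
    {μ : Measure E} [SigmaFinite μ] {F : (ι → E) → ℝ≥0∞} (hF : Measurable F) {s t : ι}
    (hst : s ≠ t) (x : ι → E) :
    lmarginal (fun _ => μ) {s, t} F x =
      ∫⁻ a, ∫⁻ b, F (Function.update (Function.update x s a) t b) ∂μ ∂μ := by
  rw [lmarginal_insert _ hF (by simpa using hst)]
  refine lintegral_congr fun a => ?_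
  rw [lmarginal_singleton]

theorem lmarginal_crossFun_le {A : ℝ≥0∞} (hA : ∀ a, ∫⁻ b, nearInd δ a b ∂μ ≤ A)
    {s : Finset (Fin 4)} (hs : s.Nonempty) (x : Fin 4 → Euc d) :
    lmarginal (fun _ => μ) s (crossFun δ L) x ≤ A := by
  obtain ⟨j, hj⟩ := hs
  rw [lmarginal_erase' _ (measurable_crossFun δ L) hj]
  have : ∀ y, lmarginal (fun _ => μ) {j} (crossFun δ L) y ≤ A := by
    intro y
    rw [lmarginal_singleton]
    refine (lintegral_mono fun a => ?_).trans (hA (y (partner j)))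
    refine (crossFun_le_nearInd δ L _ j).trans ?_
    have : ∀ j, partner j ≠ j := by decide
    rw [Function.update_of_ne (this j), Function.update_self]
  refine (lmarginal_mono (g := fun _ => A) ?_ x).trans ?_
  · intro y
    refine (le_of_eq ?_).trans (this y)
    rw [lmarginal_singleton]
  · simp [lmarginal]

/-- Each integrated vertex is confined to a δ-ball around its fixed partner. In the applications A
is of order δ^d and B, which bounds `nearProjInd`, of order δ²; hence two vertices of different
edges give δ^(2d), while a fixed edge gives only δ^(d+2). -/
theorem marg₂_crossFun_le_of_ne_partner {A : ℝ≥0∞} (hA : ∀ a, ∫⁻ b, nearInd δ a b ∂μ ≤ A)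
    {i j : Fin 4} (h1 : j ≠ i) (h2 : j ≠ partner i) (a b : Euc d) :
    marg₂ μ (crossFun δ L) i j a b ≤ A * A := by
  obtain ⟨hs, h3, h4, h5, h6⟩ := erase_erase_of_ne_partner i j h1 h2
  rw [marg₂, hs, lmarginal_pair (measurable_crossFun δ L) h3]
  calc _ ≤ ∫⁻ a', ∫⁻ b', nearInd δ a a' * nearInd δ b b' ∂μ ∂μ := by
        refine lintegral_mono fun a' => lintegral_mono fun b' => ?_
        refine (crossFun_le δ L _ i j h1 h2).1.trans (le_of_eq ?_)
        simp [Function.update_of_ne h3, Function.update_of_ne h4, Function.update_of_ne h5,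
          Function.update_of_ne h2, Function.update_of_ne h6, h1]
    _ ≤ ∫⁻ a', nearInd δ a a' * A ∂μ := by
        refine lintegral_mono fun a' => ?_
        rw [lintegral_const_mul _ (measurable_nearInd_right δ b)]
        gcongr
        exact hA b
    _ ≤ A * A := by
        rw [lintegral_mul_const _ (measurable_nearInd_right δ a)]
        gcongr
        exact hA a

theorem marg₂_crossFun_le_of_partner {A B : ℝ≥0∞} (hA : ∀ a, ∫⁻ b, nearInd δ a b ∂μ ≤ A)
    (hB : ∀ a, ∫⁻ b, nearProjInd δ L a b ∂μ ≤ B) (i : Fin 4) (a b : Euc d) :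
    marg₂ μ (crossFun δ L) i (partner i) a b ≤ A * B := by
  obtain ⟨j, h1, h2, h3, h4, -, -, hs⟩ := exists_erase_erase_partner i
  rw [marg₂, hs, lmarginal_pair (measurable_crossFun δ L) h3.symm]
  calc _ ≤ ∫⁻ a', ∫⁻ b', nearProjInd δ L a a' * nearInd δ a' b' ∂μ ∂μ := by
        refine lintegral_mono fun a' => lintegral_mono fun b' => ?_
        refine (crossFun_le δ L _ i j h1 h2).2.trans (le_of_eq ?_)
        simp [Function.update_of_ne h3.symm, Function.update_of_ne h1.symm,
          Function.update_of_ne h4]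
    _ ≤ ∫⁻ a', nearProjInd δ L a a' * A ∂μ := by
        refine lintegral_mono fun a' => ?_
        rw [lintegral_const_mul _ (measurable_nearInd_right δ a')]
        gcongr
        exact hA a'
    _ ≤ A * B := by
        rw [lintegral_mul_const _ (measurable_nearProjInd_right δ L a), mul_comm]
        gcongr
        exact hB a

theorem marg₂_crossFun_partner (i : Fin 4) (a b : Euc d) :
    marg₂ μ (crossFun δ L) i (partner i) a b = ∫⁻ c, ∫⁻ e, crossInd δ L a b c e ∂μ ∂μ := by
  obtain ⟨j, h1, h2, h3, h4, h5, h6, hs⟩ := exists_erase_erase_partner i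
  rw [marg₂, hs, lmarginal_pair (measurable_crossFun δ L) h3.symm]
  refine lintegral_congr fun c => lintegral_congr fun e => ?_
  rw [crossFun_eq_partner δ L _ i j h1 h2]
  simp [Function.update_of_ne h3.symm, Function.update_of_ne h1.symm, Function.update_of_ne h2.symm,
    Function.update_of_ne h4, Function.update_of_ne h6, h5.symm]

theorem marg₁_eq_lintegral_marg₂ {ι E : Type*} [Fintype ι] [DecidableEq ι] [MeasurableSpace E]
    {μ : Measure E} [SigmaFinite μ] {F : (ι → E) → ℝ≥0∞} (hF : Measurable F) {i j : ι}
    (hij : i ≠ j) (a : E) : marg₁ μ F i a = ∫⁻ b, marg₂ μ F i j a b ∂μ := by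
  rw [marg₁, lmarginal_erase _ hF (i := j) (by simpa using hij.symm)]
  refine lintegral_congr fun b => ?_
  rw [lmarginal_eq_marg₂ _ _ hij]
  simp [Function.update_of_ne hij]

theorem lintegral_crossFun_le {A B : ℝ≥0∞} (hA : ∀ a, ∫⁻ b, nearInd δ a b ∂μ ≤ A)
    (hB : ∀ a, ∫⁻ b, nearProjInd δ L a b ∂μ ≤ B) :
    ∫⁻ v, crossFun δ L v ∂Measure.pi (fun _ => μ) ≤ A * A * B := by
  rw [← lintegral_marg₂ (measurable_crossFun δ L) (i := 0) (j := 2) (by decide)]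
  -- Vertices 0 and 2 start different edges, so besides the bound `A * A` the marginal vanishes
  -- unless their projections are close. Integrating this indicator gives the additional factor B.
  have key : ∀ a b, marg₂ μ (crossFun δ L) 0 2 a b ≤ A * A * nearProjInd δ L a b := by
    intro a b
    by_cases h : dist (proj L a) (proj L b) ≤ 2 * δ
    · refine (marg₂_crossFun_le_of_ne_partner hA (by decide) (by decide) a b).trans ?_
      simp [nearProjInd, h]
    · have : marg₂ μ (crossFun δ L) 0 2 a b = 0 := by
        rw [marg₂, show (Finset.univ.erase (0 : Fin 4)).erase 2 = {1, 3} from by decide,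
          lmarginal_pair (measurable_crossFun δ L) (by decide)]
        refine lintegral_eq_zero_of_ae_eq_zero (Eventually.of_forall fun c => ?_)
        refine lintegral_eq_zero_of_ae_eq_zero (Eventually.of_forall fun e => ?_)
        refine if_neg fun hc => h ?_
        simpa [Function.update] using hc.dist_proj
      simp [this]
  calc _ ≤ ∫⁻ a, ∫⁻ b, A * A * nearProjInd δ L a b ∂μ ∂μ :=
        lintegral_mono fun a => lintegral_mono fun b => key a b
    _ ≤ ∫⁻ a, A * A * B ∂μ := by
        refine lintegral_mono fun a => ?_
        rw [lintegral_const_mul _ (measurable_nearProjInd_right δ L a)]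
        gcongr
        exact hB a
    _ = A * A * B := by simp

end Bounds

end RGG

namespace RGG

/-! ### Convex sets of finite volume and their sections -/

section Convex

variable {d : ℕ}

/-- If W contains a ball and points arbitrarily far from it, then the convex hull of the ball and a
far point contains arbitrarily many disjoint balls of half the radius, contradicting finite volume.
-/
theorem isBounded_of_convex_of_volume_ne_top {W : Set (Euc d)} (hW : Convex ℝ W)
    (hfin : volume W ≠ ∞) (hint : (interior W).Nonempty) : Bornology.IsBounded W := by
  obtain ⟨p, hp⟩ := hint
  obtain ⟨r, hr, hball⟩ := Metric.isOpen_iff.1 isOpen_interior p hp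
  have hballW : Metric.ball p r ⊆ W := hball.trans interior_subset
  by_contra hunb
  have hfar : ∀ M : ℝ, ∃ x ∈ W, M < dist x p := by
    intro M
    by_contra! h
    exact hunb ((Metric.isBounded_iff_subset_closedBall p).2 ⟨M, fun x hx => h x hx⟩)
  have hcount : ∀ n : ℕ, (n : ℝ≥0∞) * volume (Metric.ball (0 : Euc d) (r / 2)) ≤ volume W := by
    intro n
    rcases Nat.eq_zero_or_pos n with rfl | hn
    · simp
    have hn' : (0 : ℝ) < n := by exact_mod_cast hn
    -- Centres at parameters k / (2n) are more than r apart, which makes balls of radius r / 2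
    -- disjoint. The parameters stay below 1/2, so shrinking the ball towards x leaves at least the
    -- radius r / 2.
    obtain ⟨x, hxW, hx⟩ := hfar (2 * n * r)
    let s : ℕ → ℝ := fun k => k / (2 * n)
    let c : ℕ → Euc d := fun k => p + s k • (x - p)
    have hsub : ∀ k < n, Metric.ball (c k) (r / 2) ⊆ W := by
      intro k hk y hy
      have hk' : (k : ℝ) < n := by exact_mod_cast hk
      have hs0 : 0 ≤ s k := by positivity
      have hs1 : s k ≤ 1 / 2 := by
        rw [div_le_iff₀ (by positivity)]
        linarith
      have hs2 : 0 < 1 - s k := by linarith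
      have hq : p + (1 - s k)⁻¹ • (y - c k) ∈ W := by
        apply hballW
        rw [Metric.mem_ball, dist_eq_norm, add_sub_cancel_left, norm_smul, norm_inv,
          Real.norm_eq_abs, abs_of_pos hs2, inv_mul_lt_iff₀ hs2]
        rw [Metric.mem_ball, dist_eq_norm] at hy
        nlinarith
      have := hW hq hxW hs2.le hs0 (by ring)
      convert! this using 1
      rw [smul_add, smul_inv_smul₀ hs2.ne']
      simp only [c]
      module
    have hdisj : ∀ k l : ℕ, k < l →
      Disjoint (Metric.ball (c k) (r / 2)) (Metric.ball (c l) (r / 2)) := by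
      intro k l hkl
      refine Metric.ball_disjoint_ball ?_
      have hkl' : (k : ℝ) + 1 ≤ l := by exact_mod_cast hkl
      have e : c k - c l = (s k - s l) • (x - p) := by simp only [c]; module
      have e2 : s l - s k = ((l : ℝ) - k) / (2 * n) := by simp only [s]; ring
      rw [dist_eq_norm, e, norm_smul, Real.norm_eq_abs, abs_sub_comm, e2, ← dist_eq_norm,
        abs_of_nonneg (by apply div_nonneg <;> linarith)]
      rw [div_mul_eq_mul_div, le_div_iff₀ (by positivity)]
      have := dist_nonneg (x := x) (y := p)
      nlinarith
    have hm := measure_biUnion_finset (μ := (volume : Measure (Euc d))) (s := Finset.range n)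
      (f := fun k => Metric.ball (c k) (r / 2)) (fun k _ l _ hkl => by
        rcases lt_or_gt_of_ne hkl with h | h
        · exact hdisj k l h
        · exact (hdisj l k h).symm) (fun k _ => measurableSet_ball)
    have hv : ∀ k, volume (Metric.ball (c k) (r / 2)) = volume (Metric.ball (0 : Euc d) (r / 2)) :=
      fun k => by rw [Measure.addHaar_ball_center]
    simp only [hv, Finset.sum_const, Finset.card_range, nsmul_eq_mul] at hm
    rw [← hm]
    refine measure_mono (iUnion₂_subset fun k hk => hsub k (Finset.mem_range.1 hk))
  obtain ⟨n, hn⟩ := ENNReal.exists_nat_mul_gt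
    (a := volume (Metric.ball (0 : Euc d) (r / 2)))
    (Metric.measure_ball_pos _ _ (by positivity)).ne' hfin
  exact absurd (hcount n) (not_le.2 hn)

theorem volume_interior_of_convex {W : Set (Euc d)} (hW : Convex ℝ W) (h1 : volume W = 1) :
    volume (interior W) = 1 := by
  rw [← h1]
  exact (interior_ae_eq_of_null_frontier (hW.addHaar_frontier volume)).measure_eq

/-- The frontier of a convex set is null. This allows the passage from W, which need not be Borel,
to an open set. -/
theorem restrict_interior_of_convex {W : Set (Euc d)} (hW : Convex ℝ W) :
    (volume : Measure (Euc d)).restrict W = volume.restrict (interior W) :=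
  (Measure.restrict_congr_set
    (interior_ae_eq_of_null_frontier (hW.addHaar_frontier volume))).symm

theorem interior_nonempty_of_convex {W : Set (Euc d)} (hW : Convex ℝ W) (h1 : volume W = 1) :
    (interior W).Nonempty :=
  nonempty_of_measure_ne_zero (μ := volume) (by rw [volume_interior_of_convex hW h1]; simp)

end Convex

/-! ### Fubini along `L` and `Lᗮ`, and section volumes -/

section Sections

variable {d : ℕ} (L : Submodule ℝ (Euc d))

theorem measurePreserving_add_orthogonal :
    MeasurePreserving (fun q : L × Lᗮ => (q.1 : Euc d) + q.2) volume volume :=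
  L.orthogonalDecomposition.symm.measurePreserving.comp (WithLp.volume_preserving_toLp L Lᗮ)

theorem lintegral_eq_lintegral_orthogonal {g : Euc d → ℝ≥0∞} (hg : Measurable g) :
    ∫⁻ x, g x = ∫⁻ v : L, ∫⁻ u : Lᗮ, g (v + u) := by
  rw [← (measurePreserving_add_orthogonal L).lintegral_comp hg, Measure.volume_eq_prod,
    lintegral_prod]
  exact (hg.comp (measurePreserving_add_orthogonal L).measurable).aemeasurable

theorem lintegral_comp_smul {F : Type*} [NormedAddCommGroup F] [InnerProductSpace ℝ F]
    [MeasurableSpace F] [BorelSpace F] [FiniteDimensional ℝ F] {g : F → ℝ≥0∞} (hg : Measurable g)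
    {r : ℝ} (hr : 0 < r) :
    ∫⁻ x, g x = ENNReal.ofReal r ^ Module.finrank ℝ F * ∫⁻ x, g (r • x) := by
  have h1 := Measure.map_addHaar_smul (volume : Measure F) hr.ne'
  have h2 : ∫⁻ x, g x ∂(Measure.map (r • ·) (volume : Measure F)) = ∫⁻ x, g (r • x) :=
    lintegral_map hg (measurable_const_smul r)
  rw [← h2, h1, lintegral_smul_measure, smul_eq_mul, ← mul_assoc, ← ENNReal.ofReal_pow hr.le,
    ← ENNReal.ofReal_mul (by positivity), abs_of_pos (by positivity),
    mul_inv_cancel₀ (by positivity), ENNReal.ofReal_one, one_mul]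

/-- The volume of the section of `O` by the translate of `Lᗮ` through `a`. -/
noncomputable def secVol (O : Set (Euc d)) (a : Euc d) : ℝ≥0∞ :=
  ∫⁻ u : Lᗮ, O.indicator 1 (a + u)

variable {L} {O : Set (Euc d)}

theorem measurable_secVol (hO : MeasurableSet O) : Measurable (secVol L O) := by
  have h1 : Measurable (O.indicator (1 : Euc d → ℝ≥0∞)) := measurable_one.indicator hO
  have h2 : Measurable fun p : Euc d × Lᗮ => p.1 + (p.2 : Euc d) := by fun_prop
  exact Measurable.lintegral_prod_right' (h1.comp h2)

theorem secVol_eq (hO : MeasurableSet O) (a : Euc d) :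
    secVol L O a = volume {u : Lᗮ | a + (u : Euc d) ∈ O} := by
  have hm : MeasurableSet {u : Lᗮ | a + (u : Euc d) ∈ O} :=
    hO.preimage (by fun_prop : Measurable fun u : Lᗮ => a + (u : Euc d))
  rw [← lintegral_indicator_one hm]
  rfl

theorem secVol_add (a : Euc d) (u : Lᗮ) :
    secVol L O (a + u) = secVol L O a := by
  unfold secVol
  rw [← lintegral_add_left_eq_self (fun v : Lᗮ => O.indicator (1 : Euc d → ℝ≥0∞) (a + v)) u]
  simp [add_assoc]

theorem volume_section_le {R : ℝ} (hR : O ⊆ Metric.closedBall 0 R) (a : Euc d) :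
    volume {u : Lᗮ | a + (u : Euc d) ∈ O} ≤ volume (Metric.closedBall (0 : Lᗮ) R) := by
  rw [← Measure.addHaar_closedBall_center volume (-(Lᗮ).orthogonalProjectionOnto a) R]
  refine measure_mono fun u hu => ?_
  have h1 := hR hu
  rw [mem_closedBall_zero_iff] at h1
  rw [Metric.mem_closedBall, dist_eq_norm, sub_neg_eq_add]
  have h2 : u + (Lᗮ).orthogonalProjectionOnto a = (Lᗮ).orthogonalProjectionOnto (a + u) := by
    rw [map_add, Submodule.orthogonalProjectionOnto_mem_subspace_eq_self, add_comm]
  rw [h2]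
  exact ((Lᗮ).norm_orthogonalProjectionOnto_apply_le _).trans h1

theorem secVol_le (hO : MeasurableSet O) {R : ℝ} (hR : O ⊆ Metric.closedBall 0 R) (a : Euc d) :
    secVol L O a ≤ volume (Metric.closedBall (0 : Lᗮ) R) := by
  rw [secVol_eq hO]
  exact volume_section_le hR a

theorem secVol_pos (hO : IsOpen O) {a : Euc d} (ha : a ∈ O) : 0 < secVol L O a := by
  rw [secVol_eq hO.measurableSet]
  refine IsOpen.measure_pos _ ?_ ⟨0, by simpa using ha⟩
  exact hO.preimage (by fun_prop : Continuous fun u : Lᗮ => a + (u : Euc d))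

/-- The section volume is constant along each fibre v + `Lᗮ`, and the part of the fibre inside O
contributes one more factor. Thus the square integrated over O is the cube integrated over the
plane. -/
theorem setLIntegral_secVol_sq (hO : MeasurableSet O) :
    ∫⁻ a in O, secVol L O a ^ 2 = ∫⁻ v : L, secVol L O v ^ 3 := by
  have hm := measurable_secVol (L := L) hO
  have h1 : Measurable (O.indicator (1 : Euc d → ℝ≥0∞)) := measurable_one.indicator hO
  rw [← lintegral_indicator hO, lintegral_eq_lintegral_orthogonal L ((hm.pow_const 2).indicator hO)]
  refine lintegral_congr fun v => ?_
  have : ∀ u : Lᗮ, O.indicator (fun a => secVol L O a ^ 2) (v + u) =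
      secVol L O v ^ 2 * O.indicator 1 ((v : Euc d) + u) := by
    intro u
    by_cases h : (v : Euc d) + u ∈ O
    · rw [indicator_of_mem h, indicator_of_mem h, secVol_add]
      simp
    · rw [indicator_of_notMem h, indicator_of_notMem h, mul_zero]
  simp_rw [this]
  rw [lintegral_const_mul, pow_succ _ 2]
  · rfl
  · exact h1.comp (by fun_prop : Measurable fun u : Lᗮ => (v : Euc d) + u)

theorem ae_section_notMem {S : Set (Euc d)} (hS : volume S = 0) :
    ∀ᵐ v : L, ∀ᵐ u : Lᗮ, (v : Euc d) + u ∉ S := by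
  have h1 : ∀ᵐ x : Euc d, x ∉ S := measure_eq_zero_iff_ae_notMem.1 hS
  have h2 := (measurePreserving_add_orthogonal L).quasiMeasurePreserving.ae h1
  exact Measure.ae_ae_of_ae_prod h2

theorem ae_of_ae_orthogonal {p : Euc d → Prop} (h : ∀ᵐ v : L, ∀ u : Lᗮ, p (v + u)) :
    ∀ᵐ x, p x := by
  have h2 : ∀ᵐ q : L × Lᗮ, p (q.1 + q.2) := by
    have := (Measure.quasiMeasurePreserving_fst (μ := (volume : Measure L))
      (ν := (volume : Measure Lᗮ))).ae h
    exact this.mono fun q hq => hq q.2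
  have hmp := (measurePreserving_add_orthogonal L).symm
    (L.orthogonalDecomposition.toHomeomorph.toMeasurableEquiv.trans
      (MeasurableEquiv.toLp 2 (L × Lᗮ)).symm).symm
  have h3 := hmp.quasiMeasurePreserving.ae h2
  refine h3.mono fun x hx => ?_
  convert! hx using 1
  exact ((L.orthogonalDecomposition.toHomeomorph.toMeasurableEquiv.trans
      (MeasurableEquiv.toLp 2 (L × Lᗮ)).symm).symm_apply_apply x).symm

/-- Applied to the frontier: through almost every a, almost every point of the section is off the
frontier. There the indicator of O is locally constant, as the limit δ → 0 requires. -/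
theorem ae_section_notMem' {S : Set (Euc d)} (hS : volume S = 0) :
    ∀ᵐ a : Euc d, ∀ᵐ u : Lᗮ, a + u ∉ S := by
  refine ae_of_ae_orthogonal (L := L) ((ae_section_notMem hS).mono fun v hv u => ?_)
  have := (measurePreserving_add_left (volume : Measure Lᗮ) u).quasiMeasurePreserving.ae hv
  refine this.mono fun u' hu' => ?_
  simpa [add_assoc] using hu'

theorem toReal_secVol_interior {W : Set (Euc d)} {a : Euc d}
    (ha : ∀ᵐ u : Lᗮ, a + u ∉ frontier W) :
    (secVol L (interior W) a).toReal = sectionVol W L a := by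
  rw [secVol_eq isOpen_interior.measurableSet, sectionVol]
  congr 1
  refine measure_congr ?_
  filter_upwards [ha] with u hu
  refine propext ⟨fun h => interior_subset h, fun h => ?_⟩
  by_contra h2
  exact hu ⟨subset_closure h, h2⟩

end Sections

end RGG

namespace RGG

/-! ### The crossing indicator at small scales -/

section Rescaling

variable {d : ℕ} {L : Submodule ℝ (Euc d)} {O : Set (Euc d)}

theorem segment_inter_segment_nonempty_iff {F : Type*} [AddCommGroup F] [Module ℝ F]
    {a b c e : F} : (segment ℝ a b ∩ segment ℝ c e).Nonempty ↔
      ∃ s ∈ Icc (0 : ℝ) 1, ∃ r ∈ Icc (0 : ℝ) 1, a + s • (b - a) = c + r • (e - c) := by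
  simp only [segment_eq_image']
  constructor
  · rintro ⟨_, ⟨s, hs, rfl⟩, r, hr, h⟩
    exact ⟨s, hs, r, hr, h.symm⟩
  · rintro ⟨s, hs, r, hr, h⟩
    exact ⟨_, ⟨s, hs, rfl⟩, r, hr, h.symm⟩

/-- The event that two edges of length at most one, one of them starting in `0`, the other one in a
point with projection `y`, have projections that meet. -/
def CrossesAt (L : Submodule ℝ (Euc d)) (x : Euc d) (y : L) (z : Euc d) : Prop :=
  ‖x‖ ≤ 1 ∧ ‖z‖ ≤ 1 ∧ (segment ℝ 0 (proj L x) ∩ segment ℝ y (y + proj L z)).Nonempty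

open Classical in
/-- The indicator function of `CrossesAt`. -/
noncomputable def kernelAt (L : Submodule ℝ (Euc d)) (x : Euc d) (y : L) (z : Euc d) : ℝ≥0∞ :=
  if CrossesAt L x y z then 1 else 0

theorem isClosed_crossesAt (L : Submodule ℝ (Euc d)) :
    IsClosed {q : Euc d × L × Euc d | CrossesAt L q.1 q.2.1 q.2.2} := by
  have hp := continuous_proj L
  refine (isClosed_le (f := fun q : Euc d × L × Euc d => ‖q.1‖) (by fun_prop)
    continuous_const).inter ((isClosed_le (f := fun q : Euc d × L × Euc d => ‖q.2.2‖)
    (by fun_prop) continuous_const).inter ?_)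
  exact (isClosed_segment_inter_segment L).preimage
    (f := fun q : Euc d × L × Euc d => ((0 : L), proj L q.1, q.2.1, q.2.1 + proj L q.2.2))
    (by fun_prop)

theorem measurable_kernelAt (L : Submodule ℝ (Euc d)) :
    Measurable fun q : Euc d × L × Euc d => kernelAt L q.1 q.2.1 q.2.2 :=
  Measurable.ite (isClosed_crossesAt L).measurableSet measurable_const measurable_const

theorem norm_proj_le (L : Submodule ℝ (Euc d)) (x : Euc d) : ‖proj L x‖ ≤ ‖x‖ :=
  L.norm_orthogonalProjectionOnto_apply_le x

theorem CrossesAt.norm_le {x : Euc d} {y : L} {z : Euc d} (h : CrossesAt L x y z) : ‖y‖ ≤ 2 := by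
  obtain ⟨hx, hz, h⟩ := h
  obtain ⟨s, hs, r, hr, h⟩ := segment_inter_segment_nonempty_iff.1 h
  have : y = s • proj L x - r • proj L z := by
    simp only [zero_add, sub_zero, add_sub_cancel_left] at h
    rw [h]; abel
  rw [this]
  refine (norm_sub_le _ _).trans ?_
  rw [norm_smul, norm_smul, Real.norm_of_nonneg hs.1, Real.norm_of_nonneg hr.1]
  have h1 := norm_proj_le L x
  have h2 := norm_proj_le L z
  nlinarith [hs.1, hs.2, hr.1, hr.2, norm_nonneg (proj L x), norm_nonneg (proj L z)]

theorem kernelAt_le_one (x : Euc d) (y : L) (z : Euc d) : kernelAt L x y z ≤ 1 := by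
  unfold kernelAt
  split_ifs <;> simp

theorem proj_coe (y : L) : proj L (y : Euc d) = y :=
  Submodule.orthogonalProjectionOnto_mem_subspace_eq_self y

theorem proj_coe_orthogonal (u : Lᗮ) : proj L (u : Euc d) = 0 :=
  Submodule.orthogonalProjectionOnto_eq_zero_iff.2 u.2

/-- The start of the second edge is displaced from a by δy in `L` and by u in `Lᗮ`. Crossing depends
on projections only, so u is left unscaled and drops out. -/
theorem crosses_rescale {δ : ℝ} (hδ : 0 < δ) (a x : Euc d) (y : L) (u : Lᗮ) (z : Euc d) :
    Crosses δ L a (a + δ • x) (a + ((δ • y : L) + (u : Euc d)))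
      (a + ((δ • y : L) + (u : Euc d)) + δ • z) ↔ CrossesAt L x y z := by
  unfold Crosses CrossesAt
  have hn : ∀ x : Euc d, ‖δ • x‖ ≤ δ ↔ ‖x‖ ≤ 1 := fun x => by
    rw [norm_smul, Real.norm_of_nonneg hδ.le]
    constructor
    · intro h
      by_contra! h1
      nlinarith
    · intro h
      nlinarith
  rw [dist_self_add_right, dist_self_add_right, hn, hn]
  simp only [segment_inter_segment_nonempty_iff, proj_add, proj_smul, proj_coe,
    proj_coe_orthogonal, add_zero, sub_zero, zero_add, add_sub_cancel_left]
  refine and_congr_right fun _ => and_congr_right fun _ => exists_congr fun s =>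
    and_congr_right fun _ => exists_congr fun r => and_congr_right fun _ => ?_
  rw [add_assoc, add_right_inj, smul_comm s δ, smul_comm r δ, ← smul_add]
  exact (smul_right_injective L hδ.ne').eq_iff

theorem crossInd_rescale {δ : ℝ} (hδ : 0 < δ) (a x : Euc d) (y : L) (u : Lᗮ) (z : Euc d) :
    crossInd δ L a (a + δ • x) (a + ((δ • y : L) + (u : Euc d)))
      (a + ((δ • y : L) + (u : Euc d)) + δ • z) = kernelAt L x y z := by
  unfold crossInd kernelAt
  rw [crosses_rescale hδ]

/-- The expected number of edges, up to normalization, that cross the edge `[a, b]`. -/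
noncomputable def edgeMarg (δ : ℝ) (L : Submodule ℝ (Euc d)) (O : Set (Euc d)) (a b : Euc d) :
    ℝ≥0∞ :=
  ∫⁻ c in O, ∫⁻ e in O, crossInd δ L a b c e

/-- The integrand of `edgeMarg` after rescaling. -/
noncomputable def scaledKernel (δ : ℝ) (O : Set (Euc d)) (a x : Euc d) (q : L × Lᗮ × Euc d) :
    ℝ≥0∞ :=
  kernelAt L x q.1 q.2.2 * O.indicator 1 (a + ((δ • q.1 : L) + (q.2.1 : Euc d))) *
    O.indicator 1 (a + ((δ • q.1 : L) + (q.2.1 : Euc d)) + δ • q.2.2)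

/-- `edgeMarg` after rescaling. -/
noncomputable def scaledEdgeMarg (δ : ℝ) (L : Submodule ℝ (Euc d)) (O : Set (Euc d))
    (a x : Euc d) : ℝ≥0∞ :=
  ∫⁻ q : L × Lᗮ × Euc d, scaledKernel δ O a x q

theorem measurable_scaledKernel (δ : ℝ) (hO : MeasurableSet O) :
    Measurable fun p : (Euc d × Euc d) × L × Lᗮ × Euc d =>
      scaledKernel δ O p.1.1 p.1.2 p.2 := by
  have h1 : Measurable (O.indicator (1 : Euc d → ℝ≥0∞)) := measurable_one.indicator hO
  refine Measurable.mul (Measurable.mul ?_ ?_) ?_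
  · exact (measurable_kernelAt L).comp
      (f := fun p : (Euc d × Euc d) × L × Lᗮ × Euc d => (p.1.2, p.2.1, p.2.2.2)) (by fun_prop)
  · exact h1.comp (by fun_prop)
  · exact h1.comp (by fun_prop)

theorem measurable_scaledEdgeMarg (δ : ℝ) (hO : MeasurableSet O) :
    Measurable fun p : Euc d × Euc d => scaledEdgeMarg δ L O p.1 p.2 :=
  (measurable_scaledKernel (L := L) δ hO).lintegral_prod_right'

theorem measurable_edgeMarg (δ : ℝ) : Measurable fun p : Euc d × Euc d =>
    edgeMarg δ L O p.1 p.2 := by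
  have h1 : Measurable fun p : ((Euc d × Euc d) × Euc d) × Euc d =>
      crossInd δ L p.1.1.1 p.1.1.2 p.1.2 p.2 :=
    (measurable_crossInd δ L).comp
      (f := fun p : ((Euc d × Euc d) × Euc d) × Euc d => (p.1.1.1, p.1.1.2, p.1.2, p.2))
      (by fun_prop)
  exact h1.lintegral_prod_right'.lintegral_prod_right'

theorem lintegral_rescale {g : Euc d → ℝ≥0∞} (hg : Measurable g) {δ : ℝ} (hδ : 0 < δ) (a : Euc d) :
    ∫⁻ b, g b = ENNReal.ofReal δ ^ d * ∫⁻ x, g (a + δ • x) := by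
  have h := lintegral_comp_smul (F := Euc d) (g := fun b => g (a + b))
    (hg.comp (by fun_prop)) hδ
  rw [finrank_euclideanSpace_fin] at h
  rw [← h, lintegral_add_left_eq_self]

/-- The substitution of `crosses_rescale` has Jacobian δ^d for the edge vector z and δ² for the
planar displacement y, since u keeps its scale. -/
theorem edgeMarg_rescale (hL : Module.finrank ℝ L = 2) (hO : MeasurableSet O) {δ : ℝ} (hδ : 0 < δ)
    (a x : Euc d) : edgeMarg δ L O a (a + δ • x) =
      ENNReal.ofReal δ ^ d * ENNReal.ofReal δ ^ 2 * scaledEdgeMarg δ L O a x := by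
  have h1 : Measurable (O.indicator (1 : Euc d → ℝ≥0∞)) := measurable_one.indicator hO
  set b := a + δ • x
  have hc : Measurable fun p : Euc d × Euc d => crossInd δ L a b p.1 p.2 :=
    (measurable_crossInd δ L).comp (f := fun p : Euc d × Euc d => (a, b, p.1, p.2)) (by fun_prop)
  have hJ : Measurable fun p : Euc d × Euc d =>
      crossInd δ L a b p.1 p.2 * O.indicator 1 p.1 * O.indicator 1 p.2 :=
    (hc.mul (h1.comp measurable_fst)).mul (h1.comp measurable_snd)
  have e1 : edgeMarg δ L O a b =
      ∫⁻ c, ∫⁻ e, crossInd δ L a b c e * O.indicator 1 c * O.indicator 1 e := by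
    unfold edgeMarg
    rw [← lintegral_indicator hO]
    refine lintegral_congr fun c => ?_
    by_cases h : c ∈ O
    · rw [indicator_of_mem h, ← lintegral_indicator hO]
      refine lintegral_congr fun e => ?_
      by_cases h' : e ∈ O <;> simp [h, h']
    · simp [h]
  have e2 : ∀ c, ∫⁻ e, crossInd δ L a b c e * O.indicator 1 c * O.indicator 1 e =
      ENNReal.ofReal δ ^ d * ∫⁻ z, crossInd δ L a b c (c + δ • z) * O.indicator 1 c *
        O.indicator 1 (c + δ • z) := fun c =>
    lintegral_rescale (hJ.comp measurable_prodMk_left) hδ c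
  have hG : Measurable fun c => ∫⁻ z, crossInd δ L a b c (c + δ • z) * O.indicator 1 c *
      O.indicator 1 (c + δ • z) :=
    (hJ.comp (f := fun p : Euc d × Euc d => (p.1, p.1 + δ • p.2))
      (by fun_prop)).lintegral_prod_right'
  have hGa : Measurable fun c => ∫⁻ z, crossInd δ L a b (a + c) (a + c + δ • z) *
      O.indicator 1 (a + c) * O.indicator 1 (a + c + δ • z) :=
    hG.comp (measurable_const_add a)
  simp_rw [e1, e2]
  rw [lintegral_const_mul _ hG, ← lintegral_add_left_eq_self _ a,
    lintegral_eq_lintegral_orthogonal L hGa]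
  have hG2 : Measurable fun v : L => ∫⁻ u : Lᗮ, ∫⁻ z, crossInd δ L a b (a + ((v : Euc d) + u))
      (a + ((v : Euc d) + u) + δ • z) * O.indicator 1 (a + ((v : Euc d) + u)) *
      O.indicator 1 (a + ((v : Euc d) + u) + δ • z) :=
    (hG.comp (f := fun p : L × Lᗮ => a + ((p.1 : Euc d) + p.2))
      (by fun_prop)).lintegral_prod_right'
  rw [lintegral_comp_smul hG2 hδ, hL, ← mul_assoc]
  congr 1
  unfold scaledEdgeMarg
  have hs : Measurable (scaledKernel (L := L) δ O a x) :=
    (measurable_scaledKernel (L := L) δ hO).comp (f := fun q : L × Lᗮ × Euc d => ((a, x), q))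
      (by fun_prop)
  rw [Measure.volume_eq_prod, lintegral_prod _ hs.aemeasurable]
  refine lintegral_congr fun y => ?_
  have hs' : Measurable fun q : Lᗮ × Euc d => scaledKernel δ O a x (y, q) :=
    hs.comp measurable_prodMk_left
  rw [Measure.volume_eq_prod, lintegral_prod _ hs'.aemeasurable]
  refine lintegral_congr fun u => lintegral_congr fun z => ?_
  rw [crossInd_rescale hδ]
  rfl

/-! ### Bounds -/

theorem lintegral_nearInd_le {δ : ℝ} (hδ : 0 < δ) (a : Euc d) :
    ∫⁻ b in O, nearInd δ a b ≤
      volume (Metric.closedBall (0 : Euc d) 1) * ENNReal.ofReal δ ^ d := by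
  refine (lintegral_mono' Measure.restrict_le_self le_rfl).trans ?_
  have : ∀ b, nearInd δ a b = (Metric.closedBall a δ).indicator 1 b := by
    intro b
    unfold nearInd
    by_cases h : dist a b ≤ δ
    · rw [if_pos h, indicator_of_mem (by rwa [Metric.mem_closedBall, dist_comm])]
      rfl
    · rw [if_neg h, indicator_of_notMem (by rwa [Metric.mem_closedBall, dist_comm])]
  simp_rw [this]
  rw [lintegral_indicator_one Metric.isClosed_closedBall.measurableSet,
    Measure.addHaar_closedBall' _ _ hδ.le, finrank_euclideanSpace_fin,
    ENNReal.ofReal_pow hδ.le, mul_comm]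

/-- A disc of radius 2δ in the plane, times the largest possible section of a set inside the R-ball.
-/
theorem lintegral_nearProjInd_le (hL : Module.finrank ℝ L = 2) (hO : MeasurableSet O) {R : ℝ}
    (hR : O ⊆ Metric.closedBall 0 R) {δ : ℝ} (hδ : 0 < δ) (a : Euc d) :
    ∫⁻ b in O, nearProjInd δ L a b ≤
      volume (Metric.closedBall (0 : Lᗮ) R) * (4 * volume (Metric.closedBall (0 : L) 1)) *
        ENNReal.ofReal δ ^ 2 := by
  have h1 : Measurable (O.indicator (1 : Euc d → ℝ≥0∞)) := measurable_one.indicator hO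
  have hm := measurable_nearProjInd_right δ L a
  have e1 : ∫⁻ b in O, nearProjInd δ L a b = ∫⁻ b, nearProjInd δ L a b * O.indicator 1 b := by
    rw [← lintegral_indicator hO]
    refine lintegral_congr fun b => ?_
    by_cases h : b ∈ O <;> simp [h]
  have e2 : ∀ v : L, ∀ u : Lᗮ, nearProjInd δ L a ((v : Euc d) + u) =
      (Metric.closedBall (proj L a) (2 * δ)).indicator 1 v := by
    intro v u
    unfold nearProjInd
    rw [proj_add, proj_coe, proj_coe_orthogonal, add_zero]
    by_cases h : dist (proj L a) v ≤ 2 * δ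
    · rw [if_pos h, indicator_of_mem (by rwa [Metric.mem_closedBall, dist_comm])]
      rfl
    · rw [if_neg h, indicator_of_notMem (by rwa [Metric.mem_closedBall, dist_comm])]
  have hm1 : Measurable fun b => nearProjInd δ L a b * O.indicator 1 b := hm.mul h1
  rw [e1, lintegral_eq_lintegral_orthogonal L hm1]
  simp_rw [e2]
  have e3 : ∀ v : L, ∫⁻ u : Lᗮ, (Metric.closedBall (proj L a) (2 * δ)).indicator 1 v *
      O.indicator (1 : Euc d → ℝ≥0∞) ((v : Euc d) + u) =
      (Metric.closedBall (proj L a) (2 * δ)).indicator 1 v * secVol L O v := fun v =>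
    lintegral_const_mul _ (h1.comp (by fun_prop))
  simp_rw [e3]
  calc _ ≤ ∫⁻ v : L, (Metric.closedBall (proj L a) (2 * δ)).indicator 1 v *
        volume (Metric.closedBall (0 : Lᗮ) R) := by
        refine lintegral_mono fun v => ?_
        gcongr
        exact secVol_le hO hR _
    _ = volume (Metric.closedBall (proj L a) (2 * δ)) * volume (Metric.closedBall (0 : Lᗮ) R) := by
        rw [lintegral_mul_const _ (measurable_one.indicator
          Metric.isClosed_closedBall.measurableSet), lintegral_indicator_one
          Metric.isClosed_closedBall.measurableSet]
    _ = _ := by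
        rw [Measure.addHaar_closedBall' _ _ (by positivity), hL, mul_pow,
          ENNReal.ofReal_mul (by positivity), ENNReal.ofReal_pow hδ.le]
        norm_num
        ring

end Rescaling

end RGG

namespace RGG

/-! ### Limits of the marginals of the crossing indicator -/

section Limits

variable {d : ℕ} {L : Submodule ℝ (Euc d)} {O : Set (Euc d)}

/-- The volume of the pairs `(y, z)` for which the edges given by `x` and by `(y, z)` cross. -/
noncomputable def edgeInt (L : Submodule ℝ (Euc d)) (x : Euc d) : ℝ≥0∞ :=
  ∫⁻ y : L, ∫⁻ z, kernelAt L x y z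

/-- The integrals of the powers of `edgeInt`. -/
noncomputable def edgeIntPow (L : Submodule ℝ (Euc d)) (k : ℕ) : ℝ≥0∞ := ∫⁻ x, edgeInt L x ^ k

theorem measurable_edgeInt (L : Submodule ℝ (Euc d)) : Measurable (edgeInt L) := by
  have h : Measurable fun p : (Euc d × L) × Euc d => kernelAt L p.1.1 p.1.2 p.2 :=
    (measurable_kernelAt L).comp (f := fun p : (Euc d × L) × Euc d => (p.1.1, p.1.2, p.2))
      (by fun_prop)
  exact h.lintegral_prod_right'.lintegral_prod_right'

theorem kernelAt_le_indicator (x : Euc d) (y : L) (z : Euc d) :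
    kernelAt L x y z ≤ (Metric.closedBall (0 : L) 2).indicator 1 y *
      (Metric.closedBall (0 : Euc d) 1).indicator 1 z := by
  unfold kernelAt
  split_ifs with h
  · rw [indicator_of_mem (by simpa using h.norm_le), indicator_of_mem (by simpa using h.2.1)]
    simp
  · exact bot_le

theorem kernelAt_eq_zero {x : Euc d} (hx : 1 < ‖x‖) (y : L) (z : Euc d) : kernelAt L x y z = 0 :=
  if_neg fun h => absurd h.1 (not_le.2 hx)

theorem edgeInt_eq_zero {x : Euc d} (hx : 1 < ‖x‖) : edgeInt L x = 0 := by
  simp [edgeInt, kernelAt_eq_zero hx]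

theorem edgeInt_le (x : Euc d) : edgeInt L x ≤
    volume (Metric.closedBall (0 : L) 2) * volume (Metric.closedBall (0 : Euc d) 1) := by
  calc edgeInt L x ≤ ∫⁻ y : L, ∫⁻ z, (Metric.closedBall (0 : L) 2).indicator 1 y *
        (Metric.closedBall (0 : Euc d) 1).indicator 1 z :=
        lintegral_mono fun y => lintegral_mono fun z => kernelAt_le_indicator x y z
    _ = _ := by
        have h1 : Measurable ((Metric.closedBall (0 : L) 2).indicator (1 : L → ℝ≥0∞)) :=
          measurable_one.indicator Metric.isClosed_closedBall.measurableSet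
        have h2 : Measurable ((Metric.closedBall (0 : Euc d) 1).indicator (1 : Euc d → ℝ≥0∞)) :=
          measurable_one.indicator Metric.isClosed_closedBall.measurableSet
        simp_rw [lintegral_const_mul _ h2]
        rw [lintegral_mul_const _ h1, lintegral_indicator_one
          Metric.isClosed_closedBall.measurableSet, lintegral_indicator_one
          Metric.isClosed_closedBall.measurableSet]

theorem volume_closedBall_ne_top {F : Type*} [NormedAddCommGroup F] [InnerProductSpace ℝ F]
    [MeasurableSpace F] [BorelSpace F] [FiniteDimensional ℝ F] (r : ℝ) :
    volume (Metric.closedBall (0 : F) r) ≠ ∞ :=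
  (isCompact_closedBall (0 : F) r).measure_lt_top.ne

theorem lintegral_le_of_le_of_norm {f : Euc d → ℝ≥0∞} {C : ℝ≥0∞} (hC : ∀ x, f x ≤ C)
    (h0 : ∀ x, 1 < ‖x‖ → f x = 0) :
    ∫⁻ x, f x ≤ C * volume (Metric.closedBall (0 : Euc d) 1) := by
  calc ∫⁻ x, f x ≤ ∫⁻ x, C * (Metric.closedBall (0 : Euc d) 1).indicator 1 x := by
        refine lintegral_mono fun x => ?_
        by_cases h : ‖x‖ ≤ 1
        · simpa [h] using hC x
        · simp [h0 x (not_le.1 h)]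
    _ = _ := by
        rw [lintegral_const_mul _ (measurable_one.indicator
          Metric.isClosed_closedBall.measurableSet), lintegral_indicator_one
          Metric.isClosed_closedBall.measurableSet]

theorem edgeIntPow_ne_top {k : ℕ} (hk : k ≠ 0) : edgeIntPow L k ≠ ∞ := by
  refine ne_top_of_le_ne_top ?_ (lintegral_le_of_le_of_norm
    (C := (volume (Metric.closedBall (0 : L) 2) * volume (Metric.closedBall (0 : Euc d) 1)) ^ k)
    (fun x => ?_) fun x hx => ?_)
  · exact ENNReal.mul_ne_top (ENNReal.pow_ne_top (ENNReal.mul_ne_top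
      (volume_closedBall_ne_top 2) (volume_closedBall_ne_top 1))) (volume_closedBall_ne_top 1)
  · gcongr
    exact edgeInt_le x
  · rw [edgeInt_eq_zero hx, zero_pow hk]

theorem scaledEdgeMarg_eq_zero (δ : ℝ) (a : Euc d) {x : Euc d} (hx : 1 < ‖x‖) :
    scaledEdgeMarg δ L O a x = 0 := by
  simp [scaledEdgeMarg, scaledKernel, kernelAt_eq_zero hx]

/-- The bound for the marginal of a fixed edge is of the exact order δ^(d+2), so dividing by the
Jacobian leaves a constant. It dominates in the later limits. -/
theorem exists_scaledEdgeMarg_le (hL : Module.finrank ℝ L = 2) (hO : MeasurableSet O) {R : ℝ}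
    (hR : O ⊆ Metric.closedBall 0 R) [IsProbabilityMeasure (volume.restrict O)] :
    ∃ C : ℝ≥0∞, C ≠ ∞ ∧ ∀ δ : ℝ, 0 < δ → ∀ a x, scaledEdgeMarg δ L O a x ≤ C := by
  refine ⟨volume (Metric.closedBall (0 : Euc d) 1) *
    (volume (Metric.closedBall (0 : Lᗮ) R) * (4 * volume (Metric.closedBall (0 : L) 1))), ?_, ?_⟩
  · exact ENNReal.mul_ne_top (volume_closedBall_ne_top 1) (ENNReal.mul_ne_top
      (volume_closedBall_ne_top R) (ENNReal.mul_ne_top (by simp) (volume_closedBall_ne_top 1)))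
  · intro δ hδ a x
    have h1 := marg₂_crossFun_le_of_partner (lintegral_nearInd_le (O := O) hδ)
      (lintegral_nearProjInd_le hL hO hR hδ) 0 a (a + δ • x)
    rw [marg₂_crossFun_partner] at h1
    change edgeMarg δ L O a (a + δ • x) ≤ _ at h1
    rw [edgeMarg_rescale hL hO hδ] at h1
    have h0 : ENNReal.ofReal δ ^ d * ENNReal.ofReal δ ^ 2 ≠ 0 := by
      have : ENNReal.ofReal δ ≠ 0 := by simpa using hδ
      positivity
    have ht : ENNReal.ofReal δ ^ d * ENNReal.ofReal δ ^ 2 ≠ ∞ :=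
      ENNReal.mul_ne_top (ENNReal.pow_ne_top ENNReal.ofReal_ne_top)
        (ENNReal.pow_ne_top ENNReal.ofReal_ne_top)
    rw [← ENNReal.mul_le_mul_iff_right h0 ht]
    refine h1.trans (le_of_eq ?_)
    ring

theorem eventually_indicator_eq {p : Euc d} (hp : p ∉ frontier O) :
    ∀ᶠ x in 𝓝 p, O.indicator (1 : Euc d → ℝ≥0∞) x = O.indicator 1 p := by
  by_cases h : p ∈ O
  · have : p ∈ interior O := by
      by_contra h2
      exact hp ⟨subset_closure h, h2⟩
    filter_upwards [mem_interior_iff_mem_nhds.1 this] with x hx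
    rw [indicator_of_mem hx, indicator_of_mem h]
    rfl
  · have : p ∉ closure O := fun h2 => hp ⟨h2, fun h3 => h (interior_subset h3)⟩
    filter_upwards [isClosed_closure.isOpen_compl.mem_nhds this] with x hx
    rw [indicator_of_notMem (fun h2 => hx (subset_closure h2)), indicator_of_notMem h]

theorem lintegral_kernelAt_mul_indicator (hO : MeasurableSet O) (a x : Euc d) :
    ∫⁻ q : L × Lᗮ × Euc d, kernelAt L x q.1 q.2.2 * O.indicator 1 (a + q.2.1) =
      edgeInt L x * secVol L O a := by
  have h1 : Measurable (O.indicator (1 : Euc d → ℝ≥0∞)) := measurable_one.indicator hO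
  have h2 : Measurable fun u : Lᗮ => O.indicator (1 : Euc d → ℝ≥0∞) (a + u) :=
    h1.comp (by fun_prop)
  have h3 : Measurable fun p : L × Euc d => kernelAt L x p.1 p.2 :=
    (measurable_kernelAt L).comp (f := fun p : L × Euc d => (x, p.1, p.2)) (by fun_prop)
  have h4 : Measurable fun q : L × Lᗮ × Euc d =>
      kernelAt L x q.1 q.2.2 * O.indicator 1 (a + q.2.1) :=
    (h3.comp (f := fun q : L × Lᗮ × Euc d => (q.1, q.2.2)) (by fun_prop)).mul
      (h2.comp (f := fun q : L × Lᗮ × Euc d => q.2.1) (by fun_prop))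
  rw [Measure.volume_eq_prod, lintegral_prod _ h4.aemeasurable]
  have h5 : ∀ y : L, ∫⁻ q : Lᗮ × Euc d, kernelAt L x y q.2 * O.indicator 1 (a + q.1) =
      (∫⁻ z, kernelAt L x y z) * secVol L O a := by
    intro y
    have h6 : Measurable fun q : Lᗮ × Euc d => kernelAt L x y q.2 * O.indicator 1 (a + q.1) :=
      h4.comp (f := fun q : Lᗮ × Euc d => (y, q)) (by fun_prop)
    have h7 : Measurable fun z => kernelAt L x y z :=
      h3.comp (f := fun z : Euc d => (y, z)) (by fun_prop)
    rw [Measure.volume_eq_prod, lintegral_prod _ h6.aemeasurable]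
    simp_rw [lintegral_mul_const _ h7]
    rw [lintegral_const_mul _ h2]
    rfl
  simp_rw [h5]
  exact lintegral_mul_const _ h3.lintegral_prod_right'

/-- As δ → 0 both ends of the second edge converge to a + u. Off the frontier both indicators become
that of a + u, and the integral factors into a planar crossing volume and a section volume. -/
theorem tendsto_scaledEdgeMarg (hO : MeasurableSet O) {R : ℝ} (hR : O ⊆ Metric.closedBall 0 R)
    {a : Euc d} (ha : ∀ᵐ u : Lᗮ, a + u ∉ frontier O) (x : Euc d) :
    Tendsto (fun δ => scaledEdgeMarg δ L O a x) (𝓝[>] 0) (𝓝 (edgeInt L x * secVol L O a)) := by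
  rw [← lintegral_kernelAt_mul_indicator hO]
  unfold scaledEdgeMarg
  refine tendsto_lintegral_filter_of_dominated_convergence
    -- Crossing forces ‖y‖ ≤ 2 and ‖z‖ ≤ 1. For δ ≤ 1 the vector u is a point of O minus a minus δy,
    -- which gives the radius R + ‖a‖ + 2.
    (fun q => (Metric.closedBall (0 : L) 2 ×ˢ Metric.closedBall (0 : Lᗮ) (R + ‖a‖ + 2) ×ˢ
      Metric.closedBall (0 : Euc d) 1).indicator 1 q) ?_ ?_ ?_ ?_
  · exact Eventually.of_forall fun δ => (measurable_scaledKernel (L := L) δ hO).comp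
      (f := fun q : L × Lᗮ × Euc d => ((a, x), q)) (by fun_prop)
  · have : ∀ᶠ δ : ℝ in 𝓝[>] 0, δ ≤ 1 ∧ 0 < δ := by
      filter_upwards [Ioo_mem_nhdsGT one_pos] with δ hδ
      exact ⟨hδ.2.le, hδ.1⟩
    filter_upwards [this] with δ hδ
    refine Eventually.of_forall fun q => ?_
    obtain ⟨y, u, z⟩ := q
    by_cases hk : CrossesAt L x y z
    · by_cases ho : a + ((δ • y : L) + (u : Euc d)) ∈ O
      · have hy := hk.norm_le
        have hu : ‖u‖ ≤ R + ‖a‖ + 2 := by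
          have h1 := hR ho
          rw [mem_closedBall_zero_iff] at h1
          have h2 : (u : Euc d) = (a + ((δ • y : L) + (u : Euc d))) - a - (δ • y : L) := by abel
          have h3 : ‖(δ • y : L)‖ ≤ 2 := by
            rw [norm_smul, Real.norm_of_nonneg hδ.2.le]
            nlinarith [norm_nonneg y, hδ.1, hδ.2]
          calc ‖u‖ = ‖(u : Euc d)‖ := rfl
            _ ≤ _ := by
              rw [h2]
              refine (norm_sub_le _ _).trans ?_
              refine add_le_add ((norm_sub_le _ _).trans ?_) h3
              gcongr
        rw [indicator_of_mem]
        · unfold scaledKernel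
          refine (mul_le_mul' (mul_le_mul' (kernelAt_le_one _ _ _) ?_) ?_).trans_eq
            (by simp : (1 : ℝ≥0∞) * 1 * 1 = 1)
          · exact indicator_le_self' (fun _ _ => bot_le) _
          · exact indicator_le_self' (fun _ _ => bot_le) _
        · exact ⟨by simpa using hy, by simpa using hu, by simpa using hk.2.1⟩
      · simp only [scaledKernel, indicator_of_notMem ho, mul_zero, zero_mul]
        exact bot_le
    · simp only [scaledKernel, kernelAt, if_neg hk, zero_mul]
      exact bot_le
  · have hm : MeasurableSet (Metric.closedBall (0 : L) 2 ×ˢ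
        Metric.closedBall (0 : Lᗮ) (R + ‖a‖ + 2) ×ˢ Metric.closedBall (0 : Euc d) 1) :=
      Metric.isClosed_closedBall.measurableSet.prod
        (Metric.isClosed_closedBall.measurableSet.prod Metric.isClosed_closedBall.measurableSet)
    rw [lintegral_indicator_one hm, Measure.volume_eq_prod, Measure.prod_prod,
      Measure.volume_eq_prod, Measure.prod_prod]
    exact ENNReal.mul_ne_top (volume_closedBall_ne_top _)
      (ENNReal.mul_ne_top (volume_closedBall_ne_top _) (volume_closedBall_ne_top _))
  · have h1 : ∀ᵐ q : L × Lᗮ × Euc d, a + q.2.1 ∉ frontier O := by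
      have e1 : ∀ᵐ q : Lᗮ × Euc d, a + q.1 ∉ frontier O :=
        Measure.quasiMeasurePreserving_fst.ae ha
      exact Measure.quasiMeasurePreserving_snd.ae e1
    filter_upwards [h1] with q hq
    have c1 : Tendsto (fun δ : ℝ => a + ((δ • q.1 : L) + (q.2.1 : Euc d))) (𝓝[>] 0)
        (𝓝 (a + q.2.1)) := by
      have : Continuous fun δ : ℝ => a + ((δ • q.1 : L) + (q.2.1 : Euc d)) := by fun_prop
      have := this.tendsto 0
      simp only [zero_smul, Submodule.coe_zero, zero_add] at this
      exact this.mono_left nhdsWithin_le_nhds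
    have c2 : Tendsto (fun δ : ℝ => a + ((δ • q.1 : L) + (q.2.1 : Euc d)) + δ • q.2.2) (𝓝[>] 0)
        (𝓝 (a + q.2.1)) := by
      have : Continuous fun δ : ℝ => a + ((δ • q.1 : L) + (q.2.1 : Euc d)) + δ • q.2.2 := by
        fun_prop
      have := this.tendsto 0
      simp only [zero_smul, Submodule.coe_zero, zero_add, add_zero] at this
      exact this.mono_left nhdsWithin_le_nhds
    refine tendsto_const_nhds.congr' ?_
    filter_upwards [c1.eventually (eventually_indicator_eq hq),
      c2.eventually (eventually_indicator_eq hq)] with δ h2 h3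
    unfold scaledKernel
    rw [h2, h3, mul_assoc]
    congr 1
    -- The two indicators are now the same, and an indicator is its own square.
    by_cases h : a + (q.2.1 : Euc d) ∈ O <;> simp [h]

/-- The rescaled integral of a power of `edgeMarg` over one of the end points of an edge. -/
noncomputable def scaledVertexMarg (k : ℕ) (δ : ℝ) (L : Submodule ℝ (Euc d)) (O : Set (Euc d))
    (a : Euc d) : ℝ≥0∞ :=
  ∫⁻ x, O.indicator 1 (a + δ • x) * scaledEdgeMarg δ L O a x ^ k

theorem measurable_scaledVertexMarg (k : ℕ) (δ : ℝ) (hO : MeasurableSet O) :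
    Measurable (scaledVertexMarg k δ L O) := by
  have h1 : Measurable (O.indicator (1 : Euc d → ℝ≥0∞)) := measurable_one.indicator hO
  have h2 : Measurable fun p : Euc d × Euc d =>
      O.indicator 1 (p.1 + δ • p.2) * scaledEdgeMarg δ L O p.1 p.2 ^ k :=
    (h1.comp (by fun_prop)).mul ((measurable_scaledEdgeMarg δ hO).pow_const k)
  exact h2.lintegral_prod_right'

theorem scaledVertexMarg_le {k : ℕ} (hk : k ≠ 0) {δ : ℝ} {C : ℝ≥0∞}
    (hC : ∀ a x, scaledEdgeMarg δ L O a x ≤ C) (a : Euc d) :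
    scaledVertexMarg k δ L O a ≤ C ^ k * volume (Metric.closedBall (0 : Euc d) 1) := by
  refine lintegral_le_of_le_of_norm (fun x => ?_) fun x hx => ?_
  · refine (mul_le_mul' (indicator_le_self' (fun _ _ => bot_le) _)
      (pow_le_pow_left' (hC a x) k)).trans_eq (one_mul _)
  · rw [scaledEdgeMarg_eq_zero _ _ hx, zero_pow hk, mul_zero]

theorem tendsto_scaledVertexMarg {k : ℕ} (hk : k ≠ 0) (hO : IsOpen O) {R : ℝ}
    (hR : O ⊆ Metric.closedBall 0 R) {C : ℝ≥0∞} (hCt : C ≠ ∞)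
    (hC : ∀ δ : ℝ, 0 < δ → ∀ a x, scaledEdgeMarg δ L O a x ≤ C)
    {a : Euc d} (haO : a ∈ O) (ha : ∀ᵐ u : Lᗮ, a + u ∉ frontier O) :
    Tendsto (fun δ => scaledVertexMarg k δ L O a) (𝓝[>] 0)
      (𝓝 (edgeIntPow L k * secVol L O a ^ k)) := by
  have hlim : edgeIntPow L k * secVol L O a ^ k = ∫⁻ x, (edgeInt L x * secVol L O a) ^ k := by
    simp_rw [mul_pow]
    rw [lintegral_mul_const _ ((measurable_edgeInt L).pow_const k)]
    rfl
  have h1 : Measurable (O.indicator (1 : Euc d → ℝ≥0∞)) := measurable_one.indicator hO.measurableSet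
  rw [hlim]
  refine tendsto_lintegral_filter_of_dominated_convergence
    (fun x => C ^ k * (Metric.closedBall (0 : Euc d) 1).indicator 1 x) ?_ ?_ ?_ ?_
  · refine Eventually.of_forall fun δ => (h1.comp (by fun_prop)).mul
      (Measurable.pow_const ?_ k)
    exact (measurable_scaledEdgeMarg δ hO.measurableSet).comp (f := fun x : Euc d => (a, x))
      (by fun_prop)
  · filter_upwards [self_mem_nhdsWithin] with δ hδ
    refine Eventually.of_forall fun x => ?_
    by_cases h : ‖x‖ ≤ 1
    · have hx : x ∈ Metric.closedBall (0 : Euc d) 1 := by simpa using h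
      rw [indicator_of_mem hx, mul_comm]
      exact mul_le_mul' (pow_le_pow_left' (hC δ hδ a x) k)
        (indicator_le_self' (fun _ _ => bot_le) _)
    · rw [scaledEdgeMarg_eq_zero _ _ (not_le.1 h), zero_pow hk, mul_zero]
      exact bot_le
  · rw [lintegral_const_mul _ (measurable_one.indicator
      Metric.isClosed_closedBall.measurableSet), lintegral_indicator_one
      Metric.isClosed_closedBall.measurableSet]
    exact ENNReal.mul_ne_top (ENNReal.pow_ne_top hCt) (volume_closedBall_ne_top 1)
  · refine Eventually.of_forall fun x => ?_
    have c1 : Tendsto (fun δ : ℝ => a + δ • x) (𝓝[>] 0) (𝓝 a) := by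
      have : Continuous fun δ : ℝ => a + δ • x := by fun_prop
      have := this.tendsto 0
      simp only [zero_smul, add_zero] at this
      exact this.mono_left nhdsWithin_le_nhds
    refine ((ENNReal.Tendsto.pow (n := k)
      (tendsto_scaledEdgeMarg hO.measurableSet hR ha x))).congr' ?_
    filter_upwards [c1.eventually (hO.mem_nhds haO)] with δ h2
    rw [indicator_of_mem h2]
    simp

/-- One statement for all leading terms: k = 1, m = 2 for a common vertex of two crossings; k = 2, m
= 1 for a common edge; k = m = 1, with g the integrated distortion, for a vertex shared with a
stress pair. -/
theorem tendsto_setLIntegral_scaledVertexMarg (hL : Module.finrank ℝ L = 2) {k : ℕ} (hk : k ≠ 0)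
    (m : ℕ) (hO : IsOpen O) (hOf : volume (frontier O) = 0) {R : ℝ}
    (hR : O ⊆ Metric.closedBall 0 R) [IsProbabilityMeasure (volume.restrict O)]
    {g : Euc d → ℝ≥0∞} (hg : Measurable g) (hgt : ∫⁻ a in O, g a ≠ ∞) :
    Tendsto (fun δ => ∫⁻ a in O, scaledVertexMarg k δ L O a ^ m * g a) (𝓝[>] 0)
      (𝓝 (∫⁻ a in O, (edgeIntPow L k * secVol L O a ^ k) ^ m * g a)) := by
  obtain ⟨C, hCt, hC⟩ := exists_scaledEdgeMarg_le hL hO.measurableSet hR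
  refine tendsto_lintegral_filter_of_dominated_convergence
    (fun a => (C ^ k * volume (Metric.closedBall (0 : Euc d) 1)) ^ m * g a) ?_ ?_ ?_ ?_
  · exact Eventually.of_forall fun δ =>
      ((measurable_scaledVertexMarg k δ hO.measurableSet).pow_const m).mul hg
  · filter_upwards [self_mem_nhdsWithin] with δ hδ
    refine Eventually.of_forall fun a => ?_
    gcongr
    exact scaledVertexMarg_le hk (hC δ hδ) a
  · rw [lintegral_const_mul _ hg]
    exact ENNReal.mul_ne_top (ENNReal.pow_ne_top (ENNReal.mul_ne_top
      (ENNReal.pow_ne_top hCt) (volume_closedBall_ne_top 1))) hgt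
  · filter_upwards [ae_lt_top hg hgt, ae_restrict_mem hO.measurableSet,
      ae_restrict_of_ae (ae_section_notMem' (L := L) hOf)] with a h1 h2 h3
    exact ENNReal.Tendsto.mul_const (ENNReal.Tendsto.pow
      (tendsto_scaledVertexMarg hk hO hR hCt hC h2 h3)) (Or.inr h1.ne)

/-- The integral of `edgeMarg` over one of the end points of an edge. -/
noncomputable def vertexMarg (δ : ℝ) (L : Submodule ℝ (Euc d)) (O : Set (Euc d)) (a : Euc d) :
    ℝ≥0∞ :=
  ∫⁻ b in O, edgeMarg δ L O a b

/-- The exponent collects d from the end point b and d + 2 from each factor `edgeMarg`. -/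
theorem setLIntegral_edgeMarg_pow (hL : Module.finrank ℝ L = 2) (hO : MeasurableSet O) {δ : ℝ}
    (hδ : 0 < δ) (k : ℕ) (a : Euc d) : ∫⁻ b in O, edgeMarg δ L O a b ^ k =
      ENNReal.ofReal δ ^ (d + (d + 2) * k) * scaledVertexMarg k δ L O a := by
  have h1 : Measurable (O.indicator (1 : Euc d → ℝ≥0∞)) := measurable_one.indicator hO
  have h2 : Measurable fun b => edgeMarg δ L O a b ^ k :=
    ((measurable_edgeMarg δ).comp (f := fun b : Euc d => (a, b)) (by fun_prop)).pow_const k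
  have h3 : ∫⁻ b in O, edgeMarg δ L O a b ^ k =
      ∫⁻ b, O.indicator 1 b * edgeMarg δ L O a b ^ k := by
    rw [← lintegral_indicator hO]
    refine lintegral_congr fun b => ?_
    by_cases h : b ∈ O <;> simp [h]
  have h4 : Measurable fun b => O.indicator 1 b * edgeMarg δ L O a b ^ k := h1.mul h2
  rw [h3, lintegral_rescale h4 hδ a]
  simp_rw [edgeMarg_rescale hL hO hδ, mul_pow, ← pow_mul, ← pow_add]
  have h5 : Measurable fun x => O.indicator (1 : Euc d → ℝ≥0∞) (a + δ • x) *
      scaledEdgeMarg δ L O a x ^ k :=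
    (h1.comp (by fun_prop)).mul
      (((measurable_scaledEdgeMarg δ hO).comp (f := fun x : Euc d => (a, x))
        (by fun_prop)).pow_const k)
  have h6 : ∀ x, O.indicator (1 : Euc d → ℝ≥0∞) (a + δ • x) *
      (ENNReal.ofReal δ ^ (d * k + 2 * k) * scaledEdgeMarg δ L O a x ^ k) =
      ENNReal.ofReal δ ^ (d * k + 2 * k) * (O.indicator 1 (a + δ • x) *
        scaledEdgeMarg δ L O a x ^ k) := fun x => by ring
  simp_rw [h6]
  rw [lintegral_const_mul _ h5, ← mul_assoc, ← pow_add, ← add_mul]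
  rfl

theorem vertexMarg_eq (hL : Module.finrank ℝ L = 2) (hO : MeasurableSet O) {δ : ℝ} (hδ : 0 < δ)
    (a : Euc d) : vertexMarg δ L O a =
      ENNReal.ofReal δ ^ (2 * d + 2) * scaledVertexMarg 1 δ L O a := by
  have := setLIntegral_edgeMarg_pow hL hO hδ 1 a
  simp only [pow_one] at this
  rw [vertexMarg, this]
  congr 2
  ring

end Limits

end RGG

namespace RGG

set_option linter.unusedSectionVars false

/-! ### Asymptotics of the terms of the second moments -/

section Combinatorics

variable {ι κ : Type*} [Fintype ι] [Fintype κ] [DecidableEq ι] [DecidableEq κ]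

theorem none_mem_matchings : (fun _ => none) ∈ matchings ι κ := by
  simp [matchings]

theorem eq_none_of_card_freeIdx {φ : κ → Option ι} (h : (freeIdx φ).card = Fintype.card κ) :
    φ = fun _ => none := by
  funext j
  have : freeIdx φ = Finset.univ := Finset.card_eq_iff_eq_univ _ |>.1 h
  exact mem_freeIdx.1 (this ▸ Finset.mem_univ j)

theorem exists_of_card_freeIdx_add_one {φ : κ → Option ι}
    (h : (freeIdx φ).card + 1 = Fintype.card κ) :
    ∃ i j, φ j = some i ∧ ∀ k, k ≠ j → φ k = none := by
  have hc : (freeIdx φ)ᶜ.card = 1 := by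
    rw [Finset.card_compl]; omega
  obtain ⟨j, hj⟩ := Finset.card_eq_one.1 hc
  have h1 : ∀ k, φ k ≠ none ↔ k = j := fun k => by
    rw [← Finset.mem_singleton, ← hj, Finset.mem_compl, mem_freeIdx]
  obtain ⟨i, hi⟩ := Option.ne_none_iff_exists'.1 ((h1 j).2 rfl)
  exact ⟨i, j, hi, fun k hk => not_not.1 fun h2 => hk ((h1 k).1 h2)⟩

theorem exists_of_card_freeIdx_add_two {φ : κ → Option ι} (hφ : φ ∈ matchings ι κ)
    (h : (freeIdx φ).card + 2 = Fintype.card κ) :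
    ∃ i i' j j', i ≠ i' ∧ j ≠ j' ∧ φ j = some i ∧ φ j' = some i' ∧
      ∀ k, k ≠ j → k ≠ j' → φ k = none := by
  have hc : (freeIdx φ)ᶜ.card = 2 := by
    rw [Finset.card_compl]; omega
  obtain ⟨j, j', hjj, hj⟩ := Finset.card_eq_two.1 hc
  have h1 : ∀ k, φ k ≠ none ↔ k = j ∨ k = j' := fun k => by
    rw [← Finset.mem_singleton (a := j') (b := k), ← Finset.mem_insert, ← hj, Finset.mem_compl,
      mem_freeIdx]
  obtain ⟨i, hi⟩ := Option.ne_none_iff_exists'.1 ((h1 j).2 (Or.inl rfl))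
  obtain ⟨i', hi'⟩ := Option.ne_none_iff_exists'.1 ((h1 j').2 (Or.inr rfl))
  refine ⟨i, i', j, j', ?_, hjj, hi, hi', fun k hk hk' =>
    not_not.1 fun h2 => ((h1 k).1 h2).elim hk hk'⟩
  rintro rfl
  have : ∀ j j', φ j ≠ none → φ j = φ j' → j = j' := by simpa [matchings] using hφ
  exact hjj (this j j' (by simp [hi]) (by rw [hi, hi']))

/-- The partial injection identifies an edge of one crossing with an edge of another one. -/
def SharesEdge (φ : Fin 4 → Option (Fin 4)) : Prop :=
  ∃ i j, φ j = some i ∧ φ (partner j) = some (partner i)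

instance : DecidablePred SharesEdge := fun φ => by unfold SharesEdge; infer_instance

/-- One common vertex: 4 · 4 choices. -/
theorem card_filter_freeIdx_eq_three :
    ((matchings (Fin 4) (Fin 4)).filter fun φ => (freeIdx φ).card = 3).card = 16 := by
  decide +kernel

/-- One common edge: 2 · 2 choices of the edges and 2 orientations. -/
theorem card_filter_sharesEdge :
    ((matchings (Fin 4) (Fin 4)).filter fun φ =>
      (freeIdx φ).card = 2 ∧ SharesEdge φ).card = 8 := by
  decide +kernel

theorem card_filter_freeIdx_eq_one :
    ((matchings (Fin 4) (Fin 2)).filter fun φ => (freeIdx φ).card = 1).card = 8 := by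
  decide +kernel

theorem card_filter_freeIdx_eq_one' :
    ((matchings (Fin 2) (Fin 2)).filter fun φ => (freeIdx φ).card = 1).card = 4 := by
  decide +kernel

end Combinatorics

/-! ### Leading and negligible patterns for two crossings -/

section Asymptotics

theorem tendsto_toReal_div_pow {K Ψ : ℝ → ℝ≥0∞} {e : ℕ} {c : ℝ≥0∞}
    (hK : ∀ δ, 0 < δ → K δ = ENNReal.ofReal δ ^ e * Ψ δ) (hΨ : Tendsto Ψ (𝓝[>] 0) (𝓝 c))
    (hc : c ≠ ∞) : Tendsto (fun δ => (K δ).toReal / δ ^ e) (𝓝[>] 0) (𝓝 c.toReal) := by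
  refine ((ENNReal.tendsto_toReal hc).comp hΨ).congr' ?_
  filter_upwards [self_mem_nhdsWithin] with δ hδ
  have hδ' : 0 < δ := hδ
  rw [hK δ hδ, ENNReal.toReal_mul, ENNReal.toReal_pow, ENNReal.toReal_ofReal hδ'.le,
    Function.comp_apply]
  field_simp

theorem tendsto_toReal_div_pow_zero {K : ℝ → ℝ≥0∞} {e s : ℕ} (hs : s ≠ 0) {C : ℝ≥0∞} (hC : C ≠ ∞)
    (hK : ∀ δ, 0 < δ → K δ ≤ C * ENNReal.ofReal δ ^ (e + s)) :
    Tendsto (fun δ => (K δ).toReal / δ ^ e) (𝓝[>] 0) (𝓝 0) := by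
  have h0 : Tendsto (fun δ : ℝ => C.toReal * δ ^ s) (𝓝[>] 0) (𝓝 0) := by
    have : Continuous fun δ : ℝ => C.toReal * δ ^ s := by fun_prop
    have := this.tendsto 0
    simp only [zero_pow hs, mul_zero] at this
    exact this.mono_left nhdsWithin_le_nhds
  refine tendsto_of_tendsto_of_tendsto_of_le_of_le' tendsto_const_nhds h0 ?_ ?_
  · filter_upwards [self_mem_nhdsWithin] with δ hδ
    have hδ' : 0 < δ := hδ
    positivity
  · filter_upwards [self_mem_nhdsWithin] with δ hδ
    have hδ' : 0 < δ := hδ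
    rw [div_le_iff₀ (by positivity), mul_assoc, ← pow_add, add_comm s e]
    have := ENNReal.toReal_mono (ENNReal.mul_ne_top hC
      (ENNReal.pow_ne_top ENNReal.ofReal_ne_top)) (hK δ hδ)
    rwa [ENNReal.toReal_mul, ENNReal.toReal_pow, ENNReal.toReal_ofReal hδ'.le] at this

variable {d : ℕ} {L : Submodule ℝ (Euc d)} {O : Set (Euc d)}

theorem marg₁_crossFun [IsProbabilityMeasure ((volume : Measure (Euc d)).restrict O)] (δ : ℝ)
    (i : Fin 4) (a : Euc d) :
    marg₁ (volume.restrict O) (crossFun δ L) i a = vertexMarg δ L O a := by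
  have hi : ∀ i : Fin 4, i ≠ partner i := by decide
  rw [marg₁_eq_lintegral_marg₂ (measurable_crossFun δ L) (hi i)]
  refine lintegral_congr fun b => ?_
  rw [marg₂_crossFun_partner]
  rfl

/-- The limit of the term of the variance of the crossing number that belongs to a partial
injection. -/
noncomputable def crossLimit (L : Submodule ℝ (Euc d)) (O : Set (Euc d))
    (φ : Fin 4 → Option (Fin 4)) : ℝ :=
  if (freeIdx φ).card = 3 then (edgeIntPow L 1 ^ 2 * ∫⁻ a in O, secVol L O a ^ 2).toReal
  else if (freeIdx φ).card = 2 ∧ SharesEdge φ then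
    (edgeIntPow L 2 * ∫⁻ a in O, secVol L O a ^ 2).toReal
  else 0

theorem setLIntegral_secVol_pow_ne_top (hO : MeasurableSet O) {R : ℝ}
    (hR : O ⊆ Metric.closedBall 0 R) [IsProbabilityMeasure ((volume : Measure (Euc d)).restrict O)]
    (k : ℕ) : ∫⁻ a in O, secVol L O a ^ k ≠ ∞ := by
  refine ne_top_of_le_ne_top ?_ (lintegral_mono (g := fun _ =>
    volume (Metric.closedBall (0 : Lᗮ) R) ^ k) fun a => ?_)
  · simpa using ENNReal.pow_ne_top (volume_closedBall_ne_top R)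
  · exact pow_le_pow_left' (secVol_le hO hR a) k

/-- With at most one free index, one crossing integrates to order δ^(2d+2) and the marginal of the
other is at most of order δ^d per free index. With two free indices and no common edge, in at least
one crossing the shared vertices lie on different edges; its marginal is O(δ^(2d)), and the other
crossing is integrated. -/
theorem pairTerm_crossFun_le (hL : Module.finrank ℝ L = 2) (hO : MeasurableSet O) {R : ℝ}
    (hR : O ⊆ Metric.closedBall 0 R)
    [IsProbabilityMeasure ((volume : Measure (Euc d)).restrict O)] :
    ∃ C : ℝ≥0∞, C ≠ ∞ ∧ ∀ φ ∈ matchings (Fin 4) (Fin 4), (freeIdx φ).card ≤ 2 →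
      ¬ ((freeIdx φ).card = 2 ∧ SharesEdge φ) → ∀ δ : ℝ, 0 < δ →
      pairTerm (volume.restrict O) φ (crossFun δ L) (crossFun δ L) ≤
        C * ENNReal.ofReal δ ^ (((freeIdx φ).card + 2) * d + 2) := by
  set α := volume (Metric.closedBall (0 : Euc d) 1)
  set β := volume (Metric.closedBall (0 : Lᗮ) R) * (4 * volume (Metric.closedBall (0 : L) 1))
  have hα : α ≠ ∞ := volume_closedBall_ne_top 1
  have hβ : β ≠ ∞ := ENNReal.mul_ne_top (volume_closedBall_ne_top R)
    (ENNReal.mul_ne_top (by simp) (volume_closedBall_ne_top 1))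
  -- The summands `α * α`, `α` and `1` serve the cases of two, one and no free index.
  refine ⟨α * α * β * (α * α + α + 1), by finiteness, ?_⟩
  intro φ hφ hcard hns δ hδ
  set D := ENNReal.ofReal δ
  have hA := lintegral_nearInd_le (O := O) hδ
  have hB := lintegral_nearProjInd_le hL hO hR hδ
  have hf := lintegral_crossFun_le hA hB
  have hm := measurable_crossFun δ L
  rcases Nat.lt_or_ge (freeIdx φ).card 2 with hlt | hge
  · have hbound : ∀ c : ℝ≥0∞, (∀ y, lmarginal (fun _ => volume.restrict O) (freeIdx φ)
        (crossFun δ L) y ≤ c) →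
        pairTerm (volume.restrict O) φ (crossFun δ L) (crossFun δ L) ≤
          α * D ^ d * (α * D ^ d) * (β * D ^ 2) * c := by
      intro c hc
      calc _ ≤ ∫⁻ x, crossFun δ L x * c ∂Measure.pi fun _ => volume.restrict O :=
            lintegral_mono fun x => by
              gcongr
              exact hc _
        _ ≤ _ := by
            rw [lintegral_mul_const _ hm]
            gcongr
    rcases Nat.eq_zero_or_pos (freeIdx φ).card with h0 | hpos
    · have hemp : freeIdx φ = ∅ := Finset.card_eq_zero.1 h0
      refine (hbound 1 fun y => ?_).trans ?_
      · rw [hemp, lmarginal_empty]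
        exact crossFun_le_one δ L y
      · rw [h0]
        calc _ = α * α * β * 1 * D ^ ((0 + 2) * d + 2) := by ring
          _ ≤ _ := by
            gcongr
            exact le_add_self
    · have h1 : (freeIdx φ).card = 1 := by omega
      refine (hbound (α * D ^ d) fun y =>
        lmarginal_crossFun_le hA (Finset.card_pos.1 hpos) y).trans ?_
      rw [h1]
      calc _ = α * α * β * α * D ^ ((1 + 2) * d + 2) := by ring
        _ ≤ _ := by
          gcongr
          exact le_add_right le_add_self
  · have h2 : (freeIdx φ).card = 2 := le_antisymm hcard hge
    obtain ⟨i, i', j, j', hi, hj, e1, e2, e3⟩ := exists_of_card_freeIdx_add_two hφ (by rw [h2]; rfl)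
    rw [pairTerm_of_two hm hm hi hj e1 e2 e3, h2]
    have hmm : ∀ i i' : Fin 4, i ≠ i' → ∀ c : ℝ≥0∞,
        ∫⁻ a in O, ∫⁻ b in O, marg₂ (volume.restrict O) (crossFun δ L) i i' a b * c ≤
          α * D ^ d * (α * D ^ d) * (β * D ^ 2) * c := by
      intro i i' hi c
      have hmeas := measurable_marg₂ (μ := volume.restrict O) hm i i'
      have hs : ∀ a, Measurable fun b => marg₂ (volume.restrict O) (crossFun δ L) i i' a b :=
        fun a => hmeas.comp (f := fun b : Euc d => (a, b)) (by fun_prop)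
      simp_rw [lintegral_mul_const _ (hs _)]
      rw [lintegral_mul_const _ hmeas.lintegral_prod_right', lintegral_marg₂ hm hi]
      gcongr
    have hle : ∀ i i' : Fin 4, i ≠ i' → i' ≠ partner i → ∀ a b,
        marg₂ (volume.restrict O) (crossFun δ L) i i' a b ≤ α * D ^ d * (α * D ^ d) :=
      fun i i' h1 h2 a b => marg₂_crossFun_le_of_ne_partner hA h1.symm h2 a b
    have hfinal : α * D ^ d * (α * D ^ d) * (β * D ^ 2) * (α * D ^ d * (α * D ^ d)) ≤
        α * α * β * (α * α + α + 1) * D ^ ((2 + 2) * d + 2) := by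
      calc _ = α * α * β * (α * α) * D ^ ((2 + 2) * d + 2) := by ring
        _ ≤ _ := by
          gcongr
          exact le_add_right le_self_add
    by_cases hp : j' = partner j
    · have hp' : i' ≠ partner i := by
        rintro rfl
        exact hns ⟨h2, i, j, e1, hp ▸ e2⟩
      refine le_trans ?_ ((hmm j j' hj _).trans hfinal)
      refine lintegral_mono fun a => lintegral_mono fun b => ?_
      rw [mul_comm]
      gcongr
      exact hle i i' hi hp' a b
    · refine le_trans ?_ ((hmm i i' hi _).trans hfinal)
      refine lintegral_mono fun a => lintegral_mono fun b => ?_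
      gcongr
      exact hle j j' hj hp a b

/-- With f free indices the pattern carries t^(4+f). The normalisation δ^((f+1)d+4) is such that
t^(4+f) δ^((f+1)d+4) equals t⁷δ^(4d+4) times (1/(tδ^d))^(3-f). -/
theorem tendsto_pairTerm_crossFun (hd : 3 ≤ d) (hL : Module.finrank ℝ L = 2) (hO : IsOpen O)
    (hOf : volume (frontier O) = 0) {R : ℝ} (hR : O ⊆ Metric.closedBall 0 R)
    [IsProbabilityMeasure ((volume : Measure (Euc d)).restrict O)]
    {φ : Fin 4 → Option (Fin 4)} (hφ : φ ∈ matchings (Fin 4) (Fin 4)) (hne : φ ≠ fun _ => none) :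
    Tendsto (fun δ => (pairTerm (volume.restrict O) φ (crossFun δ L) (crossFun δ L)).toReal /
      δ ^ (((freeIdx φ).card + 1) * d + 4)) (𝓝[>] 0) (𝓝 (crossLimit L O φ)) := by
  have hI := fun k => setLIntegral_secVol_pow_ne_top (L := L) hO.measurableSet hR k
  have hcard : (freeIdx φ).card ≤ 3 := by
    have h1 : (freeIdx φ).card ≤ 4 := by simpa using Finset.card_le_univ (freeIdx φ)
    have h2 : (freeIdx φ).card ≠ 4 := fun h => hne (eq_none_of_card_freeIdx (by simpa using h))
    omega
  have h1t : ∫⁻ a in O, (1 : ℝ≥0∞) ≠ ∞ := by simp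
  unfold crossLimit
  split_ifs with h3 h2
  · obtain ⟨i, j, e1, e2⟩ := exists_of_card_freeIdx_add_one (φ := φ) (by rw [h3]; rfl)
    have hlim := tendsto_setLIntegral_scaledVertexMarg hL one_ne_zero 2 hO hOf hR
      (measurable_const (a := (1 : ℝ≥0∞))) h1t
    have hc : ∫⁻ a in O, (edgeIntPow L 1 * secVol L O a ^ 1) ^ 2 * 1 =
        edgeIntPow L 1 ^ 2 * ∫⁻ a in O, secVol L O a ^ 2 := by
      rw [← lintegral_const_mul _ ((measurable_secVol hO.measurableSet).pow_const 2)]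
      refine lintegral_congr fun a => ?_
      rw [pow_one, mul_one, mul_pow]
    rw [← hc]
    refine tendsto_toReal_div_pow (fun δ hδ => ?_) hlim ?_
    · rw [pairTerm_of_one (measurable_crossFun δ L) (measurable_crossFun δ L) e1 e2,
        ← lintegral_const_mul]
      · refine lintegral_congr fun a => ?_
        rw [marg₁_crossFun, marg₁_crossFun, vertexMarg_eq hL hO.measurableSet hδ, h3]
        ring
      · exact ((measurable_scaledVertexMarg 1 δ hO.measurableSet).pow_const 2).mul measurable_const
    · rw [hc]
      exact ENNReal.mul_ne_top (ENNReal.pow_ne_top (edgeIntPow_ne_top one_ne_zero)) (hI 2)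
  · obtain ⟨h2, i, j, e1, e2⟩ := h2
    have hp : ∀ i : Fin 4, i ≠ partner i := by decide
    have e3 : ∀ k, k ≠ j → k ≠ partner j → φ k = none := by
      intro k hk1 hk2
      by_contra hk
      have hsub : ({k, j, partner j} : Finset (Fin 4)) ⊆ (freeIdx φ)ᶜ := by
        intro l hl
        rw [Finset.mem_compl, mem_freeIdx]
        simp only [Finset.mem_insert, Finset.mem_singleton] at hl
        rcases hl with rfl | rfl | rfl
        · exact hk
        · simp [e1]
        · simp [e2]
      have := Finset.card_le_card hsub
      rw [Finset.card_compl, h2, Finset.card_eq_three.2 ⟨k, j, partner j, hk1, hk2, hp j, rfl⟩]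
        at this
      simp at this
    have hlim := tendsto_setLIntegral_scaledVertexMarg hL two_ne_zero 1 hO hOf hR
      (measurable_const (a := (1 : ℝ≥0∞))) h1t
    have hc : ∫⁻ a in O, (edgeIntPow L 2 * secVol L O a ^ 2) ^ 1 * 1 =
        edgeIntPow L 2 * ∫⁻ a in O, secVol L O a ^ 2 := by
      rw [← lintegral_const_mul _ ((measurable_secVol hO.measurableSet).pow_const 2)]
      refine lintegral_congr fun a => ?_
      rw [pow_one, mul_one]
    rw [← hc]
    refine tendsto_toReal_div_pow (fun δ hδ => ?_) hlim ?_
    · rw [pairTerm_of_two (measurable_crossFun δ L) (measurable_crossFun δ L) (hp i) (hp j)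
        e1 e2 e3, ← lintegral_const_mul]
      · refine lintegral_congr fun a => ?_
        have : ∀ b, marg₂ (volume.restrict O) (crossFun δ L) i (partner i) a b *
            marg₂ (volume.restrict O) (crossFun δ L) j (partner j) a b =
            edgeMarg δ L O a b ^ 2 := by
          intro b
          rw [marg₂_crossFun_partner, marg₂_crossFun_partner, sq]
          rfl
        simp_rw [this]
        rw [setLIntegral_edgeMarg_pow hL hO.measurableSet hδ, h2, pow_one, mul_one]
        congr 2
        ring
      · exact ((measurable_scaledVertexMarg 2 δ hO.measurableSet).pow_const 1).mul measurable_const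
    · rw [hc]
      exact ENNReal.mul_ne_top (edgeIntPow_ne_top two_ne_zero) (hI 2)
  · obtain ⟨C, hC, hle⟩ := pairTerm_crossFun_le hL hO.measurableSet hR
    -- The exponent (f+2)d + 2 exceeds (f+1)d + 4 by d - 2, which is positive since d ≥ 3.
    refine tendsto_toReal_div_pow_zero (s := d - 2) (by omega) hC fun δ hδ => ?_
    have := hle φ hφ (by omega) h2 δ hδ
    convert! this using 3
    have : d = (d - 2) + 2 := by omega
    generalize d - 2 = m at *
    subst this
    ring

theorem sum_crossLimit (ℓ : ℝ) :
    ∑ φ ∈ (matchings (Fin 4) (Fin 4)).erase (fun _ => none),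
      ℓ ^ (3 - (freeIdx φ).card) * crossLimit L O φ =
      16 * (edgeIntPow L 1 ^ 2 * ∫⁻ a in O, secVol L O a ^ 2).toReal +
        8 * ℓ * (edgeIntPow L 2 * ∫⁻ a in O, secVol L O a ^ 2).toReal := by
  set x := (edgeIntPow L 1 ^ 2 * ∫⁻ a in O, secVol L O a ^ 2).toReal with hx
  set y := (edgeIntPow L 2 * ∫⁻ a in O, secVol L O a ^ 2).toReal with hy
  have h0 : (freeIdx (fun _ : Fin 4 => (none : Option (Fin 4)))).card = 4 := by decide
  -- The empty matching has four free indices and `crossLimit` zero, so it may be put back before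
  -- counting.
  rw [Finset.sum_erase _ (by simp [crossLimit, h0])]
  have h1 : ∀ φ : Fin 4 → Option (Fin 4), ℓ ^ (3 - (freeIdx φ).card) * crossLimit L O φ =
      (if (freeIdx φ).card = 3 then x else 0) +
        if (freeIdx φ).card = 2 ∧ SharesEdge φ then ℓ * y else 0 := by
    intro φ
    unfold crossLimit
    rw [← hx, ← hy]
    by_cases h3 : (freeIdx φ).card = 3
    · simp [h3]
    · by_cases h2 : (freeIdx φ).card = 2 ∧ SharesEdge φ
      · simp [h2]
      · simp [h3, h2]
  simp_rw [h1]
  rw [Finset.sum_add_distrib, ← Finset.sum_filter, ← Finset.sum_filter, Finset.sum_const,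
    Finset.sum_const, card_filter_freeIdx_eq_three, card_filter_sharesEdge]
  simp only [nsmul_eq_mul, Nat.cast_ofNat]
  ring

/-! ### Terms that involve the stress -/

/-- A symmetric function of two points, as a function of pairs. -/
noncomputable def pairFun (g : Euc d → Euc d → ℝ≥0∞) (v : Fin 2 → Euc d) : ℝ≥0∞ := g (v 0) (v 1)

theorem measurable_pairFun {g : Euc d → Euc d → ℝ≥0∞}
    (hg : Measurable fun p : Euc d × Euc d => g p.1 p.2) : Measurable (pairFun g) :=
  hg.comp (f := fun v : Fin 2 → Euc d => (v 0, v 1)) (by fun_prop)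

variable {μ : Measure (Euc d)} [IsProbabilityMeasure μ] {g : Euc d → Euc d → ℝ≥0∞}

theorem marg₂_pairFun (hsymm : ∀ a b, g a b = g b a) {i j : Fin 2} (hij : i ≠ j) (a b : Euc d) :
    marg₂ μ (pairFun g) i j a b = g a b := by
  have : ∀ i j : Fin 2, i ≠ j → (Finset.univ.erase i).erase j = ∅ := by decide
  rw [marg₂, this i j hij, lmarginal_empty, pairFun]
  rcases Fin.exists_fin_two.1 ⟨i, rfl⟩ with rfl | rfl
  · simp
  · simp [hsymm b a]

theorem marg₁_pairFun (hg : Measurable fun p : Euc d × Euc d => g p.1 p.2)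
    (hsymm : ∀ a b, g a b = g b a) (i : Fin 2) (a : Euc d) :
    marg₁ μ (pairFun g) i a = ∫⁻ b, g a b ∂μ := by
  have : ∀ i : Fin 2, ∃ j, i ≠ j := by decide
  obtain ⟨j, hj⟩ := this i
  rw [marg₁_eq_lintegral_marg₂ (measurable_pairFun hg) hj]
  simp_rw [marg₂_pairFun hsymm hj]

/-- Substitutes for a pointwise bound on the distortion, which is only square integrable. -/
theorem le_inv_add_mul_sq (D q : ℝ≥0∞) (hD : D ≠ 0) (hD' : D ≠ ∞) : q ≤ D⁻¹ + D * q ^ 2 := by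
  rcases le_total q D⁻¹ with h | h
  · exact h.trans le_self_add
  · refine le_trans ?_ le_add_self
    calc q = D * D⁻¹ * q := by rw [ENNReal.mul_inv_cancel hD hD', one_mul]
      _ ≤ D * q * q := by gcongr
      _ = _ := by ring

/-- When both stress points are vertices of the crossing, the marginal m satisfies m = O(δ^(d+2))
and ∫∫ m = O(δ^(2d+2)). Splitting m g ≤ m/δ + δ m g² gives O(δ^(2d+1)) + O(δ^(d+3)), which is
negligible against δ^(d+2). -/
theorem tendsto_pairTerm_crossFun_pairFun (hd : 3 ≤ d) (hL : Module.finrank ℝ L = 2) (hO : IsOpen O)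
    (hOf : volume (frontier O) = 0) {R : ℝ} (hR : O ⊆ Metric.closedBall 0 R)
    [IsProbabilityMeasure ((volume : Measure (Euc d)).restrict O)]
    (hg : Measurable fun p : Euc d × Euc d => g p.1 p.2) (hsymm : ∀ a b, g a b = g b a)
    (hg1 : ∫⁻ a in O, ∫⁻ b in O, g a b ≠ ∞) (hg2 : ∫⁻ a in O, ∫⁻ b in O, g a b ^ 2 ≠ ∞)
    {φ : Fin 2 → Option (Fin 4)} (hφ : φ ∈ matchings (Fin 4) (Fin 2)) (hne : φ ≠ fun _ => none) :
    Tendsto (fun δ => (pairTerm (volume.restrict O) φ (crossFun δ L) (pairFun g)).toReal /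
      δ ^ (((freeIdx φ).card + 1) * d + 2)) (𝓝[>] 0) (𝓝 (if (freeIdx φ).card = 1 then
        (edgeIntPow L 1 * ∫⁻ a in O, secVol L O a * ∫⁻ b in O, g a b).toReal else 0)) := by
  have hcard : (freeIdx φ).card ≤ 1 := by
    have h1 : (freeIdx φ).card ≤ 2 := by simpa using Finset.card_le_univ (freeIdx φ)
    have h2 : (freeIdx φ).card ≠ 2 := fun h => hne (eq_none_of_card_freeIdx (by simpa using h))
    omega
  have hgm : Measurable fun a => ∫⁻ b in O, g a b := hg.lintegral_prod_right'
  split_ifs with h1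
  · obtain ⟨i, j, e1, e2⟩ := exists_of_card_freeIdx_add_one (φ := φ) (by rw [h1]; rfl)
    have hlim := tendsto_setLIntegral_scaledVertexMarg hL one_ne_zero 1 hO hOf hR hgm hg1
    have hc : ∫⁻ a in O, (edgeIntPow L 1 * secVol L O a ^ 1) ^ 1 * ∫⁻ b in O, g a b =
        edgeIntPow L 1 * ∫⁻ a in O, secVol L O a * ∫⁻ b in O, g a b := by
      have hsg : Measurable fun a => secVol L O a * ∫⁻ b in O, g a b :=
        (measurable_secVol hO.measurableSet).mul hgm
      rw [← lintegral_const_mul _ hsg]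
      refine lintegral_congr fun a => ?_
      rw [pow_one, pow_one, mul_assoc]
    rw [← hc]
    refine tendsto_toReal_div_pow (fun δ hδ => ?_) hlim ?_
    · rw [pairTerm_of_one (measurable_crossFun δ L) (measurable_pairFun hg) e1 e2,
        ← lintegral_const_mul]
      · refine lintegral_congr fun a => ?_
        rw [marg₁_crossFun, marg₁_pairFun hg hsymm, vertexMarg_eq hL hO.measurableSet hδ, h1]
        ring
      · exact ((measurable_scaledVertexMarg 1 δ hO.measurableSet).pow_const 1).mul hgm
    · rw [hc]
      refine ENNReal.mul_ne_top (edgeIntPow_ne_top one_ne_zero) ?_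
      refine ne_top_of_le_ne_top (b := volume (Metric.closedBall (0 : Lᗮ) R) *
        ∫⁻ a in O, ∫⁻ b in O, g a b) (ENNReal.mul_ne_top (volume_closedBall_ne_top R) hg1) ?_
      rw [← lintegral_const_mul _ hgm]
      refine lintegral_mono fun a => ?_
      gcongr
      exact secVol_le hO.measurableSet hR a
  · have h0 : (freeIdx φ).card = 0 := by omega
    obtain ⟨i, i', j, j', hi, hj, e1, e2, e3⟩ := exists_of_card_freeIdx_add_two hφ (by rw [h0]; rfl)
    set α := volume (Metric.closedBall (0 : Euc d) 1)
    set β := volume (Metric.closedBall (0 : Lᗮ) R) * (4 * volume (Metric.closedBall (0 : L) 1))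
    have hα : α ≠ ∞ := volume_closedBall_ne_top 1
    have hβ : β ≠ ∞ := ENNReal.mul_ne_top (volume_closedBall_ne_top R)
      (ENNReal.mul_ne_top (by simp) (volume_closedBall_ne_top 1))
    set Q := ∫⁻ a in O, ∫⁻ b in O, g a b ^ 2
    have key : ∀ δ : ℝ, 0 < δ → δ < 1 →
        pairTerm (volume.restrict O) φ (crossFun δ L) (pairFun g) ≤
        (α * α * β + (α * α + α * β) * Q) * ENNReal.ofReal δ ^ (d + 2 + 1) := by
      intro δ hδ hδ1
      set D := ENNReal.ofReal δ
      have hD0 : D ≠ 0 := by simpa [D] using hδ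
      have hDt : D ≠ ∞ := ENNReal.ofReal_ne_top
      have hD1 : D ≤ 1 := by simpa [D] using hδ1.le
      have hA := lintegral_nearInd_le (O := O) hδ
      have hB := lintegral_nearProjInd_le hL hO.measurableSet hR hδ
      have hf := lintegral_crossFun_le hA hB
      have hm := measurable_crossFun δ L
      have hmeas := measurable_marg₂ (μ := volume.restrict O) hm i i'
      have hs : ∀ a, Measurable fun b => marg₂ (volume.restrict O) (crossFun δ L) i i' a b :=
        fun a => hmeas.comp (f := fun b : Euc d => (a, b)) (by fun_prop)
      have hgs : ∀ a, Measurable fun b => g a b ^ 2 :=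
        fun a => (hg.comp (f := fun b : Euc d => (a, b)) (by fun_prop)).pow_const 2
      have hpow : D ^ (2 * d) ≤ D ^ (d + 2) := pow_le_pow_right_of_le_one' hD1 (by omega)
      have hle : ∀ a b, marg₂ (volume.restrict O) (crossFun δ L) i i' a b ≤
          (α * α + α * β) * D ^ (d + 2) := by
        intro a b
        by_cases hp : i' = partner i
        · rw [hp]
          refine (marg₂_crossFun_le_of_partner hA hB i a b).trans ?_
          calc _ = α * β * D ^ (d + 2) := by ring
            _ ≤ _ := by gcongr; exact le_add_self
        · refine (marg₂_crossFun_le_of_ne_partner hA hi.symm hp a b).trans ?_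
          calc _ = α * α * D ^ (2 * d) := by ring
            _ ≤ α * α * D ^ (d + 2) := by gcongr
            _ ≤ _ := by gcongr; exact le_self_add
      rw [pairTerm_of_two hm (measurable_pairFun hg) hi hj e1 e2 e3]
      simp_rw [marg₂_pairFun hsymm hj]
      calc _ ≤ ∫⁻ a in O, ∫⁻ b in O, (marg₂ (volume.restrict O) (crossFun δ L) i i' a b * D⁻¹ +
            (α * α + α * β) * D ^ (d + 2) * D * g a b ^ 2) := by
            refine lintegral_mono fun a => lintegral_mono fun b => ?_
            calc _ ≤ marg₂ (volume.restrict O) (crossFun δ L) i i' a b *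
                  (D⁻¹ + D * g a b ^ 2) := by
                  gcongr
                  exact le_inv_add_mul_sq D _ hD0 hDt
              _ ≤ _ := by
                rw [mul_add]
                refine add_le_add_right ?_ _
                rw [← mul_assoc]
                gcongr
                exact hle a b
        _ = (∫⁻ a in O, ∫⁻ b in O, marg₂ (volume.restrict O) (crossFun δ L) i i' a b) * D⁻¹ +
            (α * α + α * β) * D ^ (d + 2) * D * Q := by
            have e : ∀ a, ∫⁻ b in O, (marg₂ (volume.restrict O) (crossFun δ L) i i' a b * D⁻¹ +
                (α * α + α * β) * D ^ (d + 2) * D * g a b ^ 2) =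
                (∫⁻ b in O, marg₂ (volume.restrict O) (crossFun δ L) i i' a b) * D⁻¹ +
                (α * α + α * β) * D ^ (d + 2) * D * ∫⁻ b in O, g a b ^ 2 := by
              intro a
              rw [lintegral_add_left ((hs a).mul_const _), lintegral_mul_const _ (hs a),
                lintegral_const_mul _ (hgs a)]
            simp_rw [e]
            rw [lintegral_add_left (hmeas.lintegral_prod_right'.mul_const _),
              lintegral_mul_const _ hmeas.lintegral_prod_right',
              lintegral_const_mul _ (hg.pow_const 2).lintegral_prod_right']
        _ ≤ α * D ^ d * (α * D ^ d) * (β * D ^ 2) * D⁻¹ +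
            (α * α + α * β) * D ^ (d + 2) * D * Q := by
            rw [lintegral_marg₂ hm hi]
            gcongr
        _ = α * α * β * (D ^ (2 * d) * D) * (D * D⁻¹) + (α * α + α * β) * Q * D ^ (d + 2 + 1) := by
            ring
        _ ≤ α * α * β * (D ^ (d + 2) * D) * 1 + (α * α + α * β) * Q * D ^ (d + 2 + 1) := by
            rw [ENNReal.mul_inv_cancel hD0 hDt]
            gcongr
        _ = _ := by ring
    rw [h0, zero_add, one_mul]
    have hC : α * α * β + (α * α + α * β) * Q ≠ ∞ := by finiteness
    -- The estimate compares powers of δ and needs δ < 1; truncation does not affect the limit at 0.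
    let K' : ℝ → ℝ≥0∞ := fun δ => if δ < 1 then
      pairTerm (volume.restrict O) φ (crossFun δ L) (pairFun g) else 0
    have hK' := tendsto_toReal_div_pow_zero (K := K') (e := d + 2) (s := 1) one_ne_zero hC
      fun δ hδ => by
        simp only [K']
        split_ifs with h
        · exact key δ hδ h
        · exact bot_le
    refine hK'.congr' ?_
    filter_upwards [Ioo_mem_nhdsGT one_pos] with δ hδ
    simp only [K', if_pos hδ.2]

end Asymptotics

end RGG

namespace RGG

/-! ### The constants in the bound -/

section CrossingConstants

variable {d : ℕ} {L : Submodule ℝ (Euc d)}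

open Classical in
theorem crossConst_integrand_eq (x : Euc d) (hx : ‖x‖ ≤ 1) (y : L) (z : Euc d) (hz : ‖z‖ ≤ 1) :
    (if (segment ℝ 0 (proj L x) ∩ ((fun p => y + p) '' segment ℝ 0 (proj L z))).Nonempty
      then 1 else 0 : ℝ) = (kernelAt L x y z).toReal := by
  rw [segment_translate_image, add_zero]
  unfold kernelAt CrossesAt
  by_cases h : (segment ℝ 0 (proj L x) ∩ segment ℝ y (y + proj L z)).Nonempty
  · rw [if_pos h, if_pos ⟨hx, hz, h⟩, ENNReal.toReal_one]
  · rw [if_neg h, if_neg fun h' => h h'.2.2, ENNReal.toReal_zero]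

theorem toReal_lintegral_eq_setIntegral {α : Type*} [MeasurableSpace α] {μ : Measure α}
    {f : α → ℝ≥0∞} (hf : Measurable f) (hft : ∀ a, f a ≠ ∞) {s : Set α}
    (hs : ∀ a, a ∉ s → f a = 0) : ∫ a in s, (f a).toReal ∂μ = (∫⁻ a, f a ∂μ).toReal := by
  rw [setIntegral_eq_integral_of_forall_compl_eq_zero fun a ha => by rw [hs a ha]; rfl,
    integral_toReal hf.aemeasurable (Eventually.of_forall fun a => (hft a).lt_top)]

theorem crossConst_eq_toReal (L : Submodule ℝ (Euc d)) :
    crossConst L = (edgeIntPow L 1).toReal := by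
  have hk : Measurable fun p : (Euc d × L) × Euc d => kernelAt L p.1.1 p.1.2 p.2 :=
    (measurable_kernelAt L).comp (f := fun p : (Euc d × L) × Euc d => (p.1.1, p.1.2, p.2))
      (by fun_prop)
  have hk1 : ∀ x, Measurable fun y : L => ∫⁻ z, kernelAt L x y z := fun x =>
    hk.lintegral_prod_right'.comp (f := fun y : L => (x, y)) (by fun_prop)
  have hk2 : ∀ x (y : L), Measurable fun z => kernelAt L x y z := fun x y =>
    hk.comp (f := fun z : Euc d => ((x, y), z)) (by fun_prop)
  have hz : ∀ x (y : L), ∀ z, z ∉ Metric.closedBall (0 : Euc d) 1 → kernelAt L x y z = 0 := by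
    intro x y z hz
    refine if_neg fun h => hz ?_
    simpa using h.2.1
  have hy : ∀ x (y : L), y ∉ Metric.closedBall (0 : L) 2 → ∫⁻ z, kernelAt L x y z = 0 := by
    intro x y hy
    have : ∀ z, kernelAt L x y z = 0 := fun z => if_neg fun h => hy (by simpa using h.norm_le)
    simp [this]
  have hfin : ∀ x (y : L), ∫⁻ z, kernelAt L x y z ≠ ∞ := by
    intro x y
    refine ne_top_of_le_ne_top ?_ (lintegral_le_of_le_of_norm (C := 1)
      (fun z => kernelAt_le_one x y z) fun z h => hz x y z (by simpa using h))
    rw [one_mul]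
    exact volume_closedBall_ne_top 1
  have hfin2 : ∀ x, edgeInt L x ≠ ∞ := fun x => ne_top_of_le_ne_top
    (ENNReal.mul_ne_top (volume_closedBall_ne_top 2) (volume_closedBall_ne_top 1)) (edgeInt_le x)
  unfold crossConst edgeIntPow
  simp only [pow_one]
  rw [← toReal_lintegral_eq_setIntegral (measurable_edgeInt L) hfin2
    (s := Metric.closedBall (0 : Euc d) 1) fun x hx => edgeInt_eq_zero (by simpa using hx)]
  refine setIntegral_congr_fun Metric.isClosed_closedBall.measurableSet fun x hx => ?_
  simp only [edgeInt]
  rw [← toReal_lintegral_eq_setIntegral (hk1 x) (hfin x) (hy x)]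
  refine setIntegral_congr_fun Metric.isClosed_closedBall.measurableSet fun y _ => ?_
  beta_reduce
  rw [← toReal_lintegral_eq_setIntegral (hk2 x y)
    (fun z => ne_top_of_le_ne_top ENNReal.one_ne_top (kernelAt_le_one x y z)) (hz x y)]
  refine setIntegral_congr_fun Metric.isClosed_closedBall.measurableSet fun z hz' => ?_
  exact crossConst_integrand_eq x (by simpa using hx) y z (by simpa using hz')

/-- One factor of the square is bounded by the volume of 2B₂ × B_d, which is 4πκ_d. This is the only
loss in the final bound. -/
theorem toReal_edgeIntPow_two_le (hL : Module.finrank ℝ L = 2) :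
    (edgeIntPow L 2).toReal ≤ 4 * Real.pi * kappa d * crossConst L := by
  have hnt : Nontrivial L := Module.nontrivial_of_finrank_pos (R := ℝ) (by rw [hL]; norm_num)
  have h1 : volume (Metric.closedBall (0 : L) 2) = ENNReal.ofReal (4 * Real.pi) := by
    rw [InnerProductSpace.volume_closedBall_of_dim_even (k := 1) (by rw [hL]), hL,
      ← ENNReal.ofReal_pow (by norm_num), ← ENNReal.ofReal_mul (by norm_num)]
    norm_num
  have h2 : edgeIntPow L 2 ≤ ENNReal.ofReal (4 * Real.pi) *
      volume (Metric.closedBall (0 : Euc d) 1) * edgeIntPow L 1 := by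
    unfold edgeIntPow
    rw [← lintegral_const_mul _ ((measurable_edgeInt L).pow_const 1), ← h1]
    refine lintegral_mono fun x => ?_
    rw [sq, pow_one]
    gcongr
    exact edgeInt_le x
  have h3 := ENNReal.toReal_mono (ENNReal.mul_ne_top (ENNReal.mul_ne_top ENNReal.ofReal_ne_top
    (volume_closedBall_ne_top 1)) (edgeIntPow_ne_top one_ne_zero)) h2
  rwa [ENNReal.toReal_mul, ENNReal.toReal_mul, ENNReal.toReal_ofReal (by positivity),
    ← crossConst_eq_toReal] at h3

/-- The edges cross when y = s x|_L - r z|_L with s and r in [0, 1]; such y fill a parallelogram of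
positive area, spanned by x|_L and -z|_L. -/
theorem volume_crossesAt_pos (hL : Module.finrank ℝ L = 2) {x z : Euc d} (hx : ‖x‖ ≤ 1)
    (hz : ‖z‖ ≤ 1) (hlin : LinearIndependent ℝ ![proj L x, proj L z]) :
    0 < ∫⁻ y : L, kernelAt L x y z := by
  have hlin' : LinearIndependent ℝ ![proj L x, -proj L z] := by
    have hx0 : proj L x ≠ 0 := hlin.ne_zero 0
    rw [LinearIndependent.pair_iff' hx0] at hlin ⊢
    intro a ha
    exact hlin (-a) (by rw [neg_smul, ha, neg_neg])
  let b := basisOfLinearIndependentOfCardEqFinrank hlin' (by simp [hL])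
  have hb : (b : Fin 2 → L) = ![proj L x, -proj L z] :=
    coe_basisOfLinearIndependentOfCardEqFinrank hlin' _
  have hpos : 0 < volume (parallelepiped b) :=
    Measure.measure_pos_of_nonempty_interior _ b.parallelepiped.interior_nonempty
  have hm : MeasurableSet (parallelepiped b) :=
    b.parallelepiped.isCompact.isClosed.measurableSet
  refine hpos.trans_le ?_
  rw [← lintegral_indicator_one hm]
  refine lintegral_mono fun y => ?_
  by_cases hy : y ∈ parallelepiped b
  swap
  · rw [indicator_of_notMem hy]
    exact bot_le
  rw [indicator_of_mem hy]
  rw [mem_parallelepiped_iff] at hy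
  obtain ⟨t, ht, hy⟩ := hy
  rw [hb, Fin.sum_univ_two] at hy
  have hcr : CrossesAt L x y z := by
    refine ⟨hx, hz, segment_inter_segment_nonempty_iff.2 ⟨t 0, ⟨ht.1 0, ht.2 0⟩, t 1,
      ⟨ht.1 1, ht.2 1⟩, ?_⟩⟩
    rw [hy]
    simp
  simp [kernelAt, hcr]

/-- If the integral vanished, then for almost all x and z in the unit ball the admissible y would
form a null set. But the projections of x and z are dependent only when x lies in `Lᗮ`, or z in the
preimage of a line; both are proper subspaces. -/
theorem edgeIntPow_one_ne_zero (hL : Module.finrank ℝ L = 2) : edgeIntPow L 1 ≠ 0 := by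
  intro h0
  have hk : Measurable fun p : (Euc d × L) × Euc d => kernelAt L p.1.1 p.1.2 p.2 :=
    (measurable_kernelAt L).comp (f := fun p : (Euc d × L) × Euc d => (p.1.1, p.1.2, p.2))
      (by fun_prop)
  have h1 : ∀ᵐ x, edgeInt L x = 0 := by
    simp only [edgeIntPow, pow_one] at h0
    exact (lintegral_eq_zero_iff (measurable_edgeInt L)).1 h0
  have hball : volume (Metric.closedBall (0 : Euc d) 1) ≠ 0 :=
    (Metric.measure_closedBall_pos _ _ one_pos).ne'
  have hx0 : ∀ᵐ x : Euc d, proj L x ≠ 0 := by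
    have hne : Lᗮ ≠ ⊤ := by
      rw [Ne, Submodule.orthogonal_eq_top_iff]
      rintro rfl
      simp at hL
    have := measure_eq_zero_iff_ae_notMem.1 (Measure.addHaar_submodule volume Lᗮ hne)
    filter_upwards [this] with x hx h
    exact hx (Submodule.orthogonalProjectionOnto_eq_zero_iff.1 h)
  obtain ⟨x, hxb, hx1, hx2⟩ := Measure.exists_mem_of_measure_ne_zero_of_ae hball
    (ae_restrict_of_ae (h1.and hx0))
  have h2 : ∀ᵐ z, ∫⁻ y : L, kernelAt L x y z = 0 := by
    have hm : Measurable fun p : L × Euc d => kernelAt L x p.1 p.2 :=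
      hk.comp (f := fun p : L × Euc d => ((x, p.1), p.2)) (by fun_prop)
    have hsw : ∫⁻ z, ∫⁻ y : L, kernelAt L x y z = 0 := by
      rw [lintegral_lintegral_swap]
      · exact hx1
      · exact (hm.comp measurable_swap).aemeasurable
    exact (lintegral_eq_zero_iff (hm.comp measurable_swap).lintegral_prod_right').1 hsw
  have hz0 : ∀ᵐ z : Euc d, proj L z ∉ Submodule.span ℝ {proj L x} := by
    have hne : (Submodule.span ℝ {proj L x}).comap L.orthogonalProjectionOnto.toLinearMap ≠ ⊤ := by
      intro htop
      have hall : (⊤ : Submodule ℝ L) ≤ Submodule.span ℝ {proj L x} := by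
        intro y _
        have : (y : Euc d) ∈
            (Submodule.span ℝ {proj L x}).comap L.orthogonalProjectionOnto.toLinearMap := by
          rw [htop]; trivial
        rw [Submodule.mem_comap] at this
        have e : L.orthogonalProjectionOnto.toLinearMap (y : Euc d) = y := proj_coe y
        rwa [e] at this
      have h3 := Submodule.finrank_mono hall
      rw [finrank_top, hL, finrank_span_singleton hx2] at h3
      omega
    exact measure_eq_zero_iff_ae_notMem.1 (Measure.addHaar_submodule volume _ hne)
  obtain ⟨z, hzb, hz1, hz2⟩ := Measure.exists_mem_of_measure_ne_zero_of_ae hball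
    (ae_restrict_of_ae (h2.and hz0))
  refine (volume_crossesAt_pos hL (by simpa using hxb) (by simpa using hzb) ?_).ne' hz1
  rw [LinearIndependent.pair_iff' hx2]
  intro a ha
  exact hz2 (Submodule.mem_span_singleton.2 ⟨a, ha⟩)

theorem crossConst_pos (hL : Module.finrank ℝ L = 2) : 0 < crossConst L := by
  rw [crossConst_eq_toReal]
  exact ENNReal.toReal_pos (edgeIntPow_one_ne_zero hL) (edgeIntPow_ne_top one_ne_zero)

end CrossingConstants

end RGG

namespace RGG

set_option linter.unusedSectionVars false

/-! ### Covariances of sums over tuples -/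

section Covariance

variable {Ω : Type*} [MeasurableSpace Ω] {P : Measure Ω}

theorem memLp_toReal {Y : Ω → ℝ≥0∞} (hY : AEMeasurable Y P) (h : ∫⁻ ω, Y ω * Y ω ∂P ≠ ∞) :
    MemLp (fun ω => (Y ω).toReal) 2 P := by
  rw [memLp_two_iff_integrable_sq hY.ennreal_toReal.aestronglyMeasurable]
  have := integrable_toReal_of_lintegral_ne_top (hY.mul hY) h
  refine this.congr (Eventually.of_forall fun ω => ?_)
  simp [sq]

theorem lintegral_mul_ne_top {Y Z : Ω → ℝ≥0∞} (hY : AEMeasurable Y P)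
    (hY2 : ∫⁻ ω, Y ω * Y ω ∂P ≠ ∞) (hZ2 : ∫⁻ ω, Z ω * Z ω ∂P ≠ ∞) :
    ∫⁻ ω, Y ω * Z ω ∂P ≠ ∞ := by
  refine ne_top_of_le_ne_top (ENNReal.add_ne_top.2 ⟨hY2, hZ2⟩) ?_
  have hYY : AEMeasurable (fun ω => Y ω * Y ω) P := hY.mul hY
  rw [← lintegral_add_left' hYY]
  refine lintegral_mono fun ω => ?_
  rcases le_total (Y ω) (Z ω) with h | h
  · exact le_trans (by gcongr) le_add_self
  · exact le_trans (by gcongr) le_self_add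

theorem covariance_toReal [IsProbabilityMeasure P] {Y Z : Ω → ℝ≥0∞} (hY : AEMeasurable Y P)
    (hZ : AEMeasurable Z P) (hY2 : ∫⁻ ω, Y ω * Y ω ∂P ≠ ∞) (hZ2 : ∫⁻ ω, Z ω * Z ω ∂P ≠ ∞) :
    covariance (fun ω => (Y ω).toReal) (fun ω => (Z ω).toReal) P =
      (∫⁻ ω, Y ω * Z ω ∂P).toReal - (∫⁻ ω, Y ω ∂P).toReal * (∫⁻ ω, Z ω ∂P).toReal := by
  have hfin : ∀ {U : Ω → ℝ≥0∞}, AEMeasurable U P → ∫⁻ ω, U ω * U ω ∂P ≠ ∞ →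
      ∀ᵐ ω ∂P, U ω < ∞ := by
    intro U hU h
    filter_upwards [ae_lt_top' (hU.mul hU) h] with ω hω
    by_contra h2
    rw [not_lt, top_le_iff] at h2
    simp [h2] at hω
  rw [covariance_eq_sub (memLp_toReal hY hY2) (memLp_toReal hZ hZ2)]
  congr 1
  · have hYZ : AEMeasurable (fun ω => Y ω * Z ω) P := hY.mul hZ
    rw [← integral_toReal hYZ (ae_lt_top' hYZ (lintegral_mul_ne_top hY hY2 hZ2))]
    simp [ENNReal.toReal_mul]
  · rw [integral_toReal hY (hfin hY hY2), integral_toReal hZ (hfin hZ hZ2)]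

variable {d : ℕ} {t : ℝ} {W : Set (Euc d)} {N : Ω → ℕ} {X : ℕ → Ω → Euc d}
  {ι κ : Type*} [Fintype ι] [Fintype κ] [DecidableEq ι] [DecidableEq κ]

/-- The covariance of two sums over tuples of points of a Poisson process of intensity `t`. -/
noncomputable def covSum (μ : Measure (Euc d)) (t : ℝ) (F : (ι → Euc d) → ℝ≥0∞)
    (G : (κ → Euc d) → ℝ≥0∞) : ℝ :=
  ∑ φ ∈ (matchings ι κ).erase fun _ => none,
    t ^ (Fintype.card ι + (freeIdx φ).card) * (pairTerm μ φ F G).toReal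

theorem IsPoissonSample.lintegral_tupleSum_mul_self_ne_top
    [NullSingletonClass (volume : Measure (Euc d))]
    (h : IsPoissonSample P t W N X) (hW : volume W = 1) {F : (ι → Euc d) → ℝ≥0∞}
    (hF : Measurable F) (hFF : ∀ φ ∈ matchings ι ι, pairTerm (volume.restrict W) φ F F ≠ ∞) :
    ∫⁻ ω, tupleSum F (pointSet N X ω) * tupleSum F (pointSet N X ω) ∂P ≠ ∞ := by
  rw [h.lintegral_tupleSum_mul hW hF hF]
  exact ENNReal.sum_ne_top.2 fun φ hφ =>
    ENNReal.mul_ne_top (ENNReal.pow_ne_top ENNReal.ofReal_ne_top) (hFF φ hφ)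

/-- The empty matching equals the product of the expectations and cancels. What remains is a sum of
nonnegative terms, so no cancellation has to be controlled in the limits. -/
theorem IsPoissonSample.covariance_tupleSum [NullSingletonClass (volume : Measure (Euc d))]
    (h : IsPoissonSample P t W N X) (ht : 0 < t) (hW : volume W = 1) {F : (ι → Euc d) → ℝ≥0∞}
    {G : (κ → Euc d) → ℝ≥0∞} (hF : Measurable F) (hG : Measurable G)
    (hFF : ∀ φ ∈ matchings ι ι, pairTerm (volume.restrict W) φ F F ≠ ∞)
    (hGG : ∀ φ ∈ matchings κ κ, pairTerm (volume.restrict W) φ G G ≠ ∞) :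
    covariance (fun ω => (tupleSum F (pointSet N X ω)).toReal)
      (fun ω => (tupleSum G (pointSet N X ω)).toReal) P = covSum (volume.restrict W) t F G := by
  have := h.isProbabilityMeasure
  have : IsProbabilityMeasure ((volume : Measure (Euc d)).restrict W) := ⟨by simpa using hW⟩
  have hY := h.aemeasurable_tupleSum hW hF
  have hZ := h.aemeasurable_tupleSum hW hG
  have hY2 := h.lintegral_tupleSum_mul_self_ne_top hW hF hFF
  have hZ2 := h.lintegral_tupleSum_mul_self_ne_top hW hG hGG
  have hYZ := lintegral_mul_ne_top hY hY2 hZ2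
  rw [covariance_toReal hY hZ hY2 hZ2]
  rw [h.lintegral_tupleSum_mul hW hF hG] at hYZ ⊢
  have hterm := ENNReal.sum_ne_top.1 hYZ
  rw [ENNReal.toReal_sum hterm, ← Finset.add_sum_erase _ _ none_mem_matchings,
    pairTerm_none _ F hF G, h.lintegral_tupleSum hW hF, h.lintegral_tupleSum hW hG, covSum]
  have hc : (freeIdx fun _ : κ => (none : Option ι)).card = Fintype.card κ := by
    simp [freeIdx]
  simp only [ENNReal.toReal_mul, ENNReal.toReal_pow, ENNReal.toReal_ofReal ht.le, hc]
  ring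

end Covariance

/-! ### Asymptotics of the covariances -/

section Limits

/-- Sharing e more points than the leading pattern costs t^e and releases δ^(de), that is, a factor
(1/(tδ^d))^e. -/
theorem mul_div_mul_pow_eq {t δ : ℝ} (ht : 0 < t) (hδ : 0 < δ) (K : ℝ) (d a b e : ℕ) :
    t ^ a * K / (t ^ (a + e) * δ ^ (b + d * e)) = (1 / (t * δ ^ d)) ^ e * (K / δ ^ b) := by
  rw [div_pow, mul_pow, one_pow, ← pow_mul, pow_add, pow_add]
  field_simp

variable {d : ℕ} {L : Submodule ℝ (Euc d)} {O : Set (Euc d)} {g : Euc d → Euc d → ℝ≥0∞}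
  {δ : ℝ → ℝ} {ℓ : ℝ}

theorem tendsto_covSum_crossFun (hd : 3 ≤ d) (hL : Module.finrank ℝ L = 2) (hO : IsOpen O)
    (hOf : volume (frontier O) = 0) {R : ℝ} (hR : O ⊆ Metric.closedBall 0 R)
    [IsProbabilityMeasure ((volume : Measure (Euc d)).restrict O)]
    (hδ : Tendsto δ atTop (𝓝[>] 0)) (hℓ : Tendsto (fun t => 1 / (t * δ t ^ d)) atTop (𝓝 ℓ)) :
    Tendsto (fun t => covSum (volume.restrict O) t (crossFun (δ t) L) (crossFun (δ t) L) /
      (t ^ 7 * δ t ^ (4 * d + 4))) atTop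
      (𝓝 (16 * (edgeIntPow L 1 ^ 2 * ∫⁻ a in O, secVol L O a ^ 2).toReal +
        8 * ℓ * (edgeIntPow L 2 * ∫⁻ a in O, secVol L O a ^ 2).toReal)) := by
  rw [← sum_crossLimit]
  simp only [covSum, Finset.sum_div]
  refine tendsto_finsetSum _ fun φ hφ => ?_
  obtain ⟨hne, hφ⟩ := Finset.mem_erase.1 hφ
  have hcard : (freeIdx φ).card ≤ 3 := by
    have h1 : (freeIdx φ).card ≤ 4 := by simpa using Finset.card_le_univ (freeIdx φ)
    have h2 : (freeIdx φ).card ≠ 4 := fun h => hne (eq_none_of_card_freeIdx (by simpa using h))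
    omega
  refine ((hℓ.pow (3 - (freeIdx φ).card)).mul
    ((tendsto_pairTerm_crossFun hd hL hO hOf hR hφ hne).comp hδ)).congr' ?_
  filter_upwards [eventually_gt_atTop 0, hδ.eventually self_mem_nhdsWithin] with t ht hδt
  rw [Function.comp_apply, ← mul_div_mul_pow_eq (a := 4 + (freeIdx φ).card) ht hδt]
  congr 3
  · omega
  · obtain ⟨e, he⟩ := Nat.exists_eq_add_of_le hcard
    rw [he, Nat.add_sub_cancel_left]
    have : 4 = (freeIdx φ).card + e + 1 := by omega
    have h4 : 4 * d = ((freeIdx φ).card + e + 1) * d := by rw [← this]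
    rw [h4]
    ring

theorem tendsto_covSum_crossFun_pairFun (hd : 3 ≤ d) (hL : Module.finrank ℝ L = 2)
    (hO : IsOpen O) (hOf : volume (frontier O) = 0) {R : ℝ} (hR : O ⊆ Metric.closedBall 0 R)
    [IsProbabilityMeasure ((volume : Measure (Euc d)).restrict O)]
    (hg : Measurable fun p : Euc d × Euc d => g p.1 p.2) (hsymm : ∀ a b, g a b = g b a)
    (hg1 : ∫⁻ a in O, ∫⁻ b in O, g a b ≠ ∞) (hg2 : ∫⁻ a in O, ∫⁻ b in O, g a b ^ 2 ≠ ∞)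
    (hδ : Tendsto δ atTop (𝓝[>] 0)) (hℓ : Tendsto (fun t => 1 / (t * δ t ^ d)) atTop (𝓝 ℓ)) :
    Tendsto (fun t => covSum (volume.restrict O) t (crossFun (δ t) L) (pairFun g) /
      (t ^ 5 * δ t ^ (2 * d + 2))) atTop
      (𝓝 (8 * (edgeIntPow L 1 * ∫⁻ a in O, secVol L O a * ∫⁻ b in O, g a b).toReal)) := by
  set x := (edgeIntPow L 1 * ∫⁻ a in O, secVol L O a * ∫⁻ b in O, g a b).toReal with hx
  have hsum : 8 * x = ∑ φ ∈ (matchings (Fin 4) (Fin 2)).erase (fun _ => none),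
      ℓ ^ (1 - (freeIdx φ).card) * if (freeIdx φ).card = 1 then x else 0 := by
    have h0 : (freeIdx (fun _ : Fin 2 => (none : Option (Fin 4)))).card = 2 := by decide
    rw [Finset.sum_erase _ (by simp [h0])]
    have h1 : ∀ φ : Fin 2 → Option (Fin 4), (ℓ ^ (1 - (freeIdx φ).card) *
        if (freeIdx φ).card = 1 then x else 0) = if (freeIdx φ).card = 1 then x else 0 := by
      intro φ
      split_ifs with h <;> simp [h]
    simp only [h1]
    rw [← Finset.sum_filter, Finset.sum_const, card_filter_freeIdx_eq_one]
    simp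
  rw [hsum]
  simp only [covSum, Finset.sum_div]
  refine tendsto_finsetSum _ fun φ hφ => ?_
  obtain ⟨hne, hφ⟩ := Finset.mem_erase.1 hφ
  have hcard : (freeIdx φ).card ≤ 1 := by
    have h1 : (freeIdx φ).card ≤ 2 := by simpa using Finset.card_le_univ (freeIdx φ)
    have h2 : (freeIdx φ).card ≠ 2 := fun h => hne (eq_none_of_card_freeIdx (by simpa using h))
    omega
  refine ((hℓ.pow (1 - (freeIdx φ).card)).mul
    ((tendsto_pairTerm_crossFun_pairFun hd hL hO hOf hR hg hsymm hg1 hg2 hφ hne).comp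
      hδ)).congr' ?_
  filter_upwards [eventually_gt_atTop 0, hδ.eventually self_mem_nhdsWithin] with t ht hδt
  rw [Function.comp_apply, ← mul_div_mul_pow_eq (a := 4 + (freeIdx φ).card) ht hδt]
  congr 3
  · omega
  · obtain ⟨e, he⟩ := Nat.exists_eq_add_of_le hcard
    have h1 : 1 - (freeIdx φ).card = e := by omega
    have : 2 = (freeIdx φ).card + e + 1 := by omega
    have h2 : 2 * d = ((freeIdx φ).card + e + 1) * d := by rw [← this]
    rw [h1, h2]
    ring

theorem pairTerm_pairFun {μ : Measure (Euc d)} [IsProbabilityMeasure μ]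
    (hg : Measurable fun p : Euc d × Euc d => g p.1 p.2) (hsymm : ∀ a b, g a b = g b a)
    {φ : Fin 2 → Option (Fin 2)} (hφ : φ ∈ matchings (Fin 2) (Fin 2)) (hne : φ ≠ fun _ => none) :
    (freeIdx φ).card = 1 ∧ pairTerm μ φ (pairFun g) (pairFun g) = ∫⁻ a, (∫⁻ b, g a b ∂μ) ^ 2 ∂μ ∨
    (freeIdx φ).card = 0 ∧
      pairTerm μ φ (pairFun g) (pairFun g) = ∫⁻ a, ∫⁻ b, g a b ^ 2 ∂μ ∂μ := by
  have h1 : (freeIdx φ).card ≤ 2 := by simpa using Finset.card_le_univ (freeIdx φ)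
  have h2 : (freeIdx φ).card ≠ 2 := fun h => hne (eq_none_of_card_freeIdx (by simpa using h))
  rcases (by omega : (freeIdx φ).card = 1 ∨ (freeIdx φ).card = 0) with h | h
  · left
    obtain ⟨i, j, e1, e2⟩ := exists_of_card_freeIdx_add_one (φ := φ) (by rw [h]; rfl)
    rw [pairTerm_of_one (measurable_pairFun hg) (measurable_pairFun hg) e1 e2]
    simp_rw [marg₁_pairFun hg hsymm, ← sq]
    exact ⟨h, trivial⟩
  · right
    obtain ⟨i, i', j, j', hi, hj, e1, e2, e3⟩ := exists_of_card_freeIdx_add_two hφ (by rw [h]; rfl)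
    rw [pairTerm_of_two (measurable_pairFun hg) (measurable_pairFun hg) hi hj e1 e2 e3]
    simp_rw [marg₂_pairFun hsymm hj, marg₂_pairFun hsymm hi, ← sq]
    exact ⟨h, trivial⟩

/-- Patterns with one common point carry t³; those with both points in common carry only t² and
vanish. -/
theorem tendsto_covSum_pairFun {μ : Measure (Euc d)} [IsProbabilityMeasure μ]
    (hg : Measurable fun p : Euc d × Euc d => g p.1 p.2) (hsymm : ∀ a b, g a b = g b a) :
    Tendsto (fun t : ℝ => covSum μ t (pairFun g) (pairFun g) / t ^ 3) atTop
      (𝓝 (4 * (∫⁻ a, (∫⁻ b, g a b ∂μ) ^ 2 ∂μ).toReal)) := by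
  set x := (∫⁻ a, (∫⁻ b, g a b ∂μ) ^ 2 ∂μ).toReal with hx
  have hsum : 4 * x = ∑ φ ∈ (matchings (Fin 2) (Fin 2)).erase (fun _ => none),
      if (freeIdx φ).card = 1 then x else 0 := by
    have h0 : (freeIdx (fun _ : Fin 2 => (none : Option (Fin 2)))).card = 2 := by decide
    rw [Finset.sum_erase _ (by simp [h0]), ← Finset.sum_filter, Finset.sum_const,
      card_filter_freeIdx_eq_one']
    simp
  rw [hsum]
  simp only [covSum, Finset.sum_div]
  refine tendsto_finsetSum _ fun φ hφ => ?_
  obtain ⟨hne, hφ⟩ := Finset.mem_erase.1 hφ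
  rcases pairTerm_pairFun (μ := μ) hg hsymm hφ hne with ⟨h, e⟩ | ⟨h, e⟩
  · rw [if_pos h, e, h, ← hx]
    refine tendsto_const_nhds.congr' ?_
    filter_upwards [eventually_gt_atTop 0] with t ht
    simp only [Fintype.card_fin]
    field_simp
  · rw [if_neg (by omega), e, h]
    set y := (∫⁻ a, ∫⁻ b, g a b ^ 2 ∂μ ∂μ).toReal
    have h0 : Tendsto (fun t : ℝ => t⁻¹ * y) atTop (𝓝 0) := by
      simpa using tendsto_inv_atTop_zero.mul_const y
    refine h0.congr' ?_
    filter_upwards [eventually_gt_atTop 0] with t ht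
    simp only [Fintype.card_fin, add_zero]
    field_simp

theorem pairTerm_pairFun_ne_top {μ : Measure (Euc d)} [IsProbabilityMeasure μ]
    (hg : Measurable fun p : Euc d × Euc d => g p.1 p.2) (hsymm : ∀ a b, g a b = g b a)
    (hg0 : ∫⁻ a, ∫⁻ b, g a b ∂μ ∂μ ≠ ∞) (hg1 : ∫⁻ a, (∫⁻ b, g a b ∂μ) ^ 2 ∂μ ≠ ∞)
    (hg2 : ∫⁻ a, ∫⁻ b, g a b ^ 2 ∂μ ∂μ ≠ ∞) {φ : Fin 2 → Option (Fin 2)}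
    (hφ : φ ∈ matchings (Fin 2) (Fin 2)) : pairTerm μ φ (pairFun g) (pairFun g) ≠ ∞ := by
  by_cases hne : φ = fun _ => none
  · have h01 : (0 : Fin 2) ≠ 1 := by decide
    have hint : ∫⁻ x, pairFun g x ∂Measure.pi (fun _ => μ) ≠ ∞ := by
      rw [← lintegral_marg₂ (measurable_pairFun hg) h01]
      simp_rw [marg₂_pairFun hsymm h01]
      exact hg0
    rw [hne, pairTerm_none _ _ (measurable_pairFun hg)]
    exact ENNReal.mul_ne_top hint hint
  · rcases pairTerm_pairFun (μ := μ) hg hsymm hφ hne with ⟨_, e⟩ | ⟨_, e⟩ <;> rw [e] <;> assumption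

theorem pairTerm_crossFun_ne_top {μ : Measure (Euc d)} [IsProbabilityMeasure μ] (δ : ℝ)
    (φ : Fin 4 → Option (Fin 4)) : pairTerm μ φ (crossFun δ L) (crossFun δ L) ≠ ∞ := by
  refine ne_top_of_le_ne_top (b := 1) ENNReal.one_ne_top ?_
  have h : ∀ x, mergeFun φ (crossFun δ L) (crossFun δ L) x ≤ 1 := fun x =>
    mul_le_one' (crossFun_le_one δ L _) (crossFun_le_one δ L _)
  rw [← lintegral_mergeFun _ φ (measurable_crossFun δ L) (measurable_crossFun δ L)]
  calc _ ≤ ∫⁻ _, 1 ∂Measure.pi fun _ : Fin 4 ⊕ freeIdx φ => μ := lintegral_mono h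
    _ = 1 := by simp

end Limits

end RGG

namespace RGG

set_option linter.unusedSectionVars false

/-! ### The distortion -/

section Distortion

variable {d : ℕ} {L : Submodule ℝ (Euc d)} {w : Euc d → Euc d → ℝ} {O W : Set (Euc d)}

theorem measurable_distortion (L : Submodule ℝ (Euc d)) (hw : Measurable (Function.uncurry w)) :
    Measurable fun p : Euc d × Euc d => distortion w L p.1 p.2 := by
  have hp := (continuous_proj L).measurable
  have hw' : Measurable fun p : Euc d × Euc d => w p.1 p.2 := hw
  unfold distortion
  fun_prop

theorem dist_proj_lt {x y : Euc d} (h : x - y ∉ L) : dist (proj L x) (proj L y) < dist x y := by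
  refine (dist_proj_le L x y).lt_of_ne fun heq => h ?_
  have : proj L x - proj L y = L.orthogonalProjectionOnto (x - y) := (map_sub _ _ _).symm
  rw [dist_eq_norm, dist_eq_norm, this] at heq
  exact (L.mem_iff_norm_starProjection _).2 heq

theorem distortion_nonneg (hw : ∀ x ∈ O, ∀ y ∈ O, x ≠ y → 0 < w x y) {x y : Euc d} (hx : x ∈ O)
    (hy : y ∈ O) : 0 ≤ distortion w L x y := by
  unfold distortion
  by_cases h : x = y
  · simp [h]
  · exact mul_nonneg (hw x hx y hy h).le (sq_nonneg _)

theorem distortion_pos (hw : ∀ x ∈ O, ∀ y ∈ O, x ≠ y → 0 < w x y) {x y : Euc d} (hx : x ∈ O)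
    (hy : y ∈ O) (h : x - y ∉ L) : 0 < distortion w L x y := by
  have hne : x ≠ y := by
    rintro rfl
    exact h (by simp)
  exact mul_pos (hw x hx y hy hne) (pow_pos (sub_pos.2 (dist_proj_lt h)) 2)

/-- The distortion of two points of `O`, and zero for other points. -/
noncomputable def stressKer (w : Euc d → Euc d → ℝ) (L : Submodule ℝ (Euc d)) (O : Set (Euc d))
    (a b : Euc d) : ℝ≥0∞ :=
  O.indicator 1 a * O.indicator 1 b * ENNReal.ofReal (distortion w L a b)

theorem stressKer_of_mem {a b : Euc d} (ha : a ∈ O) (hb : b ∈ O) :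
    stressKer w L O a b = ENNReal.ofReal (distortion w L a b) := by
  simp [stressKer, ha, hb]

theorem stressKer_le (a b : Euc d) : stressKer w L O a b ≤ ENNReal.ofReal (distortion w L a b) := by
  unfold stressKer
  by_cases ha : a ∈ O <;> by_cases hb : b ∈ O <;> simp [ha, hb]

theorem stressKer_ne_top (a b : Euc d) : stressKer w L O a b ≠ ∞ :=
  ne_top_of_le_ne_top ENNReal.ofReal_ne_top (stressKer_le a b)

/-- The weight is symmetric and positive only on the set itself. The cut-off makes the kernel
symmetric everywhere, as the marginal lemmas require. -/
theorem stressKer_symm (hw : ∀ x ∈ O, ∀ y ∈ O, w x y = w y x) (a b : Euc d) :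
    stressKer w L O a b = stressKer w L O b a := by
  by_cases ha : a ∈ O
  · by_cases hb : b ∈ O
    · rw [stressKer_of_mem ha hb, stressKer_of_mem hb ha, distortion, distortion, hw a ha b hb,
        dist_comm a b, dist_comm (proj L a)]
    · simp [stressKer, hb]
  · simp [stressKer, ha]

theorem measurable_stressKer (L : Submodule ℝ (Euc d)) (hw : Measurable (Function.uncurry w))
    (hO : MeasurableSet O) :
    Measurable fun p : Euc d × Euc d => stressKer w L O p.1 p.2 := by
  have h1 : Measurable (O.indicator (1 : Euc d → ℝ≥0∞)) := measurable_one.indicator hO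
  exact ((h1.comp measurable_fst).mul (h1.comp measurable_snd)).mul
    (measurable_distortion L hw).ennreal_ofReal

theorem setLIntegral_stressKer_sq_ne_top (hw : Measurable (Function.uncurry w))
    (hO : MeasurableSet O)
    (hsq : IntegrableOn (fun p : Euc d × Euc d => distortion w L p.1 p.2 ^ 2) (O ×ˢ O)) :
    ∫⁻ a in O, ∫⁻ b in O, stressKer w L O a b ^ 2 ≠ ∞ := by
  have hm := (measurable_stressKer L hw hO).pow_const 2
  rw [← lintegral_prod _ hm.aemeasurable, Measure.prod_restrict]
  refine ne_top_of_le_ne_top hsq.2.ne (lintegral_mono fun p => ?_)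
  rw [Real.enorm_eq_ofReal (sq_nonneg _), ← sq_abs, ENNReal.ofReal_pow (abs_nonneg _)]
  exact pow_le_pow_left' ((stressKer_le _ _).trans (ENNReal.ofReal_le_ofReal (le_abs_self _))) 2

/-- A crude form of Cauchy–Schwarz; the constant 2 is harmless because it is used only for
finiteness. -/
theorem sq_lintegral_le {α : Type*} [MeasurableSpace α] {μ : Measure α} [IsProbabilityMeasure μ]
    {f : α → ℝ≥0∞} (hf : Measurable f) : (∫⁻ a, f a ∂μ) ^ 2 ≤ 2 * ∫⁻ a, f a ^ 2 ∂μ := by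
  have h1 : ∀ x y : ℝ≥0∞, x * y ≤ x ^ 2 + y ^ 2 := by
    intro x y
    rw [sq, sq]
    rcases le_total x y with h | h
    · exact le_trans (by gcongr) le_add_self
    · exact le_trans (by gcongr) le_self_add
  calc (∫⁻ a, f a ∂μ) ^ 2 = ∫⁻ a, ∫⁻ b, f a * f b ∂μ ∂μ := by
        simp_rw [lintegral_const_mul _ hf]
        rw [lintegral_mul_const _ hf, sq]
    _ ≤ ∫⁻ a, ∫⁻ b, (f a ^ 2 + f b ^ 2) ∂μ ∂μ :=
        lintegral_mono fun a => lintegral_mono fun b => h1 _ _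
    _ = 2 * ∫⁻ a, f a ^ 2 ∂μ := by
        simp_rw [lintegral_add_left measurable_const, lintegral_const, measure_univ, mul_one]
        rw [lintegral_add_right _ measurable_const, lintegral_const, measure_univ, mul_one, two_mul]

variable {μ : Measure (Euc d)} [IsProbabilityMeasure μ] {g : Euc d → Euc d → ℝ≥0∞}

theorem lintegral_sq_lintegral_ne_top (hg : Measurable fun p : Euc d × Euc d => g p.1 p.2)
    (hg2 : ∫⁻ a, ∫⁻ b, g a b ^ 2 ∂μ ∂μ ≠ ∞) : ∫⁻ a, (∫⁻ b, g a b ∂μ) ^ 2 ∂μ ≠ ∞ := by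
  refine ne_top_of_le_ne_top (ENNReal.mul_ne_top (ENNReal.ofNat_ne_top (n := 2)) hg2) ?_
  rw [← lintegral_const_mul _ (hg.pow_const 2).lintegral_prod_right']
  exact lintegral_mono fun a => sq_lintegral_le
    (hg.comp (f := fun b : Euc d => (a, b)) (by fun_prop))

theorem lintegral_lintegral_ne_top (hg : Measurable fun p : Euc d × Euc d => g p.1 p.2)
    (hg2 : ∫⁻ a, ∫⁻ b, g a b ^ 2 ∂μ ∂μ ≠ ∞) : ∫⁻ a, ∫⁻ b, g a b ∂μ ∂μ ≠ ∞ := by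
  have h := ne_top_of_le_ne_top (ENNReal.mul_ne_top (ENNReal.ofNat_ne_top (n := 2))
    (lintegral_sq_lintegral_ne_top hg hg2)) (sq_lintegral_le hg.lintegral_prod_right')
  simpa using h

end Distortion

/-! ### The integrals in the bound -/

section Integrals

variable {d : ℕ} {L : Submodule ℝ (Euc d)} {w : Euc d → Euc d → ℝ} {W : Set (Euc d)}

theorem setLIntegral_ne_zero {α : Type*} [MeasurableSpace α] {μ : Measure α} {s : Set α}
    {f : α → ℝ≥0∞} (hf : Measurable f) (hμ : μ s ≠ 0)
    (hpos : ∀ a ∈ s, f a ≠ 0) : ∫⁻ a in s, f a ∂μ ≠ 0 := by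
  intro h
  have h1 := (lintegral_eq_zero_iff hf).1 h
  obtain ⟨a, ha, h2⟩ := Measure.exists_mem_of_measure_ne_zero_of_ae hμ h1
  exact hpos a ha h2

/-- The distortion is zero only along directions in `L`. As d ≥ 3, the plane is a proper subspace,
so this excludes a null set of b. -/
theorem setLIntegral_stressKer_ne_zero (hd : 3 ≤ d) (hL : Module.finrank ℝ L = 2)
    (hw : Measurable (Function.uncurry w)) {O : Set (Euc d)} (hO : MeasurableSet O)
    (hv : volume O ≠ 0) (hpos : ∀ x ∈ O, ∀ y ∈ O, x ≠ y → 0 < w x y) {a : Euc d} (ha : a ∈ O) :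
    ∫⁻ b in O, stressKer w L O a b ≠ 0 := by
  intro h
  have hm : Measurable fun b => stressKer w L O a b :=
    (measurable_stressKer L hw hO).comp (f := fun b : Euc d => (a, b)) (by fun_prop)
  have hne : L ≠ ⊤ := by
    rintro rfl
    rw [finrank_top, finrank_euclideanSpace_fin] at hL
    omega
  have hL0 : ∀ᵐ b : Euc d, a - b ∉ L :=
    (Measure.measurePreserving_sub_left volume a).quasiMeasurePreserving.ae
      (measure_eq_zero_iff_ae_notMem.1 (Measure.addHaar_submodule volume L hne))
  obtain ⟨b, hb, h1, h2⟩ := Measure.exists_mem_of_measure_ne_zero_of_ae hv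
    (((lintegral_eq_zero_iff hm).1 h).and (ae_restrict_of_ae hL0))
  have h3 : stressKer w L O a b = 0 := h1
  rw [stressKer_of_mem ha hb, ENNReal.ofReal_eq_zero] at h3
  exact (distortion_pos hpos ha hb h2).not_ge h3

theorem setIntegral_distortion (hw : Measurable (Function.uncurry w)) {O : Set (Euc d)}
    (hO : MeasurableSet O) (hpos : ∀ x ∈ O, ∀ y ∈ O, x ≠ y → 0 < w x y) {a : Euc d}
    (ha : a ∈ O) :
    ∫ b in O, distortion w L a b = (∫⁻ b in O, stressKer w L O a b).toReal := by
  have hm : Measurable fun b => distortion w L a b :=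
    (measurable_distortion L hw).comp (f := fun b : Euc d => (a, b)) (by fun_prop)
  rw [integral_eq_lintegral_of_nonneg_ae
    (ae_restrict_of_forall_mem hO fun b hb => distortion_nonneg hpos ha hb)
    hm.aestronglyMeasurable]
  congr 1
  exact setLIntegral_congr_fun hO fun b hb => (stressKer_of_mem ha hb).symm

theorem stressIntegral_eq_toReal (hW : Convex ℝ W) (hw : Measurable (Function.uncurry w))
    (hpos : ∀ x ∈ interior W, ∀ y ∈ interior W, x ≠ y → 0 < w x y)
    (hfin : ∫⁻ a in interior W, (∫⁻ b in interior W, stressKer w L (interior W) a b) ^ 2 ≠ ∞) :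
    stressIntegral W L w =
      (∫⁻ a in interior W, (∫⁻ b in interior W, stressKer w L (interior W) a b) ^ 2).toReal := by
  have hO := (isOpen_interior (s := W)).measurableSet
  have hm := ((measurable_stressKer L hw hO).lintegral_prod_right'
    (ν := volume.restrict (interior W))).pow_const 2
  rw [stressIntegral, restrict_interior_of_convex hW,
    ← integral_toReal hm.aemeasurable (ae_lt_top hm hfin)]
  refine setIntegral_congr_fun hO fun a ha => ?_
  simp_rw [integral_const_mul, integral_mul_const]
  rw [setIntegral_distortion hw hO hpos ha, ENNReal.toReal_pow, sq]

theorem setIntegral_sectionVol_mul_distortion (hW : Convex ℝ W)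
    (hw : Measurable (Function.uncurry w))
    (hpos : ∀ x ∈ interior W, ∀ y ∈ interior W, x ≠ y → 0 < w x y)
    (hfin : ∫⁻ a in interior W, secVol L (interior W) a *
      ∫⁻ b in interior W, stressKer w L (interior W) a b ≠ ∞) :
    ∫ v in W, ∫ v₁ in W, sectionVol W L v * distortion w L v v₁ =
      (∫⁻ a in interior W, secVol L (interior W) a *
        ∫⁻ b in interior W, stressKer w L (interior W) a b).toReal := by
  have hO := (isOpen_interior (s := W)).measurableSet
  have hm : Measurable fun a => secVol L (interior W) a *
      ∫⁻ b in interior W, stressKer w L (interior W) a b := (measurable_secVol hO).mul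
    ((measurable_stressKer L hw hO).lintegral_prod_right' (ν := volume.restrict (interior W)))
  rw [restrict_interior_of_convex hW,
    ← integral_toReal hm.aemeasurable (ae_lt_top hm hfin)]
  refine setIntegral_congr_ae hO ?_
  filter_upwards [ae_section_notMem' (L := L) (hW.addHaar_frontier volume)] with a ha haO
  rw [integral_const_mul, setIntegral_distortion hw hO hpos haO, ENNReal.toReal_mul,
    toReal_secVol_interior ha]

/-- Sections of W and of its interior differ by frontier points, hence agree in volume for almost
every v; outside the projection of W they are empty, so the integral extends to the whole plane. -/
theorem sectionIntegral_eq_toReal (hW : Convex ℝ W) {R : ℝ}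
    (hR : interior W ⊆ Metric.closedBall 0 R) :
    sectionIntegral W L = (∫⁻ a in interior W, secVol L (interior W) a ^ 2).toReal := by
  have hO := (isOpen_interior (s := W)).measurableSet
  have hm : Measurable fun v : L => secVol L (interior W) v ^ 3 :=
    ((measurable_secVol hO).comp measurable_subtype_coe).pow_const 3
  have hfin : ∀ a, secVol L (interior W) a ≠ ∞ := fun a =>
    ne_top_of_le_ne_top (volume_closedBall_ne_top R) (secVol_le hO hR a)
  rw [setLIntegral_secVol_sq hO, sectionIntegral, setIntegral_eq_integral_of_forall_compl_eq_zero,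
    ← integral_toReal hm.aemeasurable (Eventually.of_forall fun v =>
      ENNReal.pow_lt_top (hfin v).lt_top)]
  · refine integral_congr_ae ?_
    filter_upwards [ae_section_notMem (L := L) (hW.addHaar_frontier volume)] with v hv
    rw [ENNReal.toReal_pow, toReal_secVol_interior hv]
  · intro v hv
    have : {u : Lᗮ | (v : Euc d) + u ∈ W} = ∅ := by
      refine eq_empty_of_forall_notMem fun u hu => hv ⟨_, hu, ?_⟩
      rw [proj_add, proj_coe, proj_coe_orthogonal, add_zero]
    simp [sectionVol, this]

end Integrals

/-! ### Crossing number and stress as sums over tuples -/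

section Statistics

variable {d : ℕ} {L : Submodule ℝ (Euc d)} {w : Euc d → Euc d → ℝ} {O W : Set (Euc d)}

theorem toReal_tupleSum {k : ℕ} {F : (Fin k → Euc d) → ℝ≥0∞} (hF : ∀ v, F v ≠ ∞)
    (V : Finset (Euc d)) : (tupleSum F V).toReal = ∑ v ∈ distinctTuples k V, (F v).toReal := by
  rw [tupleSum, ENNReal.toReal_sum fun v _ => hF v]
  refine Finset.sum_congr ?_ fun _ _ => rfl
  ext v
  simp only [distinctTuples, Finset.mem_filter, Fintype.mem_piFinset]

theorem crossingNumber_eq (δ : ℝ) (L : Submodule ℝ (Euc d)) (V : Finset (Euc d)) :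
    crossingNumber δ L V = 1 / 8 * (tupleSum (crossFun δ L) V).toReal := by
  rw [toReal_tupleSum fun v => ne_top_of_le_ne_top ENNReal.one_ne_top (crossFun_le_one δ L v),
    crossingNumber, uStat]
  congr 1
  refine Finset.sum_congr rfl fun v _ => ?_
  rw [crossFun, crossInd]
  by_cases h : Crosses δ L (v 0) (v 1) (v 2) (v 3)
  · rw [if_pos h, if_pos ((crosses_iff δ L _ _ _ _).1 h), ENNReal.toReal_one]
  · rw [if_neg h, if_neg fun h' => h ((crosses_iff δ L _ _ _ _).2 h'), ENNReal.toReal_zero]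

theorem stress_eq (hpos : ∀ x ∈ O, ∀ y ∈ O, x ≠ y → 0 < w x y) {V : Finset (Euc d)}
    (hV : ∀ v ∈ V, v ∈ O) :
    stress w L V = 1 / 2 * (tupleSum (pairFun (stressKer w L O)) V).toReal := by
  rw [toReal_tupleSum (F := pairFun (stressKer w L O)) fun v => stressKer_ne_top (v 0) (v 1),
    stress, uStat]
  congr 1
  refine Finset.sum_congr rfl fun v hv => ?_
  have hvO : ∀ i, v i ∈ O := by
    intro i
    rw [distinctTuples, Finset.mem_filter, Fintype.mem_piFinset] at hv
    exact hV _ (hv.1 i)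
  rw [pairFun, stressKer_of_mem (hvO 0) (hvO 1),
    ENNReal.toReal_ofReal (distortion_nonneg hpos (hvO 0) (hvO 1))]

theorem IsPoissonSample.interior {Ω : Type*} [MeasurableSpace Ω] {P : Measure Ω} {t : ℝ}
    {N : Ω → ℕ} {X : ℕ → Ω → Euc d} (h : IsPoissonSample P t W N X) (hW : Convex ℝ W)
    (hW1 : volume W = 1) : IsPoissonSample P t (interior W) N X where
  measurable_count := h.measurable_count
  measurable_point := h.measurable_point
  law_count := h.law_count
  law_point i := by
    have := h.law_point i
    unfold pdf.IsUniform ProbabilityTheory.cond at this ⊢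
    rw [this, volume_interior_of_convex hW hW1, hW1, restrict_interior_of_convex hW]
  indep_points := h.indep_points
  indep_count := h.indep_count

end Statistics

end RGG

namespace RGG

/-! ### The correlation coefficient -/

section Correlation

variable {d : ℕ} {L : Submodule ℝ (Euc d)} {w : Euc d → Euc d → ℝ} {O : Set (Euc d)}

theorem div_sqrt_mul_sqrt_eq {C V S a b c : ℝ} (ha : 0 < a) (hc : 0 < c) (hb : b = √a * √c) :
    1 / 16 * C / (√(1 / 64 * V) * √(1 / 4 * S)) = C / b / (√(V / a) * √(S / c)) := by
  have h1 : √(1 / 64 : ℝ) = 1 / 8 := by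
    rw [show (1 / 64 : ℝ) = (1 / 8) ^ 2 by norm_num, Real.sqrt_sq (by norm_num)]
  have h2 : √(1 / 4 : ℝ) = 1 / 2 := by
    rw [show (1 / 4 : ℝ) = (1 / 2) ^ 2 by norm_num, Real.sqrt_sq (by norm_num)]
  have ha' := Real.sqrt_pos.2 ha
  have hc' := Real.sqrt_pos.2 hc
  rw [Real.sqrt_mul (by norm_num), Real.sqrt_mul (by norm_num), h1, h2, Real.sqrt_div' _ ha.le,
    Real.sqrt_div' _ hc.le, hb]
  -- Division by zero is zero, so both sides vanish in the degenerate cases.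
  by_cases hV : √V = 0
  · simp [hV]
  by_cases hS : √S = 0
  · simp [hS]
  field_simp
  ring

/-- The normalisation of the covariance is the geometric mean of those of the two variances; hence
the correlation has a limit without further scaling. -/
theorem sqrt_mul_sqrt_eq {t δ : ℝ} (ht : 0 < t) (hδ : 0 < δ) (d : ℕ) :
    t ^ 5 * δ ^ (2 * d + 2) = √(t ^ 7 * δ ^ (4 * d + 4)) * √(t ^ 3) := by
  rw [← Real.sqrt_mul (by positivity), eq_comm, Real.sqrt_eq_iff_mul_self_eq (by positivity)
    (by positivity)]
  ring

/-- The factors 1/16, 1/64 and 1/4 come from the prefactors 1/8 and 1/2 of the statistics. The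
stress agrees with the cut-off kernel sum only almost surely, namely when all points lie in O. -/
theorem IsPoissonSample.corr_crossingNumber_stress {Ω : Type*} [MeasurableSpace Ω]
    {P : Measure Ω} {t : ℝ} {N : Ω → ℕ} {X : ℕ → Ω → Euc d}
    [NullSingletonClass (volume : Measure (Euc d))]
    [IsProbabilityMeasure ((volume : Measure (Euc d)).restrict O)]
    (h : IsPoissonSample P t O N X) (ht : 0 < t) (hO : MeasurableSet O) (h1 : volume O = 1)
    (hw : Measurable (Function.uncurry w)) (hsymm : ∀ x ∈ O, ∀ y ∈ O, w x y = w y x)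
    (hpos : ∀ x ∈ O, ∀ y ∈ O, x ≠ y → 0 < w x y)
    (hg2 : ∫⁻ a in O, ∫⁻ b in O, stressKer w L O a b ^ 2 ≠ ∞) (δ : ℝ) :
    corr P (fun ω => crossingNumber δ L (pointSet N X ω)) (fun ω => stress w L (pointSet N X ω)) =
      1 / 16 * covSum (volume.restrict O) t (crossFun δ L) (pairFun (stressKer w L O)) /
      (√(1 / 64 * covSum (volume.restrict O) t (crossFun δ L) (crossFun δ L)) *
        √(1 / 4 * covSum (volume.restrict O) t (pairFun (stressKer w L O))
          (pairFun (stressKer w L O)))) := by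
  have hg := measurable_stressKer L hw hO
  have hs := stressKer_symm (L := L) hsymm
  have hf := measurable_crossFun δ L
  have hG := measurable_pairFun hg
  have hff : ∀ φ ∈ matchings (Fin 4) (Fin 4),
      pairTerm (volume.restrict O) φ (crossFun δ L) (crossFun δ L) ≠ ∞ :=
    fun φ _ => pairTerm_crossFun_ne_top δ φ
  have hgg : ∀ φ ∈ matchings (Fin 2) (Fin 2), pairTerm (volume.restrict O) φ
      (pairFun (stressKer w L O)) (pairFun (stressKer w L O)) ≠ ∞ := fun φ hφ =>
    pairTerm_pairFun_ne_top hg hs (lintegral_lintegral_ne_top hg hg2)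
      (lintegral_sq_lintegral_ne_top hg hg2) hg2 hφ
  have hcr : (fun ω => crossingNumber δ L (pointSet N X ω)) =
      fun ω => 1 / 8 * (tupleSum (crossFun δ L) (pointSet N X ω)).toReal :=
    funext fun ω => crossingNumber_eq δ L _
  have hst : (fun ω => stress w L (pointSet N X ω)) =ᵐ[P]
      fun ω => 1 / 2 * (tupleSum (pairFun (stressKer w L O)) (pointSet N X ω)).toReal := by
    filter_upwards [h.ae_mem h1 hO.nullMeasurableSet] with ω hω
    exact stress_eq hpos hω
  have hcov : ∀ Y Z Z' : Ω → ℝ, Z =ᵐ[P] Z' → covariance Y Z P = covariance Y Z' P := by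
    intro Y Z Z' hZ
    unfold covariance
    rw [integral_congr_ae hZ]
    refine integral_congr_ae ?_
    filter_upwards [hZ] with ω hω
    rw [hω]
  have hYm := (h.aemeasurable_tupleSum h1 hf).ennreal_toReal
  have hZm := (h.aemeasurable_tupleSum h1 hG).ennreal_toReal
  rw [corr, hcr, hcov _ _ _ hst, variance_congr hst, covariance_const_mul_left,
    covariance_const_mul_right, variance_const_mul, variance_const_mul, ← covariance_self hYm,
    ← covariance_self hZm, h.covariance_tupleSum ht h1 hf hG hff hgg,
    h.covariance_tupleSum ht h1 hf hf hff hff, h.covariance_tupleSum ht h1 hG hG hgg hgg]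
  congr 1
  · ring
  · norm_num

theorem limit_eq {A S I H c ℓ : ℝ} (hc : 0 < c) (hH : 0 ≤ H)
    (hℓ : 0 ≤ ℓ) :
    8 * (c * A) / (√(16 * (c ^ 2 * I) + 8 * ℓ * (H * I)) * √(4 * S)) =
      A / (√(1 + H / (2 * c ^ 2) * ℓ) * √I * √S) := by
  have h1 : 16 * (c ^ 2 * I) + 8 * ℓ * (H * I) = (4 * c) ^ 2 * ((1 + H / (2 * c ^ 2) * ℓ) * I) := by
    field_simp
    ring
  have h2 : 4 * S = 2 ^ 2 * S := by norm_num
  rw [h1, h2, Real.sqrt_mul (by positivity), Real.sqrt_mul (by positivity),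
    Real.sqrt_mul (by positivity), Real.sqrt_sq (by positivity), Real.sqrt_sq (by positivity)]
  rw [show 8 * (c * A) = (8 * c) * A by ring, show 4 * c * (√(1 + H / (2 * c ^ 2) * ℓ) * √I) *
    (2 * √S) = (8 * c) * (√(1 + H / (2 * c ^ 2) * ℓ) * √I * √S) by ring]
  exact mul_div_mul_left _ _ (by positivity)

end Correlation

end RGG

theorem mainTheorem5 {d : ℕ} (hd : 3 ≤ d)
    (W : Set (Euc d)) (hW_convex : Convex ℝ W) (hW_volume : volume W = 1)
    (L : Submodule ℝ (Euc d)) (hL : Module.finrank ℝ L = 2)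
    (w : Euc d → Euc d → ℝ) (hw_meas : Measurable (Function.uncurry w))
    (hw_symm : ∀ x ∈ W, ∀ y ∈ W, w x y = w y x)
    (hw_pos : ∀ x ∈ W, ∀ y ∈ W, x ≠ y → 0 < w x y)
    (hw_sq : IntegrableOn (fun p : Euc d × Euc d => RGG.distortion w L p.1 p.2 ^ 2) (W ×ˢ W))
    (δ : ℝ → ℝ) (hδ_pos : ∀ t, 0 < t → 0 < δ t) (hδ_zero : Tendsto δ atTop (𝓝 0))
    (ℓ : ℝ) (hℓ : Tendsto (fun t => 1 / (t * δ t ^ d)) atTop (𝓝 ℓ))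
    {Ω : ℝ → Type*} [∀ t, MeasurableSpace (Ω t)] (P : ∀ t, Measure (Ω t))
    (N : ∀ t, Ω t → ℕ) (X : ∀ t, ℕ → Ω t → Euc d)
    (hV : ∀ t, 0 < t → RGG.IsPoissonSample (P t) t W (N t) (X t)) :
    0 < RGG.corrBound W L w ℓ ∧
      ∃ r : ℝ,
        Tendsto (fun t => RGG.corr (P t)
            (fun ω => RGG.crossingNumber (δ t) L (RGG.pointSet (N t) (X t) ω))
            (fun ω => RGG.stress w L (RGG.pointSet (N t) (X t) ω)))
          atTop (𝓝 r) ∧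
        RGG.corrBound W L w ℓ ≤ r := by
  have : Nontrivial (Euc d) := Module.nontrivial_of_finrank_pos (R := ℝ)
    (by rw [finrank_euclideanSpace_fin]; omega)
  set O := interior W with hOdef
  have hO : IsOpen O := isOpen_interior
  have hOW : O ⊆ W := interior_subset
  have hO1 : volume O = 1 := RGG.volume_interior_of_convex hW_convex hW_volume
  have hOne : volume O ≠ 0 := by rw [hO1]; exact one_ne_zero
  have : IsProbabilityMeasure ((volume : Measure (Euc d)).restrict O) := ⟨by simpa using hO1⟩
  obtain ⟨R, hR⟩ := (RGG.isBounded_of_convex_of_volume_ne_top hW_convex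
    (by rw [hW_volume]; exact ENNReal.one_ne_top)
    (RGG.interior_nonempty_of_convex hW_convex hW_volume)).subset_closedBall 0
  have hOR : O ⊆ Metric.closedBall 0 R := hOW.trans hR
  have hOf : volume (frontier O) = 0 :=
    measure_mono_null frontier_interior_subset (hW_convex.addHaar_frontier volume)
  have hsymm : ∀ x ∈ O, ∀ y ∈ O, w x y = w y x := fun x hx y hy =>
    hw_symm x (hOW hx) y (hOW hy)
  have hpos : ∀ x ∈ O, ∀ y ∈ O, x ≠ y → 0 < w x y := fun x hx y hy =>
    hw_pos x (hOW hx) y (hOW hy)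
  have hg := RGG.measurable_stressKer L hw_meas hO.measurableSet
  have hgs := RGG.stressKer_symm (L := L) hsymm
  have hg2 := RGG.setLIntegral_stressKer_sq_ne_top hw_meas hO.measurableSet
    (hw_sq.mono_set (Set.prod_mono hOW hOW))
  have hg1 := RGG.lintegral_lintegral_ne_top hg hg2
  have hS_top := RGG.lintegral_sq_lintegral_ne_top hg hg2
  have hI_top := RGG.setLIntegral_secVol_pow_ne_top (L := L) hO.measurableSet hOR 2
  have hσm := RGG.measurable_secVol (L := L) hO.measurableSet
  have hgm : Measurable fun a => ∫⁻ b in O, RGG.stressKer w L O a b := hg.lintegral_prod_right'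
  have hA_top : ∫⁻ a in O, RGG.secVol L O a * ∫⁻ b in O, RGG.stressKer w L O a b ≠ ∞ := by
    refine ne_top_of_le_ne_top (b := volume (Metric.closedBall (0 : Lᗮ) R) *
      ∫⁻ a in O, ∫⁻ b in O, RGG.stressKer w L O a b)
      (ENNReal.mul_ne_top (RGG.volume_closedBall_ne_top R) hg1) ?_
    rw [← lintegral_const_mul _ hgm]
    refine lintegral_mono fun a => ?_
    gcongr
    exact RGG.secVol_le hO.measurableSet hOR a
  have hσ_ne : ∀ a ∈ O, RGG.secVol L O a ≠ 0 := fun a ha => (RGG.secVol_pos hO ha).ne'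
  have hg_ne : ∀ a ∈ O, ∫⁻ b in O, RGG.stressKer w L O a b ≠ 0 := fun a ha =>
    RGG.setLIntegral_stressKer_ne_zero hd hL hw_meas hO.measurableSet hOne hpos ha
  have hA_pos := ENNReal.toReal_pos (RGG.setLIntegral_ne_zero (hσm.mul hgm) hOne
    fun a ha => mul_ne_zero (hσ_ne a ha) (hg_ne a ha)) hA_top
  have hI_pos := ENNReal.toReal_pos (RGG.setLIntegral_ne_zero (hσm.pow_const 2) hOne
    fun a ha => pow_ne_zero 2 (hσ_ne a ha)) hI_top
  have hS_pos := ENNReal.toReal_pos (RGG.setLIntegral_ne_zero (hgm.pow_const 2) hOne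
    fun a ha => pow_ne_zero 2 (hg_ne a ha)) hS_top
  have hc_pos := RGG.crossConst_pos hL
  have hκ : 0 ≤ RGG.kappa d := ENNReal.toReal_nonneg
  have hH := RGG.toReal_edgeIntPow_two_le hL
  have hH0 : 0 ≤ (RGG.edgeIntPow L 2).toReal := ENNReal.toReal_nonneg
  have hδ : Tendsto δ atTop (𝓝[>] 0) := tendsto_nhdsWithin_iff.2
    ⟨hδ_zero, (eventually_gt_atTop 0).mono hδ_pos⟩
  have hℓ0 : 0 ≤ ℓ := by
    refine ge_of_tendsto hℓ ((eventually_gt_atTop 0).mono fun t ht => ?_)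
    have := hδ_pos t ht
    positivity
  have hbound := RGG.setIntegral_sectionVol_mul_distortion hW_convex hw_meas hpos hA_top
  rw [RGG.corrBound, hbound, RGG.stressIntegral_eq_toReal hW_convex hw_meas hpos hS_top,
    RGG.sectionIntegral_eq_toReal hW_convex hOR]
  have hvar := RGG.tendsto_covSum_crossFun hd hL hO hOf hOR hδ hℓ
  have hcov := RGG.tendsto_covSum_crossFun_pairFun hd hL hO hOf hOR hg hgs hg1 hg2 hδ hℓ
  have hvar' := RGG.tendsto_covSum_pairFun (μ := volume.restrict O) hg hgs
  rw [ENNReal.toReal_mul, ENNReal.toReal_mul, ENNReal.toReal_pow,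
    ← RGG.crossConst_eq_toReal] at hvar
  rw [ENNReal.toReal_mul, ← RGG.crossConst_eq_toReal] at hcov
  set c := RGG.crossConst L
  set H := (RGG.edgeIntPow L 2).toReal
  set A := (∫⁻ a in O, RGG.secVol L O a * ∫⁻ b in O, RGG.stressKer w L O a b).toReal
  set I := (∫⁻ a in O, RGG.secVol L O a ^ 2).toReal
  set S := (∫⁻ a in O, (∫⁻ b in O, RGG.stressKer w L O a b) ^ 2).toReal
  -- The exact limit; H ≤ 4πκ_d c enters only in the comparison with the bound.
  refine ⟨by positivity, A / (√(1 + H / (2 * c ^ 2) * ℓ) * √I * √S), ?_, ?_⟩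
  · rw [← RGG.limit_eq hc_pos hH0 hℓ0]
    refine (hcov.div (hvar.sqrt.mul hvar'.sqrt) (by positivity)).congr' ?_
    filter_upwards [eventually_gt_atTop 0] with t ht
    have hδt := hδ_pos t ht
    rw [((hV t ht).interior hW_convex hW_volume).corr_crossingNumber_stress ht hO.measurableSet hO1
      hw_meas hsymm hpos hg2, RGG.div_sqrt_mul_sqrt_eq (by positivity) (by positivity)
      (RGG.sqrt_mul_sqrt_eq ht hδt d)]
    rfl
  · have hle : H / (2 * c ^ 2) ≤ 2 * Real.pi * RGG.kappa d / c := by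
      rw [div_le_div_iff₀ (by positivity) hc_pos]
      calc H * c ≤ 4 * Real.pi * RGG.kappa d * c * c := by gcongr
        _ = _ := by ring
    gcongr
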